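/- Let $k$ be a field of characteristic $0$ and $q\in k^\times$ with $q^2\neq-1$. For finite-dimensional $A,B$ and a linear map $T:A\otimes B\to B\otimes A$, $T(a_i\otimes b_j)=\sum T_{ij}^{kl}\,b_k\otimes a_l$ (in bases), let $T^\sharp:B\otimes A^*\to A^*\otimes B$ be the map $b_i\otimes a^j\mapsto\sum T_{ki}^{lj}\,a^k\otimes b_l$, where $(a^j)$ is the dual basis. A Hecke $\check R$-matrix (with parameter $q$) on a finite-dimensional space $V$ is an invertible linear map $R:V\otimes V\to V\otimes V$ with $R^\sharp$ invertible, satisfying $(R\otimes1)(1\otimes R)(R\otimes1)=(1\otimes R)(R\otimes1)(1\otimes R)$ and $(R-q)(R+q^{-1})=0$. The Koszul complex $K(V)=\bigoplus_{n,m\ge0}K^{n,m}(V)$ is the bigraded algebra generated by $V$ (in degree $(1,0)$) and $V^*$ (in degree $(0,1)$) with relations $R(v\otimes\bar v)=-q^{-1}v\otimes\bar v$, $R^\sharp(v\otimes v')=q\,v\otimes v'$, $R^{\sharp\sharp}(v'\otimes\bar v')=q\,v'\otimes\bar v'$ for $v,\bar v\in V$, $v',\bar v'\in V^*$. Its differential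 $D_V$, of degree $(1,1)$, is left multiplication by $\sum_i v^iv_i$, where $(v_i)$ is a basis of $V$ and $(v^i)$ the dual basis. The Berezinian is the bigraded cohomology space $\operatorname{Ber}(V)=H(K(V),D_V)$. Let $R$ on $V$ and $R'$ on $U$ be Hecke $\check R$-matrices with the same parameter $q$, and let $Q:U\otimes V\to V\otimes U$ be a linear bijection with $Q^\sharp$ and $(Q^{-1})^\sharp$ invertible such that $$(1\otimes Q)(Q\otimes1)(1\otimes R)=(R\otimes1)(1\otimes Q)(Q\otimes1),\qquad (Q\otimes1)(1\otimes Q)(R'\otimes1)=(1\otimes R')(Q\otimes1)(1\otimes Q).$$ The Hecke sum $X=V\oplus_QU$ is the space $V\oplus U$ with the $\check R$-matrix $\mathcal R$ given by $\mathcal R(v\otimes\bar v)=R(v\otimes\bar v)$, $\mathcal R(v\otimes u)=Q^{-1}(v\otimes u)$, $\mathcal R(u\otimes v)=Q(u\otimes v)+(q-q^{-1})\,u\otimes v$, $\mathcal R(u\otimes\bar u)=R'(u\otimes\bar u)$ for $v,\bar v\in V$, $u,\bar u\in U$; identify $X^*$ with $V^*\oplus U^*$. **Theorem.** The maps $D_V$,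 $D_U$, $D_X$ square to zero. There is a unique linear map $\phi:K(V)\otimes K(U)\to K(V\oplus_QU)$ such that $$\phi\bigl(v'_1\cdots v'_m\,y_1\cdots y_n\otimes w\bigr)=v'_1\cdots v'_m\,y_1\cdots y_n\,w$$ for all $m,n\ge0$, $v'_a\in V^*$, $y_b\in V$ and all products $w$ of elements of $U$ and $U^*$ (on the left the products are taken in $K(V)$ and in $K(U)$, on the right in $K(V\oplus_QU)$). Moreover: (a) $\phi$ is an isomorphism of bigraded vector spaces and of complexes, that is, $$D_{V\oplus_QU}\circ\phi=\phi\circ\bigl(D_V\otimes1+(-1)^n\otimes D_U\bigr)\quad\text{on }K^{n,m}(V)\otimes K^{i,j}(U),\quad n,m,i,j\ge0.$$ (b) $\phi^{-1}$ induces an isomorphism of bigraded vector spaces $\operatorname{Ber}(V\oplus_QU)\cong\operatorname{Ber}(V)\otimes\operatorname{Ber}(U)$, which sends the class of $\phi(x\otimes y)$ to $[x]\otimes[y]$ for all $x\in\operatorname{Ker}D_V$, $y\in\operatorname{Ker}D_U$. -/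

import Mathlib

open scoped TensorProduct

noncomputable section

namespace HeckeKoszul

open Module

section Sharp

variable {k : Type*} [Field k] {A : Type*} [AddCommGroup A] [Module k A]
  {B : Type*} [AddCommGroup B] [Module k B]

/-- Contraction of the second tensor factor with a linear functional: `b ⊗ a ↦ α(a) b`. -/
def contractRight (α : Dual k A) : B ⊗[k] A →ₗ[k] B :=
  (TensorProduct.rid k B).toLinearMap ∘ₗ LinearMap.lTensor B α

/-- The bilinear map sending `b` and `α` to the linear map `a ↦ (1 ⊗ α)(T (a ⊗ b))` from
`A` to `B`. -/
def sharpAux (T : A ⊗[k] B →ₗ[k] B ⊗[k] A) : B →ₗ[k] Dual k A →ₗ[k] (A →ₗ[k] B) :=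
  LinearMap.mk₂ k
    (fun b α => contractRight α ∘ₗ T ∘ₗ (TensorProduct.mk k A B).flip b)
    (fun b b' α => by ext a; simp)
    (fun c b α => by ext a; simp)
    (fun b α α' => by ext a; simp [contractRight, LinearMap.lTensor_add])
    (fun c b α => by ext a; simp [contractRight, LinearMap.lTensor_smul])

/-- For `T : A ⊗ B → B ⊗ A`, the map `T♯ : B ⊗ A* → A* ⊗ B`.
If `T (a_i ⊗ b_j) = ∑ T_{ij}^{kl} b_k ⊗ a_l`, then
`T♯ (b_i ⊗ a^j) = ∑ T_{ki}^{lj} a^k ⊗ b_l`; in other words `T♯ (b ⊗ α)` is the element of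
`A* ⊗ B ≃ Hom(A, B)` that corresponds to `a ↦ (1 ⊗ α)(T (a ⊗ b))`. -/
def sharp [FiniteDimensional k A] (T : A ⊗[k] B →ₗ[k] B ⊗[k] A) :
    B ⊗[k] Dual k A →ₗ[k] Dual k A ⊗[k] B :=
  (dualTensorHomEquiv k A B).symm.toLinearMap ∘ₗ TensorProduct.lift (sharpAux T)

end Sharp

section Hecke

variable {k : Type*} [Field k]

/-- The map `1 ⊗ T : A ⊗ B ⊗ C → A ⊗ D ⊗ E`, with triple tensor products bracketed to
the left. (The map `T ⊗ 1` is Mathlib's `LinearMap.rTensor`.) -/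
def oneTensor (A : Type*) [AddCommGroup A] [Module k A]
    {B : Type*} [AddCommGroup B] [Module k B] {C : Type*} [AddCommGroup C] [Module k C]
    {D : Type*} [AddCommGroup D] [Module k D] {E : Type*} [AddCommGroup E] [Module k E]
    (T : B ⊗[k] C →ₗ[k] D ⊗[k] E) : (A ⊗[k] B) ⊗[k] C →ₗ[k] (A ⊗[k] D) ⊗[k] E :=
  (TensorProduct.assoc k A D E).symm.toLinearMap ∘ₗ LinearMap.lTensor A T ∘ₗ
    (TensorProduct.assoc k A B C).toLinearMap

variable {V : Type*} [AddCommGroup V] [Module k V] {U : Type*} [AddCommGroup U] [Module k U]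

/-- `R : V ⊗ V → V ⊗ V` is a Hecke R-matrix with parameter `q`: it is invertible, obeys the
braid relation and `(R - q)(R + q⁻¹) = 0`, and `R♯` is invertible; here `q ≠ 0`, `q² ≠ -1`. -/
structure IsHecke [FiniteDimensional k V] (q : k) (R : V ⊗[k] V →ₗ[k] V ⊗[k] V) : Prop where
  q_ne_zero : q ≠ 0
  q_sq_ne : q ^ 2 ≠ -1
  bijective : Function.Bijective R
  braid :
    LinearMap.rTensor V R ∘ₗ oneTensor V R ∘ₗ LinearMap.rTensor V R =
      oneTensor V R ∘ₗ LinearMap.rTensor V R ∘ₗ oneTensor V R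
  quadratic : (R - q • LinearMap.id) ∘ₗ (R + q⁻¹ • LinearMap.id) = 0
  sharp_bijective : Function.Bijective (sharp R)

/-- The conditions on a bijective map `Q : U ⊗ V → V ⊗ U` under which the Hecke R-matrices
`R` on `V` and `R'` on `U` have a Hecke sum along `Q`. -/
structure IsGluing [FiniteDimensional k V] [FiniteDimensional k U]
    (R : V ⊗[k] V →ₗ[k] V ⊗[k] V) (R' : U ⊗[k] U →ₗ[k] U ⊗[k] U)
    (Q : U ⊗[k] V ≃ₗ[k] V ⊗[k] U) : Prop where
  compat_left :
    oneTensor V Q.toLinearMap ∘ₗ LinearMap.rTensor V Q.toLinearMap ∘ₗ oneTensor U R =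
      LinearMap.rTensor U R ∘ₗ oneTensor V Q.toLinearMap ∘ₗ LinearMap.rTensor V Q.toLinearMap
  compat_right :
    LinearMap.rTensor U Q.toLinearMap ∘ₗ oneTensor U Q.toLinearMap ∘ₗ LinearMap.rTensor V R' =
      oneTensor V R' ∘ₗ LinearMap.rTensor U Q.toLinearMap ∘ₗ oneTensor U Q.toLinearMap
  sharp_bijective : Function.Bijective (sharp Q.toLinearMap)
  sharp_symm_bijective : Function.Bijective (sharp Q.symm.toLinearMap)

/-- The R-matrix of the Hecke sum `X = V ⊕_Q U`: on `X ⊗ X` it acts by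
`v ⊗ v₁ ↦ R (v ⊗ v₁)`, `v ⊗ u ↦ Q⁻¹ (v ⊗ u)`, `u ⊗ v ↦ Q (u ⊗ v) + (q - q⁻¹) u ⊗ v`,
`u ⊗ u₁ ↦ R' (u ⊗ u₁)`. -/
def heckeSum (q : k) (R : V ⊗[k] V →ₗ[k] V ⊗[k] V) (R' : U ⊗[k] U →ₗ[k] U ⊗[k] U)
    (Q : U ⊗[k] V ≃ₗ[k] V ⊗[k] U) : (V × U) ⊗[k] (V × U) →ₗ[k] (V × U) ⊗[k] (V × U) :=
  let iV := LinearMap.inl k V U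
  let iU := LinearMap.inr k V U
  let pV := LinearMap.fst k V U
  let pU := LinearMap.snd k V U
  TensorProduct.map iV iV ∘ₗ R ∘ₗ TensorProduct.map pV pV
    + TensorProduct.map iU iV ∘ₗ Q.symm.toLinearMap ∘ₗ TensorProduct.map pV pU
    + (TensorProduct.map iV iU ∘ₗ Q.toLinearMap + (q - q⁻¹) • TensorProduct.map iU iV) ∘ₗ
        TensorProduct.map pU pV
    + TensorProduct.map iU iU ∘ₗ R' ∘ₗ TensorProduct.map pU pU

end Hecke

section Koszul

variable {k : Type*} [Field k] {V : Type*} [AddCommGroup V] [Module k V]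

/-- The map `A ⊗ B → S`, `a ⊗ b ↦ f a * g b`, to an algebra `S`. -/
def tensorMul {A : Type*} [AddCommGroup A] [Module k A] {B : Type*} [AddCommGroup B] [Module k B]
    {S : Type*} [Ring S] [Algebra k S] (f : A →ₗ[k] S) (g : B →ₗ[k] S) : A ⊗[k] B →ₗ[k] S :=
  LinearMap.mul' k S ∘ₗ TensorProduct.map f g

/-- The inclusion of `V` in the tensor algebra of `V ⊕ V*`. -/
def genT (k V : Type*) [Field k] [AddCommGroup V] [Module k V] :
    V →ₗ[k] TensorAlgebra k (V × Dual k V) :=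
  TensorAlgebra.ι k ∘ₗ LinearMap.inl k V (Dual k V)

/-- The inclusion of `V*` in the tensor algebra of `V ⊕ V*`. -/
def dualGenT (k V : Type*) [Field k] [AddCommGroup V] [Module k V] :
    Dual k V →ₗ[k] TensorAlgebra k (V × Dual k V) :=
  TensorAlgebra.ι k ∘ₗ LinearMap.inr k V (Dual k V)

variable [FiniteDimensional k V]

/-- The defining relations of the Koszul complex: `R (v ⊗ v₁) = -q⁻¹ v ⊗ v₁`,
`R♯ (v ⊗ ξ) = q v ⊗ ξ` and `R♯♯ (ξ ⊗ ξ₁) = q ξ ⊗ ξ₁` for `v, v₁ ∈ V` and `ξ, ξ₁ ∈ V*`. -/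
inductive KoszulRel (q : k) (R : V ⊗[k] V →ₗ[k] V ⊗[k] V) :
    TensorAlgebra k (V × Dual k V) → TensorAlgebra k (V × Dual k V) → Prop
  | ext (v v₁ : V) : KoszulRel q R
      (tensorMul (genT k V) (genT k V) (R (v ⊗ₜ v₁)))
      (-q⁻¹ • (genT k V v * genT k V v₁))
  | mixed (v : V) (ξ : Dual k V) : KoszulRel q R
      (tensorMul (dualGenT k V) (genT k V) (sharp R (v ⊗ₜ ξ)))
      (q • (genT k V v * dualGenT k V ξ))
  | sym (ξ ξ₁ : Dual k V) : KoszulRel q R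
      (tensorMul (dualGenT k V) (dualGenT k V) (sharp (sharp R) (ξ ⊗ₜ ξ₁)))
      (q • (dualGenT k V ξ * dualGenT k V ξ₁))

/-- The Koszul complex `K(V)` of a Hecke R-matrix, as an algebra: the quotient of the tensor
algebra of `V ⊕ V*` by the two-sided ideal of the Koszul relations. -/
def Koszul (q : k) (R : V ⊗[k] V →ₗ[k] V ⊗[k] V) := RingQuot (KoszulRel q R)

instance instRingKoszul (q : k) (R : V ⊗[k] V →ₗ[k] V ⊗[k] V) : Ring (Koszul q R) :=
  inferInstanceAs (Ring (RingQuot (KoszulRel q R)))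

instance instAlgebraKoszul (q : k) (R : V ⊗[k] V →ₗ[k] V ⊗[k] V) : Algebra k (Koszul q R) :=
  inferInstanceAs (Algebra k (RingQuot (KoszulRel q R)))

/-- The projection of the tensor algebra of `V ⊕ V*` onto `K(V)`. -/
def proj (q : k) (R : V ⊗[k] V →ₗ[k] V ⊗[k] V) :
    TensorAlgebra k (V × Dual k V) →ₐ[k] Koszul q R :=
  RingQuot.mkAlgHom k (KoszulRel q R)

/-- The canonical map `V → K(V)`. -/
def gen (q : k) (R : V ⊗[k] V →ₗ[k] V ⊗[k] V) : V →ₗ[k] Koszul q R :=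
  (proj q R).toLinearMap ∘ₗ genT k V

/-- The canonical map `V* → K(V)`. -/
def dualGen (q : k) (R : V ⊗[k] V →ₗ[k] V ⊗[k] V) : Dual k V →ₗ[k] Koszul q R :=
  (proj q R).toLinearMap ∘ₗ dualGenT k V

/-- `IsWord q R n m x`: `x` is the product in `K(V)` of a word with `n` letters from `V` and
`m` letters from `V*`, in any order. -/
inductive IsWord (q : k) (R : V ⊗[k] V →ₗ[k] V ⊗[k] V) : ℕ → ℕ → Koszul q R → Prop
  | one : IsWord q R 0 0 1
  | gen_mul {n m : ℕ} {x : Koszul q R} (v : V) (hx : IsWord q R n m x) :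
      IsWord q R (n + 1) m (gen q R v * x)
  | dualGen_mul {n m : ℕ} {x : Koszul q R} (ξ : Dual k V) (hx : IsWord q R n m x) :
      IsWord q R n (m + 1) (dualGen q R ξ * x)

/-- The homogeneous component `K^{n,m}(V)`. -/
def grade (q : k) (R : V ⊗[k] V →ₗ[k] V ⊗[k] V) (n m : ℕ) : Submodule k (Koszul q R) :=
  Submodule.span k {x | IsWord q R n m x}

/-- The element `∑ vⁱ vᵢ` of `K^{1,1}(V)`, for a basis `vᵢ` of `V` with dual basis `vⁱ`; it is
the image of the element of `V* ⊗ V` that corresponds to the identity map of `V`. -/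
def canonicalElt (q : k) (R : V ⊗[k] V →ₗ[k] V ⊗[k] V) : Koszul q R :=
  tensorMul (dualGen q R) (gen q R) ((dualTensorHomEquiv k V V).symm LinearMap.id)

/-- The differential `D_V` of `K(V)`: left multiplication by `∑ vⁱ vᵢ`. -/
def diff (q : k) (R : V ⊗[k] V →ₗ[k] V ⊗[k] V) : Koszul q R →ₗ[k] Koszul q R :=
  LinearMap.mulLeft k (canonicalElt q R)

/-- The Berezinian `Ber(V)`: the cohomology `Ker D / Im D` of `K(V)`. -/
abbrev Ber (q : k) (R : V ⊗[k] V →ₗ[k] V ⊗[k] V) :=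
  LinearMap.ker (diff q R) ⧸ (LinearMap.range (diff q R)).submoduleOf (LinearMap.ker (diff q R))

/-- The cohomology class of a cocycle. -/
def berClass (q : k) (R : V ⊗[k] V →ₗ[k] V ⊗[k] V) :
    LinearMap.ker (diff q R) →ₗ[k] Ber q R :=
  Submodule.mkQ _

/-- The homogeneous component `Ber^{n,m}(V)`: the classes of the cocycles in `K^{n,m}(V)`. -/
def berGrade (q : k) (R : V ⊗[k] V →ₗ[k] V ⊗[k] V) (n m : ℕ) : Submodule k (Ber q R) :=
  ((grade q R n m).submoduleOf (LinearMap.ker (diff q R))).map (berClass q R)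

end Koszul

/-- The component of bidegree `(p, r)` of a tensor product of two bigraded spaces: the span of
`A^{n,m} ⊗ B^{i,j}` over `n + i = p`, `m + j = r`. -/
def tensorGrade {k : Type*} [Field k] {M : Type*} [AddCommGroup M] [Module k M]
    {N : Type*} [AddCommGroup N] [Module k N] (A : ℕ → ℕ → Submodule k M)
    (B : ℕ → ℕ → Submodule k N) (p r : ℕ) : Submodule k (M ⊗[k] N) :=
  Submodule.span k {t | ∃ n m i j, n + i = p ∧ m + j = r ∧
    ∃ a ∈ A n m, ∃ b ∈ B i j, t = a ⊗ₜ[k] b}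

section SumMap

variable {k : Type*} [Field k]
  {V : Type*} [AddCommGroup V] [Module k V] [FiniteDimensional k V]
  {U : Type*} [AddCommGroup U] [Module k U] [FiniteDimensional k U]

/-- The inclusion `U ⊕ U* → X ⊕ X*` for `X = V ⊕ U`, where `X* = V* ⊕ U*`. -/
def inclSecond (k V U : Type*) [Field k] [AddCommGroup V] [Module k V]
    [AddCommGroup U] [Module k U] :
    U × Dual k U →ₗ[k] (V × U) × Dual k (V × U) :=
  LinearMap.prodMap (LinearMap.inr k V U) (LinearMap.snd k V U).dualMap

/-- `f : K(V) ⊗ K(U) → K(V ⊕_Q U)` is the multiplication map: for `s` in the tensor algebra of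
`V*`, `e` in the tensor algebra of `V` and `w` in the tensor algebra of `U ⊕ U*`, it sends
`s e ⊗ w` (the product `s e`, with the letters from `V*` on the left, taken in `K(V)`, and `w`
taken in `K(U)`) to the product `s e w` taken in `K(V ⊕_Q U)`. -/
def IsMulMap (q : k) (R : V ⊗[k] V →ₗ[k] V ⊗[k] V) (R' : U ⊗[k] U →ₗ[k] U ⊗[k] U)
    (Q : U ⊗[k] V ≃ₗ[k] V ⊗[k] U)
    (f : Koszul q R ⊗[k] Koszul q R' →ₗ[k] Koszul q (heckeSum q R R' Q)) : Prop :=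
  ∀ (s : TensorAlgebra k (Dual k V)) (e : TensorAlgebra k V)
    (w : TensorAlgebra k (U × Dual k U)),
    f ((TensorAlgebra.lift k (dualGen q R) s * TensorAlgebra.lift k (gen q R) e) ⊗ₜ[k]
        proj q R' w) =
      TensorAlgebra.lift k
          (dualGen q (heckeSum q R R' Q) ∘ₗ (LinearMap.fst k V U).dualMap) s *
        TensorAlgebra.lift k
          (gen q (heckeSum q R R' Q) ∘ₗ LinearMap.inl k V U) e *
        proj q (heckeSum q R R' Q)
          (TensorAlgebra.lift k (TensorAlgebra.ι k ∘ₗ inclSecond k V U) w)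

end SumMap

end HeckeKoszul

end

-- Write X = V ⊕_Q U, let Λ(V) and S(V*) be the quadratic algebras on V and V* defined by the first
-- and third Koszul relations, and let c_V be the canonical element ∑ vⁱvᵢ. The proof is a sequence
-- of normal ordering (PBW type) statements, all instances of `IsTwist.bijective_mulOf`: if the rule
-- for moving letters of one quadratic algebra B past letters of another algebra A is compatible
-- with both sets of relations, then the algebra generated by both kinds of letters is A ⊗ B as a
-- vector space. Surjectivity is reordering of words. For injectivity, the algebra is made to act on
-- A ⊗ B so that ab sends 1 ⊗ 1 to a ⊗ b.
--
-- The braid relation of R gives K(V) = S(V*) ⊗ Λ(V). The two gluing identities for Q give Λ(X) =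
-- Λ(V) ⊗ Λ(U) and S(X*) = S(V*) ⊗ S(U*). The Hecke sum satisfies the braid relation
-- (`heckeSum_braid`), so K(X) = S(V*) ⊗ S(U*) ⊗ Λ(V) ⊗ Λ(U). Since Q♯ is invertible, the two middle
-- factors can be interchanged (`exists_koszul_reorder`), which yields K(X) = S(V*) Λ(V) S(U*) Λ(U)
-- = K(V) ⊗ K(U); this is φ (`exists_mulEquiv`). The letters of U and U* satisfy in K(X) the
-- relations of K(U), so K(U) maps to K(X) as an algebra. The mixed relation of V with V* acquires a
-- multiple of c_U in K(X), and therefore φ is prescribed only on normally ordered elements of K(V).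
--
-- In every Koszul complex c commutes with the dual letters, and v c = -q⁻² c v. Hence c² = -q⁻² c²,
-- so c² = 0 because q² ≠ -1. In K(X) the element c_X is the sum of the V part and c_U, it commutes
-- with V*, and c_U anticommutes with V (`koszulInr_canonicalElt_mul_genFst`). Moving c_X past s ∈
-- S(V*), and then c_U past e ∈ Λ(V) of degree n, gives the formula for the differential on φ(se ⊗
-- w).
--
-- The cohomology statement is the Künneth theorem over a field, proved with explicit homotopies
-- (`exists_kunneth_map`). Bidegrees are controlled throughout by one principle
-- (`eq_of_le_of_iSup_eq_top`): a family of subspaces that lies inside a grading and spans the whole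
-- space equals that grading.

universe u v

set_option linter.unusedSectionVars false

namespace HeckeKoszul

open Module

/-! ### Quadratic algebras given by relation matrices. -/

section QuadraticAlgebra

variable {k : Type u} [Field k] {I : Type} [Fintype I]

/-- The elements `x i` of an algebra satisfy the quadratic relations
`∑ C i j a b x_a x_b = 0`. -/
def SatisfiesQuad {E : Type*} [Ring E] [Algebra k E] (C : I → I → I → I → k) (x : I → E) : Prop :=
  ∀ i j, ∑ a, ∑ b, C i j a b • (x a * x b) = 0

/-- The relations of the quadratic algebra with relation matrix `C`. -/
inductive QuadRel (C : I → I → I → I → k) : FreeAlgebra k I → FreeAlgebra k I → Prop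
  | mk (i j : I) : QuadRel C
      (∑ a, ∑ b, C i j a b • (FreeAlgebra.ι k a * FreeAlgebra.ι k b)) 0

/-- The quadratic algebra with generators `x_i` and relations `∑ C i j a b x_a x_b = 0`. -/
def QuadAlg (C : I → I → I → I → k) : Type u := RingQuot (QuadRel C)

noncomputable instance (C : I → I → I → I → k) : Ring (QuadAlg C) :=
  inferInstanceAs (Ring (RingQuot (QuadRel C)))

noncomputable instance (C : I → I → I → I → k) : Algebra k (QuadAlg C) :=
  inferInstanceAs (Algebra k (RingQuot (QuadRel C)))

/-- The generators of a quadratic algebra. -/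
noncomputable def QuadAlg.x (C : I → I → I → I → k) (i : I) : QuadAlg C :=
  RingQuot.mkAlgHom k (QuadRel C) (FreeAlgebra.ι k i)

theorem QuadAlg.satisfiesQuad (C : I → I → I → I → k) : SatisfiesQuad C (QuadAlg.x C) := by
  intro i j
  have h := RingQuot.mkAlgHom_rel k (QuadRel.mk (C := C) i j)
  simp only [map_sum, map_smul, map_mul, map_zero] at h
  exact h

/-- The universal property of a quadratic algebra. -/
noncomputable def QuadAlg.lift {C : I → I → I → I → k} {E : Type*} [Ring E] [Algebra k E]
    {x : I → E} (h : SatisfiesQuad C x) : QuadAlg C →ₐ[k] E :=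
  RingQuot.liftAlgHom k ⟨FreeAlgebra.lift k x, by
    rintro _ _ ⟨i, j⟩
    simpa using h i j⟩

@[simp]
theorem QuadAlg.lift_x {C : I → I → I → I → k} {E : Type*} [Ring E] [Algebra k E]
    {x : I → E} (h : SatisfiesQuad C x) (i : I) : QuadAlg.lift h (QuadAlg.x C i) = x i := by
  unfold QuadAlg.lift QuadAlg.x
  erw [RingQuot.liftAlgHom_mkAlgHom_apply]
  simp

theorem QuadAlg.adjoin_x (C : I → I → I → I → k) :
    Algebra.adjoin k (Set.range (QuadAlg.x C)) = ⊤ := by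
  have h : Set.range (QuadAlg.x C) =
      (RingQuot.mkAlgHom k (QuadRel C)) '' Set.range (FreeAlgebra.ι k) := by
    rw [← Set.range_comp]; rfl
  rw [h]
  erw [← AlgHom.map_adjoin, FreeAlgebra.adjoin_range_ι, Algebra.map_top,
    AlgHom.range_eq_top]
  exact RingQuot.mkAlgHom_surjective k _

end QuadraticAlgebra

/-! ### Interchange of iterated finite sums. -/

section Sums

variable {M : Type*} [AddCommMonoid M] {α β γ δ ε : Type*} [Fintype α] [Fintype β] [Fintype γ]
  [Fintype δ] [Fintype ε]

theorem sum_comm_three_two (f : α → β → γ → δ → ε → M) :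
    ∑ a, ∑ b, ∑ c, ∑ d, ∑ e, f a b c d e = ∑ d, ∑ e, ∑ a, ∑ b, ∑ c, f a b c d e := by
  calc _ = ∑ p : α × β × γ, ∑ r : δ × ε, f p.1 p.2.1 p.2.2 r.1 r.2 := by
        simp only [Fintype.sum_prod_type]
    _ = ∑ r : δ × ε, ∑ p : α × β × γ, f p.1 p.2.1 p.2.2 r.1 r.2 := Finset.sum_comm
    _ = _ := by simp only [Fintype.sum_prod_type]

theorem sum_comm_two_two (f : α → β → γ → δ → M) :
    ∑ a, ∑ b, ∑ c, ∑ d, f a b c d = ∑ c, ∑ d, ∑ a, ∑ b, f a b c d := by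
  calc _ = ∑ p : α × β, ∑ r : γ × δ, f p.1 p.2 r.1 r.2 := by
        simp only [Fintype.sum_prod_type]
    _ = ∑ r : γ × δ, ∑ p : α × β, f p.1 p.2 r.1 r.2 := Finset.sum_comm
    _ = _ := by simp only [Fintype.sum_prod_type]

theorem sum_comm_three_three {ζ : Type*} [Fintype ζ] (f : α → β → γ → δ → ε → ζ → M) :
    ∑ a, ∑ b, ∑ c, ∑ d, ∑ e, ∑ z, f a b c d e z =
      ∑ d, ∑ e, ∑ z, ∑ a, ∑ b, ∑ c, f a b c d e z := by
  calc _ = ∑ p : α × β × γ, ∑ r : δ × ε × ζ, f p.1 p.2.1 p.2.2 r.1 r.2.1 r.2.2 := by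
        simp only [Fintype.sum_prod_type]
    _ = ∑ r : δ × ε × ζ, ∑ p : α × β × γ, f p.1 p.2.1 p.2.2 r.1 r.2.1 r.2.2 := Finset.sum_comm
    _ = _ := by simp only [Fintype.sum_prod_type]

theorem sum_comm_three_one (f : α → β → γ → δ → M) :
    ∑ a, ∑ b, ∑ c, ∑ d, f a b c d = ∑ d, ∑ a, ∑ b, ∑ c, f a b c d := by
  calc _ = ∑ p : α × β × γ, ∑ d, f p.1 p.2.1 p.2.2 d := by simp only [Fintype.sum_prod_type]
    _ = ∑ d, ∑ p : α × β × γ, f p.1 p.2.1 p.2.2 d := Finset.sum_comm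
    _ = _ := by simp only [Fintype.sum_prod_type]

end Sums

/-! ### Twisted tensor products of quadratic algebras. -/

section Twist

variable {k : Type u} [Field k] {I J : Type} [Fintype I] [Fintype J]

/-- The compatibility of an exchange rule `b_j a_i = ∑ θ j i i' j' a_i' b_j'` with the quadratic
relations given by `D` (among the `a_i`) and `C` (among the `b_j`). -/
structure IsTwist (D : I → I → I → I → k) (C : J → J → J → J → k) (θ : J → I → I → J → k) :
    Prop where
  left : ∀ j i₁ i₂ p r s, ∑ a, ∑ b, ∑ m, D i₁ i₂ a b * (θ j a p m * θ m b r s) =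
    ∑ a, ∑ b, ∑ m, θ j i₁ a m * θ m i₂ b s * D a b p r
  right : ∀ j₁ j₂ i p r s, ∑ a, ∑ b, ∑ m, C j₁ j₂ a b * (θ b i m s * θ a m p r) =
    ∑ a, ∑ b, ∑ m, θ j₂ i m b * θ j₁ m p a * C a b r s

/-- The exchange rule `y_j x_i = ∑ θ j i i' j' x_i' y_j'` in an algebra. -/
def SatisfiesExchange {E : Type*} [Ring E] [Algebra k E] (θ : J → I → I → J → k)
    (x : I → E) (y : J → E) : Prop :=
  ∀ j i, y j * x i = ∑ p, ∑ s, θ j i p s • (x p * y s)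

variable {D : I → I → I → I → k} {C : J → J → J → J → k} {θ : J → I → I → J → k}
  [DecidableEq J]

/-- The matrices over the quadratic algebra of `D` that express the exchange rule `θ`. -/
noncomputable def exchangeGen (D : I → I → I → I → k) (θ : J → I → I → J → k) (i : I) :
    Matrix J J (QuadAlg D) :=
  Matrix.of fun j s => ∑ p, θ j i p s • QuadAlg.x D p

/-- `IsTwist.left` says exactly that the two-step exchange carries a relation of D to a combination
of relations of D; this makes `IsTwist.exchange` well defined on the quotient. -/
theorem IsTwist.satisfiesQuad (h : IsTwist D C θ) :
    SatisfiesQuad D (exchangeGen D θ) := by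
  intro i₁ i₂
  ext j s
  simp only [Matrix.sum_apply, Matrix.smul_apply, Matrix.mul_apply, exchangeGen, Matrix.of_apply,
    Matrix.zero_apply]
  calc _ = ∑ a, ∑ b, ∑ m, ∑ p, ∑ r, (D i₁ i₂ a b * (θ j a p m * θ m b r s)) •
        (QuadAlg.x D p * QuadAlg.x D r) := by
        simp only [Finset.sum_mul, Finset.mul_sum, Finset.smul_sum, smul_mul_smul_comm, smul_smul]
        exact Fintype.sum_congr _ _ fun a => Fintype.sum_congr _ _ fun b =>
          Fintype.sum_congr _ _ fun m => Finset.sum_comm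
    _ = ∑ p, ∑ r, (∑ a, ∑ b, ∑ m, D i₁ i₂ a b * (θ j a p m * θ m b r s)) •
        (QuadAlg.x D p * QuadAlg.x D r) := by
        rw [sum_comm_three_two]; simp only [Finset.sum_smul]
    _ = ∑ a, ∑ b, ∑ m, ∑ p, ∑ r, (θ j i₁ a m * θ m i₂ b s * D a b p r) •
        (QuadAlg.x D p * QuadAlg.x D r) := by
        rw [sum_comm_three_two]; simp only [Finset.sum_smul, h.left]
    _ = ∑ a, ∑ b, ∑ m, (θ j i₁ a m * θ m i₂ b s) •
        ∑ p, ∑ r, D a b p r • (QuadAlg.x D p * QuadAlg.x D r) := by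
        simp only [Finset.smul_sum, smul_smul]
    _ = 0 := by simp [QuadAlg.satisfiesQuad D _ _]

/-- The algebra map from the quadratic algebra of `D` to matrices over it that expresses the
exchange rule: `b_j a = ∑ (exchange a)_{j s} b_s`. -/
noncomputable def IsTwist.exchange (h : IsTwist D C θ) : QuadAlg D →ₐ[k] Matrix J J (QuadAlg D) :=
  QuadAlg.lift h.satisfiesQuad

theorem IsTwist.exchange_x (h : IsTwist D C θ) (i : I) (j s : J) :
    h.exchange (QuadAlg.x D i) j s = ∑ p, θ j i p s • QuadAlg.x D p := by
  simp [IsTwist.exchange, exchangeGen]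

/-- The exchange rule for moving two generators `b_j₁ b_j₂` past an element. -/
noncomputable def IsTwist.exchangeTwo (h : IsTwist D C θ) :
    QuadAlg D →ₐ[k] Matrix (J × J) (J × J) (QuadAlg D) :=
  (Matrix.compAlgEquiv J J (QuadAlg D) k).toAlgHom.comp (h.exchange.mapMatrix.comp h.exchange)

theorem IsTwist.exchangeTwo_apply (h : IsTwist D C θ) (a : QuadAlg D) (p r : J × J) :
    h.exchangeTwo a p r = h.exchange (h.exchange a p.1 r.1) p.2 r.2 := rfl

/-- Extends `IsTwist.right` from generators to all elements a: moving a relation among the b_j past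
a gives again a combination of such relations. -/
theorem IsTwist.exchangeTwo_comm (h : IsTwist D C θ) (a : QuadAlg D) (j₁ j₂ r s : J) :
    ∑ c, ∑ b, C j₁ j₂ c b • h.exchange (h.exchange a b s) c r =
      ∑ c, ∑ b, C c b r s • h.exchange (h.exchange a j₂ b) j₁ c := by
  -- The indices of C appear swapped because in b_j₁ b_j₂ a the letter b_j₂ passes a first, so that
  -- pairs are listed as (j₂, j₁).
  let N : Matrix (J × J) (J × J) (QuadAlg D) :=
    Matrix.of fun p r => algebraMap k _ (C p.2 p.1 r.2 r.1)
  have key : ∀ a, N * h.exchangeTwo a = h.exchangeTwo a * N := by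
    intro a
    -- The elements whose two-step exchange commutes with N form a subalgebra, so generators
    -- suffice.
    have ha : a ∈ (Subalgebra.centralizer k {N}).comap h.exchangeTwo := by
      have : (⊤ : Subalgebra k (QuadAlg D)) ≤
          (Subalgebra.centralizer k {N}).comap h.exchangeTwo := by
        rw [← QuadAlg.adjoin_x D, Algebra.adjoin_le_iff]
        rintro _ ⟨i, rfl⟩
        simp only [Subalgebra.coe_comap, Set.mem_preimage, SetLike.mem_coe,
          Subalgebra.mem_centralizer_iff, Set.mem_singleton_iff, forall_eq]
        ext ⟨j₂, j₁⟩ ⟨s, r⟩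
        simp only [Matrix.mul_apply, N, Matrix.of_apply, h.exchangeTwo_apply, h.exchange_x,
          map_sum, map_smul, Matrix.sum_apply, Matrix.smul_apply, Fintype.sum_prod_type,
          ← Algebra.smul_def, ← Algebra.commutes]
        have e₁ : ∀ p, (∑ c, ∑ b, ∑ m, C j₁ j₂ c b * (θ b i m s * θ c m p r)) =
          ∑ b, ∑ c, ∑ m, C j₁ j₂ c b * (θ b i m s * θ c m p r) := fun p => Finset.sum_comm
        have e₂ : ∀ p, (∑ c, ∑ b, ∑ m, θ j₂ i m b * θ j₁ m p c * C c b r s) =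
          ∑ b, ∑ c, ∑ m, θ j₂ i m b * θ j₁ m p c * C c b r s := fun p => Finset.sum_comm
        calc _ = ∑ p, (∑ b, ∑ c, ∑ m, C j₁ j₂ c b * (θ b i m s * θ c m p r)) •
              QuadAlg.x D p := by
              simp only [Finset.smul_sum, Finset.sum_smul, smul_smul]
              exact sum_comm_three_one _
          _ = ∑ p, (∑ b, ∑ c, ∑ m, θ j₂ i m b * θ j₁ m p c * C c b r s) •
              QuadAlg.x D p := by
              simp only [← e₁, ← e₂, h.right]
          _ = _ := by
              simp only [Finset.smul_sum, Finset.sum_smul, smul_smul]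
              rw [← sum_comm_three_one]
              simp only [mul_comm (C _ _ _ _)]
      exact this trivial
    simpa [Subalgebra.mem_centralizer_iff] using ha
  have := congrFun (congrFun (key a) (j₂, j₁)) (s, r)
  simp only [Matrix.mul_apply, N, Matrix.of_apply, h.exchangeTwo_apply,
          Fintype.sum_prod_type, ← Algebra.smul_def, ← Algebra.commutes] at this
  rw [Finset.sum_comm, this, Finset.sum_comm]

/-- The entry `(j, s)` of `IsTwist.exchange`, as a linear map. -/
noncomputable def IsTwist.entry (h : IsTwist D C θ) (j s : J) : QuadAlg D →ₗ[k] QuadAlg D :=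
  Matrix.entryLinearMap k (QuadAlg D) j s ∘ₗ h.exchange.toLinearMap

theorem IsTwist.entry_apply (h : IsTwist D C θ) (j s : J) (a : QuadAlg D) :
    h.entry j s a = h.exchange a j s := rfl

/-- The action of the generators `x_i` on the tensor product of two quadratic algebras. -/
noncomputable def actLeft (D : I → I → I → I → k) (C : J → J → J → J → k) (i : I) :
    Module.End k (QuadAlg D ⊗[k] QuadAlg C) :=
  TensorProduct.map (LinearMap.mulLeft k (QuadAlg.x D i)) LinearMap.id

/-- The action of the generators `y_j` on the tensor product of two quadratic algebras with an
exchange rule. -/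
noncomputable def IsTwist.actRight (h : IsTwist D C θ) (j : J) :
    Module.End k (QuadAlg D ⊗[k] QuadAlg C) :=
  ∑ s, TensorProduct.map (h.entry j s) (LinearMap.mulLeft k (QuadAlg.x C s))

theorem actLeft_tmul (i : I) (a : QuadAlg D) (b : QuadAlg C) :
    actLeft D C i (a ⊗ₜ b) = (QuadAlg.x D i * a) ⊗ₜ b := rfl

theorem IsTwist.actRight_tmul (h : IsTwist D C θ) (j : J) (a : QuadAlg D) (b : QuadAlg C) :
    h.actRight j (a ⊗ₜ b) = ∑ s, h.exchange a j s ⊗ₜ (QuadAlg.x C s * b) := by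
  simp [IsTwist.actRight, LinearMap.sum_apply, IsTwist.entry_apply]

theorem IsTwist.satisfiesQuad_actLeft : SatisfiesQuad D (actLeft D C) := by
  intro i j
  ext a b
  simp only [LinearMap.sum_apply, LinearMap.smul_apply, Module.End.mul_apply, actLeft_tmul,
    TensorProduct.AlgebraTensorModule.curry_apply, TensorProduct.curry_apply,
    LinearMap.coe_restrictScalars, ← mul_assoc, TensorProduct.smul_tmul', ← smul_mul_assoc,
    ← TensorProduct.sum_tmul, ← Finset.sum_mul]
  have := QuadAlg.satisfiesQuad D i j
  simp only [← smul_mul_assoc] at this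
  rw [this]
  simp

/-- By `exchangeTwo_comm` the relation matrix C can be transferred from the first tensor factor to
the second, where it multiplies generators and gives zero. -/
theorem IsTwist.satisfiesQuad_actRight (h : IsTwist D C θ) : SatisfiesQuad C h.actRight := by
  intro j₁ j₂
  ext a b
  simp only [LinearMap.sum_apply, LinearMap.smul_apply, Module.End.mul_apply, h.actRight_tmul,
    TensorProduct.AlgebraTensorModule.curry_apply, TensorProduct.curry_apply,
    LinearMap.coe_restrictScalars, map_sum, ← mul_assoc]
  calc _ = ∑ s, ∑ r, (∑ c, ∑ b, C j₁ j₂ c b • h.exchange (h.exchange a b s) c r) ⊗ₜ[k]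
        (QuadAlg.x C r * QuadAlg.x C s * b) := by
        simp only [TensorProduct.sum_tmul, TensorProduct.smul_tmul', Finset.smul_sum]
        rw [sum_comm_two_two]
    _ = ∑ c, ∑ b', h.exchange (h.exchange a j₂ b') j₁ c ⊗ₜ[k]
        ((∑ r, ∑ s, C c b' r s • (QuadAlg.x C r * QuadAlg.x C s)) * b) := by
        simp only [h.exchangeTwo_comm, TensorProduct.sum_tmul, Finset.sum_mul,
          TensorProduct.tmul_sum, TensorProduct.tmul_smul, TensorProduct.smul_tmul',
          smul_mul_assoc]
        rw [sum_comm_two_two]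
        exact Fintype.sum_congr _ _ fun _ => Fintype.sum_congr _ _ fun _ => Finset.sum_comm
    _ = 0 := by simp [QuadAlg.satisfiesQuad C _ _]
    _ = _ := by simp

/-- This is the multiplicativity of `IsTwist.exchange`, applied to a product x_i a. -/
theorem IsTwist.satisfiesExchange_act (h : IsTwist D C θ) :
    SatisfiesExchange θ (actLeft D C) h.actRight := by
  intro j i
  ext a b
  simp only [LinearMap.sum_apply, LinearMap.smul_apply, Module.End.mul_apply, h.actRight_tmul,
    TensorProduct.AlgebraTensorModule.curry_apply, TensorProduct.curry_apply,
    LinearMap.coe_restrictScalars, map_sum, actLeft_tmul, map_mul, Matrix.mul_apply,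
    h.exchange_x, Finset.sum_mul, TensorProduct.sum_tmul, smul_mul_assoc,
    ← TensorProduct.smul_tmul', Finset.smul_sum]
  rw [Finset.sum_comm, Finset.sum_comm_cycle]

/-- In any algebra with the exchange rule, y_j moves past every element of A, not only past
generators. Consequently the span of the products ab is stable under left multiplication by y_j. -/
theorem exchange_of_satisfiesExchange {P : Type*} [Ring P] [Algebra k P] (h : IsTwist D C θ)
    {x : I → P} {y : J → P} (hx : SatisfiesQuad D x) (hxy : SatisfiesExchange θ x y) (j : J)
    (a : QuadAlg D) :
    y j * QuadAlg.lift hx a = ∑ s, QuadAlg.lift hx (h.exchange a j s) * y s := by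
  have ha : a ∈ Algebra.adjoin k (Set.range (QuadAlg.x D)) := by
    rw [QuadAlg.adjoin_x]; trivial
  induction ha using Algebra.adjoin_induction generalizing j with
  | mem a ha =>
    obtain ⟨i, rfl⟩ := ha
    simp only [h.exchange_x, QuadAlg.lift_x, map_sum, map_smul, hxy j i, Finset.sum_mul,
      smul_mul_assoc]
    exact Finset.sum_comm
  | algebraMap r =>
    simp [Matrix.algebraMap_matrix_apply, apply_ite, ite_mul, Algebra.commutes]
  | add a b _ _ ha hb =>
    simp only [map_add, mul_add, Matrix.add_apply, add_mul, Finset.sum_add_distrib, ha, hb]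
  | mul a b _ _ ha hb =>
    simp only [map_mul, ← mul_assoc, ha, Matrix.mul_apply, Finset.sum_mul, map_sum]
    simp only [mul_assoc, hb, Finset.mul_sum]
    exact Finset.sum_comm

/-- The multiplication map of an algebra, restricted to two algebras that map to it. -/
noncomputable def mulOf {A B P : Type*} [Ring A] [Algebra k A] [Ring B] [Algebra k B] [Ring P]
    [Algebra k P] (f : A →ₐ[k] P) (g : B →ₐ[k] P) : A ⊗[k] B →ₗ[k] P :=
  LinearMap.mul' k P ∘ₗ TensorProduct.map f.toLinearMap g.toLinearMap

@[simp]
theorem mulOf_tmul {A B P : Type*} [Ring A] [Algebra k A] [Ring B] [Algebra k B] [Ring P]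
    [Algebra k P] (f : A →ₐ[k] P) (g : B →ₐ[k] P) (a : A) (b : B) :
    mulOf f g (a ⊗ₜ b) = f a * g b := rfl

/-- A submodule which contains `1` and is stable under left multiplication by generators of the
algebra is everything. -/
theorem eq_top_of_one_mem_of_mul_mem {P : Type*} [Ring P] [Algebra k P] {S : Set P}
    (hS : Algebra.adjoin k S = ⊤) (N : Submodule k P) (h1 : 1 ∈ N)
    (hN : ∀ s ∈ S, ∀ z ∈ N, s * z ∈ N) : N = ⊤ := by
  have key : ∀ a ∈ Algebra.adjoin k S, ∀ z ∈ N, a * z ∈ N := by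
    intro a ha
    induction ha using Algebra.adjoin_induction with
    | mem a ha => exact hN a ha
    | algebraMap r => intro z hz; rw [← Algebra.smul_def]; exact N.smul_mem _ hz
    | add a b _ _ ha hb => intro z hz; rw [add_mul]; exact N.add_mem (ha z hz) (hb z hz)
    | mul a b _ _ ha hb => intro z hz; rw [mul_assoc]; exact ha _ (hb z hz)
  rw [eq_top_iff]
  intro a _
  simpa using key a (by rw [hS]; trivial) 1 h1

/-- An algebra `P` with the universal property of the twisted tensor product of two quadratic
algebras is isomorphic to their tensor product by the multiplication map. -/
theorem IsTwist.bijective_mulOf {P : Type*} [Ring P] [Algebra k P] (h : IsTwist D C θ)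
    {x : I → P} {y : J → P} (hx : SatisfiesQuad D x) (hy : SatisfiesQuad C y)
    (hxy : SatisfiesExchange θ x y) (hP : Algebra.adjoin k (Set.range x ∪ Set.range y) = ⊤)
    (univ : ∀ {E : Type u} [Ring E] [Algebra k E] (x' : I → E) (y' : J → E),
      SatisfiesQuad D x' → SatisfiesQuad C y' → SatisfiesExchange θ x' y' →
        ∃ F : P →ₐ[k] E, (∀ i, F (x i) = x' i) ∧ ∀ j, F (y j) = y' j) :
    Function.Bijective (mulOf (QuadAlg.lift hx) (QuadAlg.lift hy)) := by
  constructor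
  · obtain ⟨F, hFx, hFy⟩ := univ _ _ IsTwist.satisfiesQuad_actLeft h.satisfiesQuad_actRight
      h.satisfiesExchange_act
    have hA : ∀ a a' b, F (QuadAlg.lift hx a) (a' ⊗ₜ b) = (a * a') ⊗ₜ b := by
      intro a
      have ha : a ∈ Algebra.adjoin k (Set.range (QuadAlg.x D)) := by
        rw [QuadAlg.adjoin_x]; trivial
      induction ha using Algebra.adjoin_induction with
      | mem a ha => obtain ⟨i, rfl⟩ := ha; simp [hFx, actLeft_tmul]
      | algebraMap r => simp [Algebra.algebraMap_eq_smul_one, TensorProduct.smul_tmul']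
      | add a b _ _ ha hb => simp [ha, hb, add_mul, TensorProduct.add_tmul]
      | mul a b _ _ ha hb => simp [ha, hb, mul_assoc]
    have hB : ∀ b b', F (QuadAlg.lift hy b) (1 ⊗ₜ b') = 1 ⊗ₜ (b * b') := by
      intro b
      have hb : b ∈ Algebra.adjoin k (Set.range (QuadAlg.x C)) := by
        rw [QuadAlg.adjoin_x]; trivial
      induction hb using Algebra.adjoin_induction with
      | mem b hb =>
        obtain ⟨j, rfl⟩ := hb
        intro b'
        simp only [QuadAlg.lift_x, hFy, h.actRight_tmul, map_one, Matrix.one_apply]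
        rw [Finset.sum_eq_single j] <;> simp +contextual [eq_comm]
      | algebraMap r => simp [Algebra.algebraMap_eq_smul_one]
      | add a b _ _ ha hb => simp [ha, hb, add_mul, TensorProduct.tmul_add]
      | mul a b _ _ ha hb => simp [ha, hb, mul_assoc]
    -- Evaluating the action on 1 ⊗ 1 is a left inverse of multiplication.
    have key : ∀ t, F (mulOf (QuadAlg.lift hx) (QuadAlg.lift hy) t) (1 ⊗ₜ 1) = t := by
      intro t
      induction t with
      | zero => simp
      | tmul a b => simp [hA, hB]
      | add s t hs ht => simp [hs, ht]
    exact Function.LeftInverse.injective (g := fun p => F p (1 ⊗ₜ 1)) key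
  · rw [← LinearMap.range_eq_top]
    -- Left multiplication by a generator lifts along multiplication to `actLeft` or
    -- `IsTwist.actRight`, so the range is a left ideal containing 1.
    refine eq_top_of_one_mem_of_mul_mem hP _ ⟨1 ⊗ₜ 1, by simp⟩ ?_
    rintro _ (⟨i, rfl⟩ | ⟨j, rfl⟩) _ ⟨t, rfl⟩
    · refine ⟨actLeft D C i t, ?_⟩
      induction t with
      | zero => simp
      | tmul a b => simp [actLeft_tmul, mul_assoc]
      | add s t hs ht => simp [hs, ht, mul_add]
    · refine ⟨h.actRight j t, ?_⟩
      induction t with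
      | zero => simp
      | tmul a b =>
        simp [h.actRight_tmul, ← mul_assoc, exchange_of_satisfiesExchange h hx hxy,
          Finset.sum_mul]
      | add s t hs ht => simp [hs, ht, mul_add]

end Twist

/-! ### Maps of tensor products in coordinates. -/

section Coordinates

variable {k : Type*} [Field k]
  {A B C D A₁ B₁ C₁ D₁ B₂ C₂ E F : Type*}
  [AddCommGroup A] [Module k A] [AddCommGroup B] [Module k B] [AddCommGroup C] [Module k C]
  [AddCommGroup D] [Module k D] [AddCommGroup A₁] [Module k A₁] [AddCommGroup B₁] [Module k B₁]
  [AddCommGroup C₁] [Module k C₁] [AddCommGroup D₁] [Module k D₁]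
  [AddCommGroup B₂] [Module k B₂] [AddCommGroup C₂] [Module k C₂] [AddCommGroup E] [Module k E] [AddCommGroup F] [Module k F]
  {iA iB iC iD iA₁ iB₁ iC₁ iB₂ iC₂ iD₁ iE iF : Type*}
  [Fintype iA] [Fintype iB] [Fintype iC] [Fintype iD] [Fintype iA₁] [Fintype iB₁] [Fintype iC₁]
  [Fintype iB₂] [Fintype iC₂] [Fintype iD₁] [Fintype iE] [Fintype iF]
  (a : Basis iA k A) (b : Basis iB k B) (c : Basis iC k C) (d : Basis iD k D)
  (a₁ : Basis iA₁ k A₁) (b₁ : Basis iB₁ k B₁) (c₁ : Basis iC₁ k C₁) (b₂ : Basis iB₂ k B₂)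
  (c₂ : Basis iC₂ k C₂)
  (d₁ : Basis iD₁ k D₁) (e : Basis iE k E) (f : Basis iF k F)

/-- The matrix coefficients of a map `T : A ⊗ B → C ⊗ D` in bases:
`T (a_i ⊗ b_j) = ∑ coeff i j p r • c_p ⊗ d_r`. -/
noncomputable def coeff (T : A ⊗[k] B →ₗ[k] C ⊗[k] D) (i : iA) (j : iB) (p : iC) (r : iD) : k :=
  (c.tensorProduct d).repr (T (a i ⊗ₜ b j)) (p, r)

theorem apply_eq_sum_coeff (T : A ⊗[k] B →ₗ[k] C ⊗[k] D) (i : iA) (j : iB) :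
    T (a i ⊗ₜ b j) = ∑ p, ∑ r, coeff a b c d T i j p r • (c p ⊗ₜ[k] d r) := by
  conv_lhs => rw [← (c.tensorProduct d).sum_repr (T (a i ⊗ₜ b j))]
  rw [Fintype.sum_prod_type]
  simp [coeff]

theorem coeff_eq_of_apply_eq (T : A ⊗[k] B →ₗ[k] C ⊗[k] D) (z : iA → iB → iC → iD → k)
    (h : ∀ i j, T (a i ⊗ₜ b j) = ∑ p, ∑ r, z i j p r • (c p ⊗ₜ[k] d r)) :
    coeff a b c d T = z := by
  classical
  funext i j p r
  simp [coeff, h, Finsupp.single_apply]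

theorem oneTensor_apply (T : A ⊗[k] B →ₗ[k] C ⊗[k] D) (n : iE) (i : iA) (j : iB) :
    oneTensor E T ((e n ⊗ₜ a i) ⊗ₜ b j) =
      ∑ p, ∑ r, coeff a b c d T i j p r • ((e n ⊗ₜ[k] c p) ⊗ₜ[k] d r) := by
  simp [oneTensor, apply_eq_sum_coeff a b c d, TensorProduct.tmul_sum]

theorem rTensor_apply (T : A ⊗[k] B →ₗ[k] C ⊗[k] D) (i : iA) (j : iB) (n : iE) :
    LinearMap.rTensor E T ((a i ⊗ₜ b j) ⊗ₜ e n) =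
      ∑ p, ∑ r, coeff a b c d T i j p r • ((c p ⊗ₜ[k] d r) ⊗ₜ[k] e n) := by
  simp [apply_eq_sum_coeff a b c d, TensorProduct.sum_tmul, TensorProduct.smul_tmul']

/-- A Yang–Baxter type identity `(1 ⊗ T₃)(T₂ ⊗ 1)(1 ⊗ T₁) = (S₃ ⊗ 1)(1 ⊗ S₂)(S₁ ⊗ 1)` in
coordinates. -/
theorem yangBaxter_iff_coeff
    (T₁ : B ⊗[k] C →ₗ[k] B₁ ⊗[k] C₁) (T₂ : A ⊗[k] B₁ →ₗ[k] D ⊗[k] B₂)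
    (T₃ : B₂ ⊗[k] C₁ →ₗ[k] E ⊗[k] F)
    (S₁ : A ⊗[k] B →ₗ[k] A₁ ⊗[k] D₁) (S₂ : D₁ ⊗[k] C →ₗ[k] C₂ ⊗[k] F)
    (S₃ : A₁ ⊗[k] C₂ →ₗ[k] D ⊗[k] E) :
    oneTensor D T₃ ∘ₗ LinearMap.rTensor C₁ T₂ ∘ₗ oneTensor A T₁ =
        LinearMap.rTensor F S₃ ∘ₗ oneTensor A₁ S₂ ∘ₗ LinearMap.rTensor C S₁ ↔
      ∀ i j n p r s,
        ∑ x, ∑ y, ∑ m, coeff b c b₁ c₁ T₁ j n x y * coeff a b₁ d b₂ T₂ i x p m *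
          coeff b₂ c₁ e f T₃ m y r s =
        ∑ x, ∑ y, ∑ m, coeff a b a₁ d₁ S₁ i j x y * coeff d₁ c c₂ f S₂ y n m s *
          coeff a₁ c₂ d e S₃ x m p r := by
  classical
  have h₁ : ∀ i j n, (oneTensor D T₃ ∘ₗ LinearMap.rTensor C₁ T₂ ∘ₗ oneTensor A T₁)
      ((a i ⊗ₜ b j) ⊗ₜ c n) = ∑ p, ∑ r, ∑ s,
        (∑ x, ∑ y, ∑ m, coeff b c b₁ c₁ T₁ j n x y * coeff a b₁ d b₂ T₂ i x p m *
          coeff b₂ c₁ e f T₃ m y r s) • ((d p ⊗ₜ[k] e r) ⊗ₜ[k] f s) := by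
    intro i j n
    simp only [LinearMap.comp_apply, oneTensor_apply b c b₁ c₁ a, map_sum, map_smul,
      rTensor_apply a b₁ d b₂ c₁, oneTensor_apply b₂ c₁ e f d, Finset.smul_sum, smul_smul,
      Finset.sum_smul, mul_assoc]
    refine Eq.trans ?_ (sum_comm_three_three _)
    exact Fintype.sum_congr _ _ fun _ => Fintype.sum_congr _ _ fun _ => Finset.sum_comm
  have h₂ : ∀ i j n, (LinearMap.rTensor F S₃ ∘ₗ oneTensor A₁ S₂ ∘ₗ LinearMap.rTensor C S₁)
      ((a i ⊗ₜ b j) ⊗ₜ c n) = ∑ p, ∑ r, ∑ s,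
        (∑ x, ∑ y, ∑ m, coeff a b a₁ d₁ S₁ i j x y * coeff d₁ c c₂ f S₂ y n m s *
          coeff a₁ c₂ d e S₃ x m p r) • ((d p ⊗ₜ[k] e r) ⊗ₜ[k] f s) := by
    intro i j n
    simp only [LinearMap.comp_apply, rTensor_apply a b a₁ d₁ c, map_sum, map_smul,
      oneTensor_apply d₁ c c₂ f a₁, rTensor_apply a₁ c₂ d e f, Finset.smul_sum, smul_smul,
      Finset.sum_smul, mul_assoc]
    refine Eq.trans ?_ (sum_comm_three_three _)
    exact Fintype.sum_congr _ _ fun _ => Fintype.sum_congr _ _ fun _ =>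
      Fintype.sum_congr _ _ fun _ => Finset.sum_comm_cycle.symm
  constructor
  · intro h i j n p r s
    have := congrArg (fun t => ((d.tensorProduct e).tensorProduct f).repr t ((p, r), s))
      (LinearMap.congr_fun h ((a i ⊗ₜ b j) ⊗ₜ c n))
    simp only [h₁, h₂] at this
    simpa [Finsupp.single_apply, ite_and] using this
  · intro h
    refine ((a.tensorProduct b).tensorProduct c).ext ?_
    rintro ⟨⟨i, j⟩, n⟩
    simp only [Basis.tensorProduct_apply, h₁, h₂, h]

variable [FiniteDimensional k A] [DecidableEq iA]

theorem sharp_basis [DecidableEq iB] (T : A ⊗[k] B →ₗ[k] B ⊗[k] A) (j : iB) (i : iA) :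
    sharp T (b j ⊗ₜ a.coord i) =
      ∑ p, ∑ r, coeff a b b a T p j r i • (a.coord p ⊗ₜ[k] b r) := by
  simp only [sharp, LinearMap.comp_apply, LinearEquiv.coe_coe]
  rw [LinearEquiv.symm_apply_eq]
  refine a.ext fun s => ?_
  simp [sharpAux, contractRight, apply_eq_sum_coeff a b b a, Finsupp.single_apply]

/-- In coordinates ♯ is a partial transposition, so identities for T♯ are those for T with indices
permuted. -/
theorem coeff_sharp [DecidableEq iB] (T : A ⊗[k] B →ₗ[k] B ⊗[k] A) :
    coeff b a.dualBasis a.dualBasis b (sharp T) = fun j i p r => coeff a b b a T p j r i :=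
  coeff_eq_of_apply_eq _ _ _ _ _ _ fun j i => by
    simpa using sharp_basis a b T j i

end Coordinates

/-! ### Koszul relations and compatibility conditions in coordinates. -/

section KoszulCoordinates

variable {k : Type u} [Field k] {I : Type} [Fintype I] [DecidableEq I]

/-- The elements `x i` and `y i` of an algebra satisfy the Koszul relations of the R-matrix with
coefficients `r`. -/
structure KoszulRep (q : k) (r : I → I → I → I → k) {E : Type*} [Ring E] [Algebra k E]
    (x y : I → E) : Prop where
  ext : ∀ i j, ∑ a, ∑ b, r i j a b • (x a * x b) = -q⁻¹ • (x i * x j)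
  mixed : ∀ i j, ∑ a, ∑ b, r a i b j • (y a * x b) = q • (x i * y j)
  sym : ∀ i j, ∑ a, ∑ b, r b a j i • (y a * y b) = q • (y i * y j)

/-- The sum of a matrix of quadratic relations and a multiple of the identity. -/
def addId (r : I → I → I → I → k) (c : k) : I → I → I → I → k :=
  fun i j a b => r i j a b + c * ((if i = a then 1 else 0) * (if j = b then 1 else 0))

/-- The coefficients of `R♯♯`, in terms of those of `R`. -/
def flipCoeff (r : I → I → I → I → k) : I → I → I → I → k := fun i j a b => r b a j i

theorem satisfiesQuad_addId {E : Type*} [Ring E] [Algebra k E] {r : I → I → I → I → k} {c : k}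
    {x : I → E} : SatisfiesQuad (addId r c) x ↔
      ∀ i j, ∑ a, ∑ b, r i j a b • (x a * x b) = -c • (x i * x j) := by
  refine forall_congr' fun i => forall_congr' fun j => ?_
  rw [neg_smul, ← add_eq_zero_iff_eq_neg]
  simp [addId, add_smul, Finset.sum_add_distrib, ite_smul]

/-- Puts the Koszul relations in the form needed for twisted tensor products: the dual letters come
first, and the mixed relation becomes an exchange rule after division by q. -/
theorem koszulRep_iff {q : k} (hq : q ≠ 0) {r : I → I → I → I → k} {E : Type*} [Ring E]
    [Algebra k E] {x y : I → E} : KoszulRep q r x y ↔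
      SatisfiesQuad (addId (flipCoeff r) (-q)) y ∧ SatisfiesQuad (addId r q⁻¹) x ∧
        SatisfiesExchange (fun j i p s => q⁻¹ * r p j s i) y x := by
  rw [satisfiesQuad_addId, satisfiesQuad_addId]
  have : SatisfiesExchange (fun j i p s => q⁻¹ * r p j s i) y x ↔
      ∀ i j, ∑ a, ∑ b, r a i b j • (y a * x b) = q • (x i * y j) := by
    refine forall_congr' fun i => forall_congr' fun j => ?_
    simp only [mul_smul, ← Finset.smul_sum]
    rw [eq_inv_smul_iff₀ hq, eq_comm]
  rw [this]
  simp only [neg_neg, flipCoeff]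
  exact ⟨fun h => ⟨h.sym, h.ext, h.mixed⟩, fun h => ⟨h.2.1, h.2.2, h.1⟩⟩

variable {J : Type} [Fintype J] [DecidableEq J]

/-- Both conditions are linear in D or C and quadratic in θ, and they hold trivially when D or C is
the identity. Hence R may be replaced by R + c, whose relations define eigenspace quotients, and θ
may be rescaled. -/
theorem IsTwist.addId {D : I → I → I → I → k} {C : J → J → J → J → k} {θ : J → I → I → J → k}
    (h : IsTwist D C θ) (c c' t : k) :
    IsTwist (addId D c) (HeckeKoszul.addId C c') (fun j i p s => t * θ j i p s) := by
  constructor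
  · intro j i₁ i₂ p r s
    have := congrArg (fun z => t * t * z) (h.left j i₁ i₂ p r s)
    simp only [Finset.mul_sum] at this
    simp only [HeckeKoszul.addId, add_mul, mul_add, Finset.sum_add_distrib]
    congr 1
    · refine Eq.trans (Eq.trans ?_ this) ?_ <;> exact Fintype.sum_congr _ _ fun _ =>
        Fintype.sum_congr _ _ fun _ => Fintype.sum_congr _ _ fun _ => by ring
    · simp
      exact Fintype.sum_congr _ _ fun _ => by ring
  · intro j₁ j₂ i p r s
    have := congrArg (fun z => t * t * z) (h.right j₁ j₂ i p r s)
    simp only [Finset.mul_sum] at this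
    simp only [HeckeKoszul.addId, add_mul, mul_add, Finset.sum_add_distrib]
    congr 1
    · refine Eq.trans (Eq.trans ?_ this) ?_ <;> exact Fintype.sum_congr _ _ fun _ =>
        Fintype.sum_congr _ _ fun _ => Fintype.sum_congr _ _ fun _ => by ring
    · simp
      exact Fintype.sum_congr _ _ fun _ => by ring

theorem sum_congr_three {α β γ M : Type*} [Fintype α] [Fintype β] [Fintype γ] [AddCommMonoid M]
    {f g : α → β → γ → M} (h : ∀ a b c, f a b c = g a b c) :
    ∑ a, ∑ b, ∑ c, f a b c = ∑ a, ∑ b, ∑ c, g a b c := by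
  simp only [h]

/-- Reading both conditions from output to input keeps each of them; this version serves the
algebras on V* and U*. -/
theorem IsTwist.transpose {D : I → I → I → I → k} {C : J → J → J → J → k}
    {θ : J → I → I → J → k} (h : IsTwist D C θ) :
    IsTwist (flipCoeff D) (flipCoeff C) (fun j i p s => θ s p i j) := by
  constructor
  · intro j i₁ i₂ p r s
    refine Eq.trans (Eq.trans ?_ (h.left s r p i₂ i₁ j).symm) ?_
    · rw [Finset.sum_comm]; exact sum_congr_three fun _ _ _ => by rw [flipCoeff]; ring
    · rw [Finset.sum_comm]; exact sum_congr_three fun _ _ _ => by rw [flipCoeff]; ring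
  · intro j₁ j₂ i p r s
    refine Eq.trans (Eq.trans ?_ (h.right s r p i j₂ j₁).symm) ?_
    · rw [Finset.sum_comm]; exact sum_congr_three fun _ _ _ => by rw [flipCoeff]; ring
    · rw [Finset.sum_comm]; exact sum_congr_three fun _ _ _ => by rw [flipCoeff]; ring

/-- Partial transposition interchanges the left and the right condition. For θ = R it orders K(V),
and for θ = Q it exchanges Λ(V) with S(U*). -/
theorem IsTwist.sharp {D : I → I → I → I → k} {C : J → J → J → J → k}
    {θ : J → I → I → J → k} (h : IsTwist D C θ) :
    IsTwist (flipCoeff C) D (fun i j p s => θ p i s j) := by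
  constructor
  · intro j i₁ i₂ p r s
    refine Eq.trans (Eq.trans ?_ (h.right r p j s i₂ i₁).symm) ?_
    · rw [Finset.sum_comm]; exact sum_congr_three fun _ _ _ => by rw [flipCoeff]; ring
    · rw [Finset.sum_comm]; exact sum_congr_three fun _ _ _ => by rw [flipCoeff]; ring
  · intro j₁ j₂ i p r s
    refine Eq.trans (Eq.trans ?_ (h.left p j₁ j₂ r s i)) ?_
    · exact sum_congr_three fun _ _ _ => by ring
    · exact sum_congr_three fun _ _ _ => by ring

/-- Both right-hand conditions have Yang–Baxter shape with T occurring twice. For D = R, C = R' and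
T = Q they are the gluing identities; for D = C = T = R both reduce to the braid relation. -/
theorem isTwist_coeff_iff {A B : Type*} [AddCommGroup A] [Module k A] [AddCommGroup B] [Module k B]
    (a : Basis I k A) (b : Basis J k B) (D : A ⊗[k] A →ₗ[k] A ⊗[k] A)
    (C : B ⊗[k] B →ₗ[k] B ⊗[k] B) (T : B ⊗[k] A →ₗ[k] A ⊗[k] B) :
    IsTwist (coeff a a a a D) (coeff b b b b C) (coeff b a a b T) ↔
      (oneTensor A T ∘ₗ LinearMap.rTensor A T ∘ₗ oneTensor B D =
        LinearMap.rTensor B D ∘ₗ oneTensor A T ∘ₗ LinearMap.rTensor A T) ∧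
      (LinearMap.rTensor B T ∘ₗ oneTensor B T ∘ₗ LinearMap.rTensor A C =
        oneTensor A C ∘ₗ LinearMap.rTensor B T ∘ₗ oneTensor B T) := by
  rw [eq_comm (a := LinearMap.rTensor B T ∘ₗ _),
    yangBaxter_iff_coeff b a a a a a a b a b a b D T T T T D,
    yangBaxter_iff_coeff b b a a b a b b a b b b T T C C T T]
  have e₁ : ∀ j i₁ i₂ p r s, ∑ x, ∑ y, ∑ m, coeff b a a b T j i₁ x y * coeff b a a b T y i₂ m s *
      coeff a a a a D x m p r = ∑ x, ∑ y, ∑ m, coeff b a a b T j i₁ x m *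
        coeff b a a b T m i₂ y s * coeff a a a a D x y p r :=
    fun _ _ _ _ _ _ => Fintype.sum_congr _ _ fun _ => Finset.sum_comm
  have e₂ : ∀ i j n p r s, ∑ x, ∑ y, ∑ m, coeff b a a b T j n x y * coeff b a a b T i x p m *
      coeff b b b b C m y r s = ∑ x, ∑ y, ∑ m, coeff b a a b T j n m y *
        coeff b a a b T i m p x * coeff b b b b C x y r s := fun _ _ _ _ _ _ => by
    rw [Finset.sum_comm_cycle]
    exact Fintype.sum_congr _ _ fun _ => Finset.sum_comm
  simp only [e₁, e₂]
  refine ⟨fun h => ⟨fun j i₁ i₂ p r s => ?_, fun i j n p r s => ?_⟩,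
    fun h => ⟨fun j i₁ i₂ p r s => ?_, fun i j n p r s => ?_⟩⟩
  · refine Eq.trans (sum_congr_three fun _ _ _ => ?_) (h.left j i₁ i₂ p r s)
    ring
  · refine Eq.trans (h.right i j n p r s).symm (sum_congr_three fun _ _ _ => ?_)
    ring
  · refine Eq.trans (sum_congr_three fun _ _ _ => ?_) (h.1 j i₁ i₂ p r s)
    ring
  · refine Eq.trans (sum_congr_three fun _ _ _ => ?_) (h.2 i j n p r s).symm
    ring

end KoszulCoordinates


/-! ### Presentation and normal ordering of the Koszul complex. -/

section KoszulPresentation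

variable {k : Type u} [Field k] {V : Type*} [AddCommGroup V] [Module k V] [FiniteDimensional k V]
  {q : k} {R : V ⊗[k] V →ₗ[k] V ⊗[k] V}

@[simp]
theorem tensorMul_tmul {A B S : Type*} [AddCommGroup A] [Module k A] [AddCommGroup B] [Module k B]
    [Ring S] [Algebra k S] (f : A →ₗ[k] S) (g : B →ₗ[k] S) (a : A) (b : B) :
    tensorMul f g (a ⊗ₜ b) = f a * g b := rfl

theorem map_tensorMul {A B S S' : Type*} [AddCommGroup A] [Module k A] [AddCommGroup B]
    [Module k B] [Ring S] [Algebra k S] [Ring S'] [Algebra k S'] (F : S →ₐ[k] S')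
    (f : A →ₗ[k] S) (g : B →ₗ[k] S) (t : A ⊗[k] B) :
    F (tensorMul f g t) = tensorMul (F.toLinearMap ∘ₗ f) (F.toLinearMap ∘ₗ g) t := by
  induction t with
  | zero => simp
  | tmul a b => simp
  | add s t hs ht => simp [hs, ht]

theorem proj_rel {s t : TensorAlgebra k (V × Dual k V)} (h : KoszulRel q R s t) :
    proj q R s = proj q R t :=
  RingQuot.mkAlgHom_rel k h

theorem proj_surjective : Function.Surjective (proj q R) :=
  RingQuot.mkAlgHom_surjective k (KoszulRel q R)

theorem gen_ext (v v₁ : V) : tensorMul (gen q R) (gen q R) (R (v ⊗ₜ v₁)) =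
    -q⁻¹ • (gen q R v * gen q R v₁) := by
  have := proj_rel (KoszulRel.ext (q := q) (R := R) v v₁)
  rw [map_tensorMul, map_smul, map_mul] at this
  exact this

theorem gen_mixed (v : V) (ξ : Dual k V) :
    tensorMul (dualGen q R) (gen q R) (sharp R (v ⊗ₜ ξ)) = q • (gen q R v * dualGen q R ξ) := by
  have := proj_rel (KoszulRel.mixed (q := q) (R := R) v ξ)
  rw [map_tensorMul, map_smul, map_mul] at this
  exact this

theorem gen_sym (ξ ξ₁ : Dual k V) :
    tensorMul (dualGen q R) (dualGen q R) (sharp (sharp R) (ξ ⊗ₜ ξ₁)) =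
      q • (dualGen q R ξ * dualGen q R ξ₁) := by
  have := proj_rel (KoszulRel.sym (q := q) (R := R) ξ ξ₁)
  rw [map_tensorMul, map_smul, map_mul] at this
  exact this

variable {I : Type} [Fintype I] [DecidableEq I] (b : Basis I k V)

theorem sharp_sharp_basis (i j : I) : sharp (sharp R) (b.coord i ⊗ₜ b.coord j) =
    ∑ p, ∑ s, coeff b b b b R s p j i • (b.coord p ⊗ₜ[k] b.coord s) := by
  have := sharp_basis b b.dualBasis (sharp R) i j
  rw [coeff_sharp] at this
  simpa using this

theorem koszulRep_gen : KoszulRep q (coeff b b b b R) (fun i => gen q R (b i))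
    (fun i => dualGen q R (b.coord i)) where
  ext i j := by
    rw [← gen_ext, apply_eq_sum_coeff b b b b]; simp
  mixed i j := by
    rw [← gen_mixed, sharp_basis b b]; simp
  sym i j := by
    rw [← gen_sym, sharp_sharp_basis]; simp

/-- The universal property of the Koszul complex, in coordinates. -/
theorem exists_koszul_lift {E : Type*} [Ring E] [Algebra k E] {x y : I → E}
    (h : KoszulRep q (coeff b b b b R) x y) :
    ∃ F : Koszul q R →ₐ[k] E, (∀ i, F (gen q R (b i)) = x i) ∧
      ∀ i, F (dualGen q R (b.coord i)) = y i := by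
  let f : V →ₗ[k] E := b.constr k x
  let g : Dual k V →ₗ[k] E := b.dualBasis.constr k y
  have hf : ∀ i, f (b i) = x i := fun i => by simp [f]
  have hg : ∀ i, g (b.coord i) = y i := fun i => by
    rw [← b.coe_dualBasis]; exact b.dualBasis.constr_basis k y i
  let G : TensorAlgebra k (V × Dual k V) →ₐ[k] E := TensorAlgebra.lift k (f.coprod g)
  have hGf : G.toLinearMap ∘ₗ genT k V = f := by ext v; simp [G, genT]
  have hGg : G.toLinearMap ∘ₗ dualGenT k V = g := by ext v; simp [G, dualGenT]
  have hGf' : ∀ v, G (genT k V v) = f v := fun v => LinearMap.congr_fun hGf v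
  have hGg' : ∀ v, G (dualGenT k V v) = g v := fun v => LinearMap.congr_fun hGg v
  have hG : ∀ ⦃s t⦄, KoszulRel q R s t → G s = G t := by
    rintro _ _ (⟨v, v₁⟩ | ⟨v, ξ⟩ | ⟨ξ, ξ₁⟩)
    · simp only [map_tensorMul, hGf, map_smul, map_mul, hGf']
      suffices tensorMul f f ∘ₗ R = -q⁻¹ • tensorMul f f from LinearMap.congr_fun this (v ⊗ₜ v₁)
      refine (b.tensorProduct b).ext ?_
      rintro ⟨i, j⟩
      simp [apply_eq_sum_coeff b b b b, hf, ← h.ext]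
    · simp only [map_tensorMul, hGf, hGg, map_smul, map_mul, hGf', hGg']
      suffices tensorMul g f ∘ₗ sharp R = q • tensorMul f g from
        LinearMap.congr_fun this (v ⊗ₜ ξ)
      refine (b.tensorProduct b.dualBasis).ext ?_
      rintro ⟨i, j⟩
      simp [sharp_basis b b, hf, hg, ← h.mixed]
    · simp only [map_tensorMul, hGg, map_smul, map_mul, hGg']
      suffices tensorMul g g ∘ₗ sharp (sharp R) = q • tensorMul g g from
        LinearMap.congr_fun this (ξ ⊗ₜ ξ₁)
      refine (b.dualBasis.tensorProduct b.dualBasis).ext ?_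
      rintro ⟨i, j⟩
      simp [sharp_sharp_basis b, hg, ← h.sym]
  refine ⟨RingQuot.liftAlgHom k ⟨G, hG⟩, fun i => ?_, fun i => ?_⟩
  · exact (RingQuot.liftAlgHom_mkAlgHom_apply k G hG _).trans ((hGf' _).trans (hf i))
  · exact (RingQuot.liftAlgHom_mkAlgHom_apply k G hG _).trans ((hGg' _).trans (hg i))

theorem adjoin_gen : Algebra.adjoin k (Set.range (fun i => dualGen q R (b.coord i)) ∪
    Set.range (fun i => gen q R (b i))) = ⊤ := by
  set N := Algebra.adjoin k (Set.range (fun i => dualGen q R (b.coord i)) ∪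
    Set.range (fun i => gen q R (b i))) with hN
  have h₁ : ∀ v, gen q R v ∈ N := by
    intro v
    rw [← b.sum_repr v, map_sum]
    refine Subalgebra.sum_mem _ fun i _ => ?_
    rw [map_smul]
    exact N.smul_mem (Algebra.subset_adjoin (Or.inr ⟨i, rfl⟩)) _
  have h₂ : ∀ ξ, dualGen q R ξ ∈ N := by
    intro ξ
    rw [← b.dualBasis.sum_repr ξ, map_sum]
    refine Subalgebra.sum_mem _ fun i _ => ?_
    rw [map_smul, b.coe_dualBasis]
    exact N.smul_mem (Algebra.subset_adjoin (Or.inl ⟨i, rfl⟩)) _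
  have h₃ : (⊤ : Subalgebra k (TensorAlgebra k (V × Dual k V))) ≤ N.comap (proj q R) := by
    rw [← TensorAlgebra.adjoin_range_ι, Algebra.adjoin_le_iff]
    rintro _ ⟨⟨v, ξ⟩, rfl⟩
    have : (v, ξ) = LinearMap.inl k V (Dual k V) v + LinearMap.inr k V (Dual k V) ξ := by simp
    rw [this, map_add]
    exact (N.comap (proj q R)).add_mem (h₁ v) (h₂ ξ)
  rw [eq_top_iff]
  intro x _
  obtain ⟨t, rfl⟩ := proj_surjective x
  exact h₃ trivial

theorem isTwist_of_braid
    (h : LinearMap.rTensor V R ∘ₗ oneTensor V R ∘ₗ LinearMap.rTensor V R =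
      oneTensor V R ∘ₗ LinearMap.rTensor V R ∘ₗ oneTensor V R) :
    IsTwist (coeff b b b b R) (coeff b b b b R) (coeff b b b b R) :=
  (isTwist_coeff_iff b b R R R).2 ⟨h.symm, h⟩

variable (q R) in
/-- The map from the quadratic algebra on `V` to the Koszul complex. -/
noncomputable def extHom (hq : q ≠ 0) :
    QuadAlg (addId (coeff b b b b R) q⁻¹) →ₐ[k] Koszul q R :=
  QuadAlg.lift ((koszulRep_iff hq).1 (koszulRep_gen b)).2.1

variable (q R) in
/-- The map from the quadratic algebra on `V*` to the Koszul complex. -/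
noncomputable def symHom (hq : q ≠ 0) :
    QuadAlg (addId (flipCoeff (coeff b b b b R)) (-q)) →ₐ[k] Koszul q R :=
  QuadAlg.lift ((koszulRep_iff hq).1 (koszulRep_gen b)).1

@[simp]
theorem extHom_x (hq : q ≠ 0) (i : I) : extHom q R b hq (QuadAlg.x _ i) = gen q R (b i) := by
  simp [extHom]

@[simp]
theorem symHom_x (hq : q ≠ 0) (i : I) :
    symHom q R b hq (QuadAlg.x _ i) = dualGen q R (b.coord i) := by
  simp [symHom]

/-- The normal ordering theorem for the Koszul complex. -/
theorem bijective_mulOf_symHom_extHom (hq : q ≠ 0)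
    (h : LinearMap.rTensor V R ∘ₗ oneTensor V R ∘ₗ LinearMap.rTensor V R =
      oneTensor V R ∘ₗ LinearMap.rTensor V R ∘ₗ oneTensor V R) :
    Function.Bijective (mulOf (symHom q R b hq) (extHom q R b hq)) := by
  have hK := (koszulRep_iff hq).1 (koszulRep_gen (q := q) (R := R) b)
  refine ((isTwist_of_braid b h).sharp.addId (-q) q⁻¹ q⁻¹).bijective_mulOf hK.1 hK.2.1 hK.2.2
    (adjoin_gen b) ?_
  intro E _ _ x' y' hx hy hxy
  obtain ⟨F, h₁, h₂⟩ := exists_koszul_lift (q := q) (R := R) b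
    ((koszulRep_iff hq).2 ⟨hx, hy, hxy⟩)
  exact ⟨F, h₂, h₁⟩

end KoszulPresentation

/-! ### Operators on threefold tensor products. -/

section TensorTwo

variable {k : Type*} [Field k] {A B C D A' B' C' X : Type*}
  [AddCommGroup A] [Module k A] [AddCommGroup B] [Module k B] [AddCommGroup C] [Module k C]
  [AddCommGroup D] [Module k D] [AddCommGroup A'] [Module k A'] [AddCommGroup B'] [Module k B']
  [AddCommGroup C'] [Module k C'] [AddCommGroup X] [Module k X]

theorem oneTensor_tmul (T : B ⊗[k] C →ₗ[k] B' ⊗[k] C') (a : A) (t : B ⊗[k] C) :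
    oneTensor A T ((TensorProduct.assoc k A B C).symm (a ⊗ₜ t)) =
      (TensorProduct.assoc k A B' C').symm (a ⊗ₜ T t) := by
  simp [oneTensor]

theorem map_map_assoc_symm (f : A →ₗ[k] A') (g : B →ₗ[k] B') (h : C →ₗ[k] C')
    (a : A) (t : B ⊗[k] C) :
    TensorProduct.map (TensorProduct.map f g) h ((TensorProduct.assoc k A B C).symm (a ⊗ₜ t)) =
      (TensorProduct.assoc k A' B' C').symm (f a ⊗ₜ TensorProduct.map g h t) := by
  induction t with
  | zero => simp
  | tmul b c => simp
  | add s t hs ht => simp only [TensorProduct.tmul_add, map_add, hs, ht]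

/-- Computes an operator on X ⊗ X block by block. The scalar c accounts for the term (q - q⁻¹) u ⊗ v
of a Hecke sum and is 0 on the other three blocks. -/
theorem rTensor_map_map {T : X ⊗[k] X →ₗ[k] X ⊗[k] X} {f : A →ₗ[k] X} {g : B →ₗ[k] X}
    {f' : A' →ₗ[k] X} {g' : B' →ₗ[k] X} {S : A ⊗[k] B →ₗ[k] A' ⊗[k] B'} {c : k}
    (hT : ∀ t, T (TensorProduct.map f g t) =
      TensorProduct.map f' g' (S t) + c • TensorProduct.map f g t)
    (h : C →ₗ[k] X) (s : (A ⊗[k] B) ⊗[k] C) :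
    LinearMap.rTensor X T (TensorProduct.map (TensorProduct.map f g) h s) =
      TensorProduct.map (TensorProduct.map f' g') h (LinearMap.rTensor C S s) +
        c • TensorProduct.map (TensorProduct.map f g) h s := by
  induction s with
  | zero => simp
  | tmul t c' => simp [hT, TensorProduct.add_tmul, TensorProduct.smul_tmul']
  | add s t hs ht => simp only [map_add, hs, ht, smul_add]; abel

theorem oneTensor_map_map {T : X ⊗[k] X →ₗ[k] X ⊗[k] X} {f : A →ₗ[k] X} {g : B →ₗ[k] X}
    {f' : A' →ₗ[k] X} {g' : B' →ₗ[k] X} {S : A ⊗[k] B →ₗ[k] A' ⊗[k] B'} {c : k}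
    (hT : ∀ t, T (TensorProduct.map f g t) =
      TensorProduct.map f' g' (S t) + c • TensorProduct.map f g t)
    (h : C →ₗ[k] X) (s : (C ⊗[k] A) ⊗[k] B) :
    oneTensor X T (TensorProduct.map (TensorProduct.map h f) g s) =
      TensorProduct.map (TensorProduct.map h f') g' (oneTensor C S s) +
        c • TensorProduct.map (TensorProduct.map h f) g s := by
  obtain ⟨s, rfl⟩ := (TensorProduct.assoc k C A B).symm.surjective s
  induction s with
  | zero => simp
  | tmul c' t =>
    simp only [oneTensor_tmul, map_map_assoc_symm, hT, TensorProduct.tmul_add,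
      TensorProduct.tmul_smul, map_add, map_smul]
  | add s t hs ht => simp only [map_add, hs, ht, smul_add]; abel

theorem rTensor_symm_rTensor (T : A ⊗[k] B ≃ₗ[k] A' ⊗[k] B') (s : (A ⊗[k] B) ⊗[k] C) :
    LinearMap.rTensor C T.symm.toLinearMap (LinearMap.rTensor C T.toLinearMap s) = s := by
  rw [← LinearMap.rTensor_comp_apply]; simp

theorem rTensor_rTensor_symm (T : A ⊗[k] B ≃ₗ[k] A' ⊗[k] B') (s : (A' ⊗[k] B') ⊗[k] C) :
    LinearMap.rTensor C T.toLinearMap (LinearMap.rTensor C T.symm.toLinearMap s) = s := by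
  rw [← LinearMap.rTensor_comp_apply]; simp

theorem oneTensor_oneTensor (T : A ⊗[k] B →ₗ[k] A' ⊗[k] B') (S : A' ⊗[k] B' →ₗ[k] X ⊗[k] D)
    (s : (C ⊗[k] A) ⊗[k] B) : oneTensor C S (oneTensor C T s) = oneTensor C (S ∘ₗ T) s := by
  simp [oneTensor, LinearMap.lTensor_comp]

theorem oneTensor_id (s : (C ⊗[k] A) ⊗[k] B) :
    oneTensor C (LinearMap.id : A ⊗[k] B →ₗ[k] A ⊗[k] B) s = s := by
  simp [oneTensor]

theorem oneTensor_symm_oneTensor (T : A ⊗[k] B ≃ₗ[k] A' ⊗[k] B') (s : (C ⊗[k] A) ⊗[k] B) :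
    oneTensor C T.symm.toLinearMap (oneTensor C T.toLinearMap s) = s := by
  rw [oneTensor_oneTensor]; simp [oneTensor_id]

theorem oneTensor_oneTensor_symm (T : A ⊗[k] B ≃ₗ[k] A' ⊗[k] B') (s : (C ⊗[k] A') ⊗[k] B') :
    oneTensor C T.toLinearMap (oneTensor C T.symm.toLinearMap s) = s := by
  rw [oneTensor_oneTensor]; simp [oneTensor_id]

theorem oneTensor_add_smul_id (T : A ⊗[k] B →ₗ[k] A ⊗[k] B) (c : k) (s : (C ⊗[k] A) ⊗[k] B) :
    oneTensor C (LinearMap.id + c • T) s = s + c • oneTensor C T s := by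
  simp [oneTensor, LinearMap.lTensor_add, LinearMap.lTensor_smul]

end TensorTwo

/-! ### The Hecke sum satisfies the braid relation. -/

section HeckeSum

variable {k : Type*} [Field k]
  {V : Type*} [AddCommGroup V] [Module k V] [FiniteDimensional k V]
  {U : Type*} [AddCommGroup U] [Module k U] [FiniteDimensional k U]
  (q : k) (R : V ⊗[k] V →ₗ[k] V ⊗[k] V) (R' : U ⊗[k] U →ₗ[k] U ⊗[k] U)
  (Q : U ⊗[k] V ≃ₗ[k] V ⊗[k] U)

local notation "iV" => LinearMap.inl k V U
local notation "iU" => LinearMap.inr k V U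

theorem heckeSum_inl_inl (t : V ⊗[k] V) :
    heckeSum q R R' Q (TensorProduct.map iV iV t) = TensorProduct.map iV iV (R t) := by
  simp [heckeSum, TensorProduct.map_map]

theorem heckeSum_inl_inr (t : V ⊗[k] U) :
    heckeSum q R R' Q (TensorProduct.map iV iU t) = TensorProduct.map iU iV (Q.symm t) := by
  simp [heckeSum, TensorProduct.map_map]

theorem heckeSum_inr_inl (t : U ⊗[k] V) :
    heckeSum q R R' Q (TensorProduct.map iU iV t) = TensorProduct.map iV iU (Q t) +
      (q - q⁻¹) • TensorProduct.map iU iV t := by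
  simp [heckeSum, TensorProduct.map_map]

theorem heckeSum_inr_inr (t : U ⊗[k] U) :
    heckeSum q R R' Q (TensorProduct.map iU iU t) = TensorProduct.map iU iU (R' t) := by
  simp [heckeSum, TensorProduct.map_map]

variable {q R R' Q}

theorem IsHecke.comp_self (h : IsHecke q R) : R ∘ₗ R = LinearMap.id + (q - q⁻¹) • R := by
  have h₁ := h.quadratic
  have hq := h.q_ne_zero
  ext x y
  have := LinearMap.congr_fun h₁ (x ⊗ₜ y)
  simp only [LinearMap.comp_apply, LinearMap.sub_apply, LinearMap.add_apply, LinearMap.smul_apply,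
    LinearMap.id_apply, map_add, map_smul, LinearMap.zero_apply, smul_sub, smul_smul,
    inv_mul_cancel₀ hq, one_smul] at this
  simp only [LinearMap.comp_apply, LinearMap.add_apply, LinearMap.smul_apply, LinearMap.id_apply,
    TensorProduct.AlgebraTensorModule.curry_apply, TensorProduct.curry_apply,
    LinearMap.coe_restrictScalars, sub_smul]
  rw [← sub_eq_zero, ← this]
  abel

/-- The relation is checked on the eight blocks of X ⊗ X ⊗ X. Three equal letters give the braid
relations of R and R'; the blocks with two V's use `compat_left`, those with two U's use
`compat_right`. -/
theorem heckeSum_braid (hR : IsHecke q R) (hR' : IsHecke q R') (hQ : IsGluing R R' Q) :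
    LinearMap.rTensor (V × U) (heckeSum q R R' Q) ∘ₗ oneTensor (V × U) (heckeSum q R R' Q) ∘ₗ
        LinearMap.rTensor (V × U) (heckeSum q R R' Q) =
      oneTensor (V × U) (heckeSum q R R' Q) ∘ₗ LinearMap.rTensor (V × U) (heckeSum q R R' Q) ∘ₗ
        oneTensor (V × U) (heckeSum q R R' Q) := by
  set H := heckeSum q R R' Q
  -- The zero multiple brings all four blocks to the shape required by `rTensor_map_map` and
  -- `oneTensor_map_map`.
  have vv : ∀ t, H (TensorProduct.map iV iV t) = TensorProduct.map iV iV (R t) +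
      (0 : k) • TensorProduct.map iV iV t := fun t => by simp [H, heckeSum_inl_inl]
  have vu : ∀ t, H (TensorProduct.map iV iU t) = TensorProduct.map iU iV (Q.symm.toLinearMap t) +
      (0 : k) • TensorProduct.map iV iU t := fun t => by simp [H, heckeSum_inl_inr]
  have uv : ∀ t, H (TensorProduct.map iU iV t) = TensorProduct.map iV iU (Q.toLinearMap t) +
      (q - q⁻¹) • TensorProduct.map iU iV t := heckeSum_inr_inl q R R' Q
  have uu : ∀ t, H (TensorProduct.map iU iU t) = TensorProduct.map iU iU (R' t) +
      (0 : k) • TensorProduct.map iU iU t := fun t => by simp [H, heckeSum_inr_inr]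
  have L := LinearMap.congr_fun hQ.compat_left
  have L' := LinearMap.congr_fun hQ.compat_right
  simp only [LinearMap.comp_apply] at L L'
  have vvv : ∀ x y z, LinearMap.rTensor (V × U) H (oneTensor (V × U) H
      (LinearMap.rTensor (V × U) H ((iV x ⊗ₜ iV y) ⊗ₜ iV z))) = oneTensor (V × U) H
      (LinearMap.rTensor (V × U) H (oneTensor (V × U) H ((iV x ⊗ₜ iV y) ⊗ₜ iV z))) := by
    intro x y z
    have := LinearMap.congr_fun hR.braid ((x ⊗ₜ y) ⊗ₜ z)
    simp only [LinearMap.comp_apply] at this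
    simp only [← TensorProduct.map_tmul, rTensor_map_map vv, oneTensor_map_map vv, zero_smul,
      add_zero, this]
  have uuu : ∀ x y z, LinearMap.rTensor (V × U) H (oneTensor (V × U) H
      (LinearMap.rTensor (V × U) H ((iU x ⊗ₜ iU y) ⊗ₜ iU z))) = oneTensor (V × U) H
      (LinearMap.rTensor (V × U) H (oneTensor (V × U) H ((iU x ⊗ₜ iU y) ⊗ₜ iU z))) := by
    intro x y z
    have := LinearMap.congr_fun hR'.braid ((x ⊗ₜ y) ⊗ₜ z)
    simp only [LinearMap.comp_apply] at this
    simp only [← TensorProduct.map_tmul, rTensor_map_map uu, oneTensor_map_map uu, zero_smul,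
      add_zero, this]
  -- Since Q⁻¹ acts here, the gluing identity is evaluated at a vector on which both factors Q
  -- cancel.
  have vvu : ∀ x y z, LinearMap.rTensor (V × U) H (oneTensor (V × U) H
      (LinearMap.rTensor (V × U) H ((iV x ⊗ₜ iV y) ⊗ₜ iU z))) = oneTensor (V × U) H
      (LinearMap.rTensor (V × U) H (oneTensor (V × U) H ((iV x ⊗ₜ iV y) ⊗ₜ iU z))) := by
    intro x y z
    have := L (LinearMap.rTensor V Q.symm.toLinearMap (oneTensor V Q.symm.toLinearMap
      ((x ⊗ₜ y) ⊗ₜ z)))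
    rw [rTensor_rTensor_symm, oneTensor_oneTensor_symm] at this
    simp only [← TensorProduct.map_tmul, rTensor_map_map vv, oneTensor_map_map vv,
      rTensor_map_map vu, oneTensor_map_map vu, zero_smul, add_zero, ← this,
      oneTensor_symm_oneTensor, rTensor_symm_rTensor]
  have vuu : ∀ x y z, LinearMap.rTensor (V × U) H (oneTensor (V × U) H
      (LinearMap.rTensor (V × U) H ((iV x ⊗ₜ iU y) ⊗ₜ iU z))) = oneTensor (V × U) H
      (LinearMap.rTensor (V × U) H (oneTensor (V × U) H ((iV x ⊗ₜ iU y) ⊗ₜ iU z))) := by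
    intro x y z
    have := L' (oneTensor U Q.symm.toLinearMap (LinearMap.rTensor U Q.symm.toLinearMap
      ((x ⊗ₜ y) ⊗ₜ z)))
    rw [oneTensor_oneTensor_symm, rTensor_rTensor_symm] at this
    simp only [← TensorProduct.map_tmul, rTensor_map_map uu, oneTensor_map_map uu,
      rTensor_map_map vu, oneTensor_map_map vu, zero_smul, add_zero, ← this,
      oneTensor_symm_oneTensor, rTensor_symm_rTensor]
  have vuv : ∀ x y z, LinearMap.rTensor (V × U) H (oneTensor (V × U) H
      (LinearMap.rTensor (V × U) H ((iV x ⊗ₜ iU y) ⊗ₜ iV z))) = oneTensor (V × U) H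
      (LinearMap.rTensor (V × U) H (oneTensor (V × U) H ((iV x ⊗ₜ iU y) ⊗ₜ iV z))) := by
    intro x y z
    have := L (LinearMap.rTensor V Q.symm.toLinearMap ((x ⊗ₜ y) ⊗ₜ z))
    rw [rTensor_rTensor_symm] at this
    simp only [← TensorProduct.map_tmul, rTensor_map_map vv, oneTensor_map_map vv, map_add,
      map_smul, rTensor_map_map vu, oneTensor_map_map vu, rTensor_map_map uv,
      oneTensor_map_map uv, zero_smul, add_zero, ← this, oneTensor_symm_oneTensor]
  have uvu : ∀ x y z, LinearMap.rTensor (V × U) H (oneTensor (V × U) H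
      (LinearMap.rTensor (V × U) H ((iU x ⊗ₜ iV y) ⊗ₜ iU z))) = oneTensor (V × U) H
      (LinearMap.rTensor (V × U) H (oneTensor (V × U) H ((iU x ⊗ₜ iV y) ⊗ₜ iU z))) := by
    intro x y z
    have := L' (oneTensor U Q.symm.toLinearMap ((x ⊗ₜ y) ⊗ₜ z))
    rw [oneTensor_oneTensor_symm] at this
    simp only [← TensorProduct.map_tmul, rTensor_map_map uu, oneTensor_map_map uu, map_add,
      map_smul, rTensor_map_map vu, oneTensor_map_map vu, rTensor_map_map uv,
      oneTensor_map_map uv, zero_smul, add_zero, ← this, rTensor_symm_rTensor]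
  -- The term (q - q⁻¹) u ⊗ v leaves R² on one side only; the quadratic relation R² = 1 + (q - q⁻¹)
  -- R balances it against the other.
  have uvv : ∀ x y z, LinearMap.rTensor (V × U) H (oneTensor (V × U) H
      (LinearMap.rTensor (V × U) H ((iU x ⊗ₜ iV y) ⊗ₜ iV z))) = oneTensor (V × U) H
      (LinearMap.rTensor (V × U) H (oneTensor (V × U) H ((iU x ⊗ₜ iV y) ⊗ₜ iV z))) := by
    intro x y z
    have := L ((x ⊗ₜ y) ⊗ₜ z)
    simp only [← TensorProduct.map_tmul, rTensor_map_map vv, oneTensor_map_map vv, map_add,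
      map_smul, rTensor_map_map vu, rTensor_map_map uv,
      oneTensor_map_map uv, zero_smul, add_zero, this, rTensor_symm_rTensor,
      oneTensor_oneTensor R R, hR.comp_self, oneTensor_add_smul_id]
    module
  have uuv : ∀ x y z, LinearMap.rTensor (V × U) H (oneTensor (V × U) H
      (LinearMap.rTensor (V × U) H ((iU x ⊗ₜ iU y) ⊗ₜ iV z))) = oneTensor (V × U) H
      (LinearMap.rTensor (V × U) H (oneTensor (V × U) H ((iU x ⊗ₜ iU y) ⊗ₜ iV z))) := by
    intro x y z
    have := L' ((x ⊗ₜ y) ⊗ₜ z)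
    simp only [← TensorProduct.map_tmul, rTensor_map_map uu, oneTensor_map_map uu, map_add,
      map_smul, oneTensor_map_map vu, rTensor_map_map uv,
      oneTensor_map_map uv, zero_smul, add_zero, this, oneTensor_symm_oneTensor,
      ← LinearMap.rTensor_comp_apply, hR'.comp_self, LinearMap.rTensor_add,
      LinearMap.rTensor_smul, LinearMap.add_apply, LinearMap.smul_apply, LinearMap.rTensor_id_apply]
    module
  refine TensorProduct.ext_threefold fun x y z => ?_
  have hx : x = iV x.1 + iU x.2 := by simp
  have hy : y = iV y.1 + iU y.2 := by simp
  have hz : z = iV z.1 + iU z.2 := by simp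
  rw [hx, hy, hz]
  simp only [TensorProduct.add_tmul, TensorProduct.tmul_add, map_add, LinearMap.comp_apply,
    vvv, vvu, vuv, vuu, uvv, uvu, uuv, uuu]

variable {I J : Type} [Fintype I] [Fintype J] [DecidableEq I] [DecidableEq J]
  (b : Basis I k V) (c : Basis J k U)

variable (q) in
/-- The coefficients of the R-matrix of a Hecke sum. -/
def sumCoeff (r : I → I → I → I → k) (r' : J → J → J → J → k) (z : J → I → I → J → k)
    (w : I → J → J → I → k) : I ⊕ J → I ⊕ J → I ⊕ J → I ⊕ J → k
  | .inl i, .inl j, .inl a, .inl b => r i j a b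
  | .inl i, .inr j, .inr a, .inl b => w i j a b
  | .inr i, .inl j, .inl a, .inr b => z i j a b
  | .inr i, .inl j, .inr a, .inl b =>
      (q - q⁻¹) * ((if i = a then 1 else 0) * (if j = b then 1 else 0))
  | .inr i, .inr j, .inr a, .inr b => r' i j a b
  | _, _, _, _ => 0

theorem coeff_heckeSum :
    coeff (b.prod c) (b.prod c) (b.prod c) (b.prod c) (heckeSum q R R' Q) =
      sumCoeff q (coeff b b b b R) (coeff c c c c R') (coeff c b b c Q.toLinearMap)
        (coeff b c c b Q.symm.toLinearMap) := by
  have hv : ∀ i, (b.prod c) (.inl i) = iV (b i) := fun i => by ext <;> simp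
  have hu : ∀ i, (b.prod c) (.inr i) = iU (c i) := fun i => by ext <;> simp
  refine coeff_eq_of_apply_eq _ _ _ _ _ _ ?_
  rintro (i | i) (j | j)
  · rw [hv, hv, ← TensorProduct.map_tmul, heckeSum_inl_inl, apply_eq_sum_coeff b b b b]
    simp [Fintype.sum_sum_type, sumCoeff]
  · rw [hv, hu, ← TensorProduct.map_tmul, heckeSum_inl_inr, ← LinearEquiv.coe_toLinearMap,
      apply_eq_sum_coeff b c c b]
    simp [Fintype.sum_sum_type, sumCoeff]
  · rw [hv, hu, ← TensorProduct.map_tmul, heckeSum_inr_inl, ← LinearEquiv.coe_toLinearMap,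
      apply_eq_sum_coeff c b b c]
    simp [Fintype.sum_sum_type, sumCoeff]
  · rw [hu, hu, ← TensorProduct.map_tmul, heckeSum_inr_inr, apply_eq_sum_coeff c c c c]
    simp [Fintype.sum_sum_type, sumCoeff]

end HeckeSum

theorem sum_coeff_mul_coeff {k : Type*} [Field k] {A B C D E F iA iB iC iD iE iF : Type*}
    [AddCommGroup A] [Module k A] [AddCommGroup B] [Module k B] [AddCommGroup C] [Module k C]
    [AddCommGroup D] [Module k D] [AddCommGroup E] [Module k E] [AddCommGroup F] [Module k F]
    [Fintype iA] [Fintype iB] [Fintype iC] [Fintype iD] [Fintype iE] [Fintype iF]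
    (a : Basis iA k A) (b : Basis iB k B) (c : Basis iC k C) (d : Basis iD k D)
    (e : Basis iE k E) (f : Basis iF k F) (T : A ⊗[k] B →ₗ[k] C ⊗[k] D)
    (S : C ⊗[k] D →ₗ[k] E ⊗[k] F) (i : iA) (j : iB) (p : iE) (r : iF) :
    ∑ x, ∑ y, coeff a b c d T i j x y * coeff c d e f S x y p r =
      coeff a b e f (S ∘ₗ T) i j p r := by
  rw [coeff, LinearMap.comp_apply, apply_eq_sum_coeff a b c d]
  simp [coeff]

theorem coeff_id {k : Type*} [Field k] {A B iA iB : Type*} [DecidableEq iA] [DecidableEq iB]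
    [AddCommGroup A] [Module k A] [AddCommGroup B] [Module k B] [Fintype iA] [Fintype iB]
    (a : Basis iA k A) (b : Basis iB k B) (i : iA) (j : iB) (p : iA) (r : iB) :
    coeff a b a b LinearMap.id i j p r =
      (if i = p then 1 else 0) * (if j = r then 1 else 0) := by
  simp only [coeff, LinearMap.id_apply, Basis.tensorProduct_repr_tmul_apply, Basis.repr_self,
    Finsupp.single_apply, smul_eq_mul, mul_comm]

/-! ### Relations of the Koszul complex of a Hecke sum, split into blocks. -/

section SumRelations

variable {k : Type u} [Field k] {I J : Type} [Fintype I] [DecidableEq I] [Fintype J]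
  [DecidableEq J] {q : k} {r : I → I → I → I → k} {r' : J → J → J → J → k}
  {z : J → I → I → J → k} {w : I → J → J → I → k} {E : Type*} [Ring E] [Algebra k E]

/-- On U ⊗ V the relation reads Q + (q - q⁻¹) = -q⁻¹, which is uv = -q⁻¹ Q(u ⊗ v) multiplied out.
The relation on V ⊗ U follows from it because w inverts z. -/
theorem satisfiesQuad_sum_ext (hq : q ≠ 0) (hw : ∀ i j p s, ∑ a, ∑ b, w i j a b * z a b p s =
      (if i = p then 1 else 0) * (if j = s then 1 else 0)) {x : I ⊕ J → E} :
    SatisfiesQuad (addId (sumCoeff q r r' z w) q⁻¹) x ↔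
      SatisfiesQuad (addId r q⁻¹) (fun i => x (.inl i)) ∧
      SatisfiesQuad (addId r' q⁻¹) (fun i => x (.inr i)) ∧
      SatisfiesExchange (fun j i p s => -q⁻¹ * z j i p s) (fun i => x (.inl i))
        (fun i => x (.inr i)) := by
  simp only [satisfiesQuad_addId, Sum.forall, Fintype.sum_sum_type, sumCoeff, zero_smul,
    Finset.sum_const_zero, add_zero, zero_add]
  have h₁ : ∀ i j, (∑ a, ∑ b, z j i a b • (x (.inl a) * x (.inr b)) +
      ∑ a, ∑ b, ((q - q⁻¹) * ((if j = a then 1 else 0) * (if i = b then 1 else 0))) •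
        (x (.inr a) * x (.inl b)) = -q⁻¹ • (x (.inr j) * x (.inl i))) ↔
      x (.inr j) * x (.inl i) = ∑ p, ∑ s, (-q⁻¹ * z j i p s) • (x (.inl p) * x (.inr s)) := by
    intro i j
    have e : ∑ a, ∑ b, ((q - q⁻¹) * ((if j = a then 1 else 0) * (if i = b then 1 else 0))) •
        (x (.inr a) * x (.inl b)) = (q - q⁻¹) • (x (.inr j) * x (.inl i)) := by
      simp [ite_smul]
    rw [e]
    simp only [mul_smul, ← Finset.smul_sum]
    rw [eq_comm (a := x (.inr j) * _), ← eq_sub_iff_add_eq, ← sub_smul, neg_smul,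
      neg_eq_iff_eq_neg, inv_smul_eq_iff₀ hq, smul_neg, ← neg_smul]
    ring_nf
  constructor
  · intro h
    exact ⟨fun i j => (h.1 i).1 j, fun i j => (h.2 i).2 j, fun j i => (h₁ i j).1 ((h.2 j).1 i)⟩
  · rintro ⟨h₂, h₃, h₄⟩
    refine ⟨fun i => ⟨h₂ i, fun j => ?_⟩, fun j => ⟨fun i => (h₁ i j).2 (h₄ j i), h₃ j⟩⟩
    simp only [h₄ _ _, Finset.smul_sum, smul_smul]
    rw [sum_comm_two_two]
    simp only [← Finset.sum_smul, mul_left_comm _ (-q⁻¹), ← Finset.mul_sum, hw]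
    simp [ite_smul]

/-- After transposition the Hecke term sits in the block V* ⊗ U*, while the block U* ⊗ V* is the
pure exchange rule and implies the other. -/
theorem satisfiesQuad_sum_sym (hq : q ≠ 0) (hz : ∀ j i s p, ∑ a, ∑ b, z j i a b * w a b s p =
      (if j = s then 1 else 0) * (if i = p then 1 else 0)) {y : I ⊕ J → E} :
    SatisfiesQuad (addId (flipCoeff (sumCoeff q r r' z w)) (-q)) y ↔
      SatisfiesQuad (addId (flipCoeff r) (-q)) (fun i => y (.inl i)) ∧
      SatisfiesQuad (addId (flipCoeff r') (-q)) (fun i => y (.inr i)) ∧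
      SatisfiesExchange (fun j i p s => q⁻¹ * z s p i j) (fun i => y (.inl i))
        (fun i => y (.inr i)) := by
  simp only [satisfiesQuad_addId, Sum.forall, Fintype.sum_sum_type, sumCoeff, zero_smul,
    Finset.sum_const_zero, add_zero, zero_add, flipCoeff, neg_neg]
  have h₁ : ∀ i j, (∑ a, ∑ b, z b a i j • (y (.inl a) * y (.inr b)) =
      q • (y (.inr j) * y (.inl i))) ↔
      y (.inr j) * y (.inl i) = ∑ p, ∑ s, (q⁻¹ * z s p i j) • (y (.inl p) * y (.inr s)) := by
    intro i j
    simp only [mul_smul, ← Finset.smul_sum]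
    rw [eq_inv_smul_iff₀ hq, eq_comm]
  constructor
  · intro h
    exact ⟨fun i j => (h.1 i).1 j, fun i j => (h.2 i).2 j, fun j i => (h₁ i j).1 ((h.2 j).1 i)⟩
  · rintro ⟨h₂, h₃, h₄⟩
    refine ⟨fun i => ⟨h₂ i, fun j => ?_⟩, fun j => ⟨fun i => (h₁ i j).2 (h₄ j i), h₃ j⟩⟩
    have e : ∑ a, ∑ b, ((q - q⁻¹) * ((if b = j then 1 else 0) * (if a = i then 1 else 0))) •
        (y (.inl a) * y (.inr b)) = (q - q⁻¹) • (y (.inl i) * y (.inr j)) := by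
      simp [ite_smul]
    -- The exchange rule makes the w-term equal to q⁻¹, and q⁻¹ + (q - q⁻¹) = q is the required
    -- eigenvalue.
    have e' : ∑ a, ∑ b, w b a j i • (y (.inr a) * y (.inl b)) =
        q⁻¹ • (y (.inl i) * y (.inr j)) := by
      simp only [h₄ _ _, Finset.smul_sum, smul_smul]
      rw [sum_comm_two_two]
      have e₁ : ∀ p s, ∑ a, ∑ b, w b a j i * (q⁻¹ * z s p b a) =
          q⁻¹ * ((if s = j then 1 else 0) * (if p = i then 1 else 0)) := by
        intro p s
        rw [← hz, Finset.sum_comm, Finset.mul_sum]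
        simp only [Finset.mul_sum]
        exact Fintype.sum_congr _ _ fun _ => Fintype.sum_congr _ _ fun _ => by ring
      simp only [← Finset.sum_smul, e₁]
      simp [ite_smul]
    rw [e, e', ← add_smul]
    congr 1; ring

/-- The consequences of the Koszul relations of a Hecke sum. -/
structure SumRelations (q : k) (r' : J → J → J → J → k)
    (z : J → I → I → J → k) (x y : I ⊕ J → E) : Prop where
  second : KoszulRep q r' (fun j => x (.inr j)) (fun j => y (.inr j))
  exchange : SatisfiesExchange (fun i j p s => q⁻¹ * z p i s j) (fun j => y (.inr j))
    (fun i => x (.inl i))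

/-- The Hecke term does not enter the mixed relations of U with U* or of V with U*, so these keep
the form given by R' and Q. Only the pair V, V* is deformed. -/
theorem KoszulRep.sumRelations (hq : q ≠ 0) {x y : I ⊕ J → E}
    (h : KoszulRep q (sumCoeff q r r' z w) x y) : SumRelations q r' z x y := by
  obtain ⟨h₁, h₂, h₃⟩ := h
  simp only [Sum.forall, Fintype.sum_sum_type, sumCoeff, zero_smul,
    Finset.sum_const_zero, add_zero, zero_add] at h₁ h₂ h₃
  refine ⟨⟨fun i j => (h₁.2 i).2 j, fun i j => (h₂.2 i).2 j, fun i j => (h₃.2 i).2 j⟩,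
    fun i j => ?_⟩
  simp only [mul_smul, ← Finset.smul_sum]
  rw [eq_inv_smul_iff₀ hq, eq_comm]
  exact (h₂.1 i).2 j

end SumRelations

/-! ### Algebras with an invertible exchange rule. -/

section ExchangeAlgebra

variable {k : Type u} [Field k] {I J : Type} [Fintype I] [DecidableEq I] [Fintype J]
  [DecidableEq J] {D : I → I → I → I → k} {C : J → J → J → J → k} {θ : J → I → I → J → k}
  {E : Type*} [Ring E] [Algebra k E]

theorem QuadAlg.hom_ext {f g : QuadAlg D →ₐ[k] E}
    (h : ∀ i, f (QuadAlg.x D i) = g (QuadAlg.x D i)) : f = g := by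
  refine AlgHom.ext_of_adjoin_eq_top (QuadAlg.adjoin_x D) ?_
  rintro _ ⟨i, rfl⟩
  exact h i

theorem mulOf_comp {A B P S : Type*} [Ring A] [Algebra k A] [Ring B] [Algebra k B] [Ring P]
    [Algebra k P] [Ring S] [Algebra k S] (f : A →ₐ[k] P) (g : B →ₐ[k] P) (F : P →ₐ[k] S)
    (t : A ⊗[k] B) : F (mulOf f g t) = mulOf (F.comp f) (F.comp g) t := by
  induction t with
  | zero => simp
  | tmul a b => simp
  | add s t hs ht => simp [hs, ht]

/-- The relation matrix of the algebra generated by `x_i` and `y_j` with quadratic relations `D`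
and `C` and the exchange rule `θ`. -/
def exchangeCoeff (D : I → I → I → I → k) (C : J → J → J → J → k) (θ : J → I → I → J → k) :
    I ⊕ J → I ⊕ J → I ⊕ J → I ⊕ J → k
  | .inl i, .inl j, .inl a, .inl b => D i j a b
  | .inr i, .inr j, .inr a, .inr b => C i j a b
  | .inr i, .inl j, .inr a, .inl b => (if i = a then 1 else 0) * (if j = b then 1 else 0)
  | .inr i, .inl j, .inl a, .inr b => -θ i j a b
  | _, _, _, _ => 0

theorem satisfiesQuad_exchangeCoeff {x : I ⊕ J → E} :
    SatisfiesQuad (exchangeCoeff D C θ) x ↔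
      SatisfiesQuad D (fun i => x (.inl i)) ∧ SatisfiesQuad C (fun i => x (.inr i)) ∧
      SatisfiesExchange θ (fun i => x (.inl i)) (fun i => x (.inr i)) := by
  have h₁ : ∀ i j, (∑ a, ∑ b, -θ i j a b • (x (.inl a) * x (.inr b)) +
      ∑ a, ∑ b, ((if i = a then 1 else 0) * (if j = b then 1 else 0) : k) •
        (x (.inr a) * x (.inl b)) = 0) ↔
      x (.inr i) * x (.inl j) = ∑ p, ∑ s, θ i j p s • (x (.inl p) * x (.inr s)) := by
    intro i j
    have e : ∑ a, ∑ b, ((if i = a then 1 else 0) * (if j = b then 1 else 0) : k) •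
        (x (.inr a) * x (.inl b)) = x (.inr i) * x (.inl j) := by
      simp [ite_smul]
    rw [e]
    simp only [neg_smul, Finset.sum_neg_distrib]
    rw [neg_add_eq_zero, eq_comm]
  simp only [SatisfiesQuad, Sum.forall, Fintype.sum_sum_type, exchangeCoeff, zero_smul,
    Finset.sum_const_zero, add_zero, zero_add, implies_true, true_and, h₁, forall_and,
    SatisfiesExchange]
  tauto

/-- The exchange rule `θ'` is inverse to `θ`. -/
def IsInverseExchange (θ : J → I → I → J → k) (θ' : I → J → J → I → k) : Prop :=
  ∀ i j p s, ∑ a, ∑ b, θ' i j a b * θ a b p s =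
    (if i = p then 1 else 0) * (if j = s then 1 else 0)

theorem SatisfiesExchange.inverse {x : I → E} {y : J → E} {θ' : I → J → J → I → k}
    (h : SatisfiesExchange θ x y) (hθ : IsInverseExchange θ θ') :
    SatisfiesExchange θ' y x := by
  intro i j
  simp only [h _ _, Finset.smul_sum, smul_smul]
  rw [sum_comm_two_two]
  simp only [← Finset.sum_smul, hθ _ _ _ _]
  simp [ite_smul]

variable (D C θ) in
theorem satisfiesQuad_exchange_x : SatisfiesQuad D (fun i => QuadAlg.x (exchangeCoeff D C θ) (.inl i)) ∧
    SatisfiesQuad C (fun j => QuadAlg.x (exchangeCoeff D C θ) (.inr j)) ∧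
    SatisfiesExchange θ (fun i => QuadAlg.x (exchangeCoeff D C θ) (.inl i))
      (fun j => QuadAlg.x (exchangeCoeff D C θ) (.inr j)) :=
  satisfiesQuad_exchangeCoeff.1 (QuadAlg.satisfiesQuad _)

theorem adjoin_inl_inr (C : I ⊕ J → I ⊕ J → I ⊕ J → I ⊕ J → k) :
    Algebra.adjoin k (Set.range (fun i => QuadAlg.x C (.inl i)) ∪
      Set.range (fun j => QuadAlg.x C (.inr j))) = ⊤ := by
  rw [← QuadAlg.adjoin_x C]
  congr 1
  ext t
  simp

/-- If two quadratic algebras have compatible exchange rules `θ` and `θ'` that are inverse to each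
other, then products of their elements can be reordered by a linear bijection. -/
theorem exists_reorder {θ' : I → J → J → I → k} (h : IsTwist D C θ) (h' : IsTwist C D θ')
    (hθ : IsInverseExchange θ θ') (hθ' : IsInverseExchange θ' θ) :
    ∃ σ : QuadAlg C ⊗[k] QuadAlg D ≃ₗ[k] QuadAlg D ⊗[k] QuadAlg C,
      ∀ {E : Type v} [Ring E] [Algebra k E] {x : I → E} {y : J → E} (hx : SatisfiesQuad D x)
        (hy : SatisfiesQuad C y), SatisfiesExchange θ x y → ∀ t,
        mulOf (QuadAlg.lift hx) (QuadAlg.lift hy) (σ t) =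
          mulOf (QuadAlg.lift hy) (QuadAlg.lift hx) t := by
  obtain ⟨hD, hC, hDC⟩ := satisfiesQuad_exchange_x D C θ
  have b₁ : Function.Bijective (mulOf (QuadAlg.lift hD) (QuadAlg.lift hC)) := by
    refine h.bijective_mulOf hD hC hDC (adjoin_inl_inr _) ?_
    intro E _ _ x' y' hx hy hxy
    have : SatisfiesQuad (exchangeCoeff D C θ) (Sum.elim x' y') :=
      satisfiesQuad_exchangeCoeff.2 ⟨hx, hy, hxy⟩
    exact ⟨QuadAlg.lift this, by simp, by simp⟩
  have b₂ : Function.Bijective (mulOf (QuadAlg.lift hC) (QuadAlg.lift hD)) := by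
    refine h'.bijective_mulOf hC hD (hDC.inverse hθ) (by rw [Set.union_comm, adjoin_inl_inr]) ?_
    intro E _ _ x' y' hx hy hxy
    have : SatisfiesQuad (exchangeCoeff D C θ) (Sum.elim y' x') :=
      satisfiesQuad_exchangeCoeff.2 ⟨hy, hx, hxy.inverse hθ'⟩
    exact ⟨QuadAlg.lift this, by simp, by simp⟩
  -- Both orderings are normal forms of the universal exchange algebra; comparing them gives σ, and
  -- every other algebra with the rule is reached by a homomorphism.
  refine ⟨LinearEquiv.ofBijective _ b₂ ≪≫ₗ (LinearEquiv.ofBijective _ b₁).symm, ?_⟩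
  intro E _ _ x y hx hy hxy t
  have hF : SatisfiesQuad (exchangeCoeff D C θ) (Sum.elim x y) :=
    satisfiesQuad_exchangeCoeff.2 ⟨hx, hy, hxy⟩
  have e₁ : (QuadAlg.lift hF).comp (QuadAlg.lift hD) = QuadAlg.lift hx :=
    QuadAlg.hom_ext fun i => by simp
  have e₂ : (QuadAlg.lift hF).comp (QuadAlg.lift hC) = QuadAlg.lift hy :=
    QuadAlg.hom_ext fun i => by simp
  rw [← e₁, ← e₂, ← mulOf_comp, ← mulOf_comp]
  congr 1
  exact LinearEquiv.apply_symm_apply (LinearEquiv.ofBijective _ b₁) _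

end ExchangeAlgebra

/-! ### Factorization of Λ(X) and S(X*), and rearrangement of four factors. -/

section SumAlgebras

variable {k : Type u} [Field k] {I J : Type} [Fintype I] [DecidableEq I] [Fintype J]
  [DecidableEq J] {q : k} {r : I → I → I → I → k} {r' : J → J → J → J → k}
  {z : J → I → I → J → k} {w : I → J → J → I → k} {E : Type*} [Ring E] [Algebra k E]

/-- By `satisfiesQuad_sum_ext`, Λ(X) has the universal property of the twisted tensor product of
Λ(V) and Λ(U) with exchange rule -q⁻¹ Q. -/
theorem bijective_mulOf_ext (hq : q ≠ 0) (hw : IsInverseExchange z w) (h : IsTwist r r' z)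
    {x : I ⊕ J → E} (hx : SatisfiesQuad (addId (sumCoeff q r r' z w) q⁻¹) x) :
    ∃ e : QuadAlg (addId r q⁻¹) ⊗[k] QuadAlg (addId r' q⁻¹) ≃ₗ[k]
        QuadAlg (addId (sumCoeff q r r' z w) q⁻¹), ∀ t, QuadAlg.lift hx (e t) =
      mulOf (QuadAlg.lift ((satisfiesQuad_sum_ext hq hw).1 hx).1)
        (QuadAlg.lift ((satisfiesQuad_sum_ext hq hw).1 hx).2.1) t := by
  obtain ⟨h₁, h₂, h₃⟩ := (satisfiesQuad_sum_ext hq hw).1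
    (QuadAlg.satisfiesQuad (addId (sumCoeff q r r' z w) q⁻¹))
  have b : Function.Bijective (mulOf (QuadAlg.lift h₁) (QuadAlg.lift h₂)) := by
    refine (h.addId q⁻¹ q⁻¹ (-q⁻¹)).bijective_mulOf h₁ h₂ h₃ (adjoin_inl_inr _) ?_
    intro E _ _ x' y' hx hy hxy
    have : SatisfiesQuad (addId (sumCoeff q r r' z w) q⁻¹) (Sum.elim x' y') :=
      (satisfiesQuad_sum_ext hq hw).2 ⟨hx, hy, hxy⟩
    exact ⟨QuadAlg.lift this, by simp, by simp⟩
  refine ⟨LinearEquiv.ofBijective _ b, fun t => ?_⟩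
  rw [LinearEquiv.ofBijective_apply, mulOf_comp]
  congr 2 <;> exact QuadAlg.hom_ext fun i => by simp

/-- The dual case uses the transposed exchange rule, scaled by q⁻¹. -/
theorem bijective_mulOf_sym (hq : q ≠ 0) (hz : IsInverseExchange w z) (h : IsTwist r r' z)
    {y : I ⊕ J → E} (hy : SatisfiesQuad (addId (flipCoeff (sumCoeff q r r' z w)) (-q)) y) :
    ∃ e : QuadAlg (addId (flipCoeff r) (-q)) ⊗[k] QuadAlg (addId (flipCoeff r') (-q)) ≃ₗ[k]
        QuadAlg (addId (flipCoeff (sumCoeff q r r' z w)) (-q)), ∀ t, QuadAlg.lift hy (e t) =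
      mulOf (QuadAlg.lift ((satisfiesQuad_sum_sym hq hz).1 hy).1)
        (QuadAlg.lift ((satisfiesQuad_sum_sym hq hz).1 hy).2.1) t := by
  obtain ⟨h₁, h₂, h₃⟩ := (satisfiesQuad_sum_sym hq hz).1
    (QuadAlg.satisfiesQuad (addId (flipCoeff (sumCoeff q r r' z w)) (-q)))
  have b : Function.Bijective (mulOf (QuadAlg.lift h₁) (QuadAlg.lift h₂)) := by
    refine (h.transpose.addId (-q) (-q) q⁻¹).bijective_mulOf h₁ h₂ h₃ (adjoin_inl_inr _) ?_
    intro E _ _ x' y' hx hy hxy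
    have : SatisfiesQuad (addId (flipCoeff (sumCoeff q r r' z w)) (-q)) (Sum.elim x' y') :=
      (satisfiesQuad_sum_sym hq hz).2 ⟨hx, hy, hxy⟩
    exact ⟨QuadAlg.lift this, by simp, by simp⟩
  refine ⟨LinearEquiv.ofBijective _ b, fun t => ?_⟩
  rw [LinearEquiv.ofBijective_apply, mulOf_comp]
  congr 2 <;> exact QuadAlg.hom_ext fun i => by simp

/-- If the products `s s' l l'` give a linear bijection, and `l s'` can be reordered, then so do
the products `s l s' l'`. -/
theorem exists_equiv_mulOf_mulOf {A B A' B' : Type*} [Ring A] [Algebra k A] [Ring B] [Algebra k B]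
    [Ring A'] [Algebra k A'] [Ring B'] [Algebra k B']
    (f : A →ₐ[k] E) (g : B →ₐ[k] E) (f' : A' →ₐ[k] E) (g' : B' →ₐ[k] E)
    (e : (A ⊗[k] A') ⊗[k] (B ⊗[k] B') ≃ₗ[k] E)
    (he : ∀ s t, e (s ⊗ₜ t) = mulOf f f' s * mulOf g g' t)
    (σ : B ⊗[k] A' ≃ₗ[k] A' ⊗[k] B) (hσ : ∀ t, mulOf f' g (σ t) = mulOf g f' t) :
    ∃ e' : (A ⊗[k] B) ⊗[k] (A' ⊗[k] B') ≃ₗ[k] E,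
      ∀ s t, e' (s ⊗ₜ t) = mulOf f g s * mulOf f' g' t := by
  let ρ₁ : (A ⊗[k] B) ⊗[k] (A' ⊗[k] B') ≃ₗ[k] A ⊗[k] ((B ⊗[k] A') ⊗[k] B') :=
    TensorProduct.assoc k A B (A' ⊗[k] B') ≪≫ₗ
      LinearEquiv.lTensor A (TensorProduct.assoc k B A' B').symm
  let ρ₂ : A ⊗[k] ((A' ⊗[k] B) ⊗[k] B') ≃ₗ[k] (A ⊗[k] A') ⊗[k] (B ⊗[k] B') :=
    LinearEquiv.lTensor A (TensorProduct.assoc k A' B B') ≪≫ₗ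
      (TensorProduct.assoc k A A' (B ⊗[k] B')).symm
  let ρ := LinearEquiv.lTensor A (LinearEquiv.rTensor B' σ)
  have h₁ : ∀ a t b, e (ρ₂ (a ⊗ₜ (t ⊗ₜ b))) = f a * mulOf f' g t * g' b := by
    intro a t b
    induction t with
    | zero => simp
    | tmul s l => simp [ρ₂, he, mul_assoc]
    | add s t hs ht =>
      simp only [TensorProduct.add_tmul, TensorProduct.tmul_add, map_add, hs, ht, mul_add, add_mul]
  refine ⟨ρ₁ ≪≫ₗ ρ ≪≫ₗ ρ₂ ≪≫ₗ e, fun s t => ?_⟩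
  induction s with
  | zero => simp
  | add s s' hs hs' => simp only [TensorProduct.add_tmul, map_add, hs, hs', add_mul]
  | tmul a b =>
    induction t with
    | zero => simp
    | add s s' hs hs' => simp only [TensorProduct.tmul_add, map_add, hs, hs', mul_add]
    | tmul a' b' =>
      have : (ρ₁ ≪≫ₗ ρ ≪≫ₗ ρ₂ ≪≫ₗ e) ((a ⊗ₜ b) ⊗ₜ (a' ⊗ₜ b')) =
          e (ρ₂ (a ⊗ₜ (σ (b ⊗ₜ a') ⊗ₜ b'))) := by simp [ρ₁, ρ]
      rw [this, h₁, hσ]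
      simp [mul_assoc]

end SumAlgebras

/-! ### Compatibility of the inverse exchange rule. -/

section InverseTwist

variable {k : Type u} [Field k] {A B : Type*} [AddCommGroup A] [Module k A] [AddCommGroup B]
  [Module k B] {D : A ⊗[k] A →ₗ[k] A ⊗[k] A} {C : B ⊗[k] B →ₗ[k] B ⊗[k] B}

theorem twist_left_symm (T : B ⊗[k] A ≃ₗ[k] A ⊗[k] B)
    (h : oneTensor A T.toLinearMap ∘ₗ LinearMap.rTensor A T.toLinearMap ∘ₗ oneTensor B D =
      LinearMap.rTensor B D ∘ₗ oneTensor A T.toLinearMap ∘ₗ LinearMap.rTensor A T.toLinearMap) :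
    LinearMap.rTensor A T.symm.toLinearMap ∘ₗ oneTensor A T.symm.toLinearMap ∘ₗ
        LinearMap.rTensor B D =
      oneTensor B D ∘ₗ LinearMap.rTensor A T.symm.toLinearMap ∘ₗ
        oneTensor A T.symm.toLinearMap := by
  refine LinearMap.ext fun t => ?_
  have := LinearMap.congr_fun h (LinearMap.rTensor A T.symm.toLinearMap
    (oneTensor A T.symm.toLinearMap t))
  simp only [LinearMap.comp_apply, rTensor_rTensor_symm, oneTensor_oneTensor_symm] at this
  simp only [LinearMap.comp_apply, ← this, oneTensor_symm_oneTensor, rTensor_symm_rTensor]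

theorem twist_right_symm (T : B ⊗[k] A ≃ₗ[k] A ⊗[k] B)
    (h : LinearMap.rTensor B T.toLinearMap ∘ₗ oneTensor B T.toLinearMap ∘ₗ LinearMap.rTensor A C =
      oneTensor A C ∘ₗ LinearMap.rTensor B T.toLinearMap ∘ₗ oneTensor B T.toLinearMap) :
    oneTensor B T.symm.toLinearMap ∘ₗ LinearMap.rTensor B T.symm.toLinearMap ∘ₗ oneTensor A C =
      LinearMap.rTensor A C ∘ₗ oneTensor B T.symm.toLinearMap ∘ₗ
        LinearMap.rTensor B T.symm.toLinearMap := by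
  refine LinearMap.ext fun t => ?_
  have := LinearMap.congr_fun h (oneTensor B T.symm.toLinearMap
    (LinearMap.rTensor B T.symm.toLinearMap t))
  simp only [LinearMap.comp_apply, rTensor_rTensor_symm, oneTensor_oneTensor_symm] at this
  simp only [LinearMap.comp_apply, ← this, oneTensor_symm_oneTensor, rTensor_symm_rTensor]

variable {I J : Type} [Fintype I] [DecidableEq I] [Fintype J] [DecidableEq J]
  (a : Basis I k A) (b : Basis J k B)

theorem isTwist_coeff_symm (T : B ⊗[k] A ≃ₗ[k] A ⊗[k] B)
    (h : IsTwist (coeff a a a a D) (coeff b b b b C) (coeff b a a b T.toLinearMap)) :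
    IsTwist (coeff b b b b C) (coeff a a a a D) (coeff a b b a T.symm.toLinearMap) := by
  rw [isTwist_coeff_iff] at h ⊢
  exact ⟨twist_right_symm T h.2, twist_left_symm T h.1⟩

theorem isInverseExchange_coeff {A B : Type*} [AddCommGroup A] [Module k A] [AddCommGroup B]
    [Module k B] (a : Basis I k A) (b : Basis J k B) (T : B ⊗[k] A ≃ₗ[k] A ⊗[k] B) :
    IsInverseExchange (coeff b a a b T.toLinearMap) (coeff a b b a T.symm.toLinearMap) := by
  intro i j p s
  rw [sum_coeff_mul_coeff]
  have : T.toLinearMap ∘ₗ T.symm.toLinearMap = LinearMap.id := by ext; simp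
  rw [this, coeff_id]

theorem IsInverseExchange.smul {θ : J → I → I → J → k} {θ' : I → J → J → I → k}
    (h : IsInverseExchange θ θ') {s t : k} (hst : t * s = 1) :
    IsInverseExchange (fun j i p r => s * θ j i p r) (fun i j p r => t * θ' i j p r) := by
  intro i j p r
  have e : ∀ a b, t * θ' i j a b * (s * θ a b p r) = θ' i j a b * θ a b p r := fun a b => by
    rw [mul_mul_mul_comm, hst, one_mul]
  simp only [e, h i j p r]

end InverseTwist

/-! ### The multiplication isomorphism K(V) ⊗ K(U) → K(X). -/

section MulEquiv

variable {k : Type u} [Field k]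
  {V : Type*} [AddCommGroup V] [Module k V] [FiniteDimensional k V]
  {U : Type*} [AddCommGroup U] [Module k U] [FiniteDimensional k U]
  {q : k} {R : V ⊗[k] V →ₗ[k] V ⊗[k] V} {R' : U ⊗[k] U →ₗ[k] U ⊗[k] U}
  {Q : U ⊗[k] V ≃ₗ[k] V ⊗[k] U}
  {I J : Type} [Fintype I] [Fintype J] [DecidableEq I] [DecidableEq J]
  (b : Basis I k V) (c : Basis J k U)

theorem coeff_sharp_sharp : coeff b.dualBasis b.dualBasis b.dualBasis b.dualBasis
    (sharp (sharp R)) = flipCoeff (coeff b b b b R) := by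
  rw [coeff_sharp, coeff_sharp]; rfl

/-- The types of the quadratic algebras depend on the coefficient array. Stating the normal ordering
theorem for any r equal to it allows the block form of the Hecke sum to be inserted. -/
theorem bijective_mulOf_lift (hq : q ≠ 0)
    (h : LinearMap.rTensor V R ∘ₗ oneTensor V R ∘ₗ LinearMap.rTensor V R =
      oneTensor V R ∘ₗ LinearMap.rTensor V R ∘ₗ oneTensor V R) {r : I → I → I → I → k}
    (hr : coeff b b b b R = r)
    (hy : SatisfiesQuad (addId (flipCoeff r) (-q)) (fun i => dualGen q R (b.coord i)))
    (hx : SatisfiesQuad (addId r q⁻¹) (fun i => gen q R (b i))) :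
    Function.Bijective (mulOf (QuadAlg.lift hy) (QuadAlg.lift hx)) := by
  subst hr
  exact bijective_mulOf_symHom_extHom b hq h

theorem coe_prod_inl (i : I) : (b.prod c) (.inl i) = (b i, 0) := by ext <;> simp
theorem coe_prod_inr (j : J) : (b.prod c) (.inr j) = (0, c j) := by ext <;> simp
theorem coord_prod_inl (i : I) :
    (b.prod c).coord (.inl i) = (LinearMap.fst k V U).dualMap (b.coord i) := by
  ext <;> simp
theorem coord_prod_inr (j : J) :
    (b.prod c).coord (.inr j) = (LinearMap.snd k V U).dualMap (c.coord j) := by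
  ext <;> simp

variable (q R R' Q) in
/-- The map `V → K(V ⊕_Q U)`. -/
noncomputable def genFst : V →ₗ[k] Koszul q (heckeSum q R R' Q) :=
  gen q (heckeSum q R R' Q) ∘ₗ LinearMap.inl k V U

variable (q R R' Q) in
/-- The map `U → K(V ⊕_Q U)`. -/
noncomputable def genSnd : U →ₗ[k] Koszul q (heckeSum q R R' Q) :=
  gen q (heckeSum q R R' Q) ∘ₗ LinearMap.inr k V U

variable (q R R' Q) in
/-- The map `V* → K(V ⊕_Q U)`. -/
noncomputable def dualGenFst : Dual k V →ₗ[k] Koszul q (heckeSum q R R' Q) :=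
  dualGen q (heckeSum q R R' Q) ∘ₗ (LinearMap.fst k V U).dualMap

variable (q R R' Q) in
/-- The map `U* → K(V ⊕_Q U)`. -/
noncomputable def dualGenSnd : Dual k U →ₗ[k] Koszul q (heckeSum q R R' Q) :=
  dualGen q (heckeSum q R R' Q) ∘ₗ (LinearMap.snd k V U).dualMap

variable (q R R' Q) in
theorem koszulRep_heckeSum : KoszulRep q (sumCoeff q (coeff b b b b R) (coeff c c c c R')
    (coeff c b b c Q.toLinearMap) (coeff b c c b Q.symm.toLinearMap))
    (fun i => gen q (heckeSum q R R' Q) (b.prod c i))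
    (fun i => dualGen q (heckeSum q R R' Q) ((b.prod c).coord i)) := by
  rw [← coeff_heckeSum]
  exact koszulRep_gen (b.prod c)

variable (q R R' Q) in
theorem sumRelations_heckeSum (hq : q ≠ 0) : SumRelations q (coeff c c c c R') (coeff c b b c Q.toLinearMap)
    (fun i => gen q (heckeSum q R R' Q) (b.prod c i))
    (fun i => dualGen q (heckeSum q R R' Q) ((b.prod c).coord i)) :=
  (koszulRep_heckeSum q R R' Q b c).sumRelations hq

variable (q R R' Q) in
/-- `K(U)` maps to `K(V ⊕_Q U)`. -/
theorem exists_koszul_inr (hq : q ≠ 0) : ∃ F : Koszul q R' →ₐ[k] Koszul q (heckeSum q R R' Q),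
    (∀ u, F (gen q R' u) = genSnd q R R' Q u) ∧
      ∀ ξ, F (dualGen q R' ξ) = dualGenSnd q R R' Q ξ := by
  let b := finBasis k V
  let c := finBasis k U
  obtain ⟨F, h₁, h₂⟩ := exists_koszul_lift c (sumRelations_heckeSum q R R' Q b c hq).second
  refine ⟨F, fun u => ?_, fun ξ => ?_⟩
  · suffices F.toLinearMap ∘ₗ gen q R' = genSnd q R R' Q from LinearMap.congr_fun this u
    refine c.ext fun j => (h₁ j).trans ?_
    rw [coe_prod_inr]; rfl
  · suffices F.toLinearMap ∘ₗ dualGen q R' = dualGenSnd q R R' Q from LinearMap.congr_fun this ξ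
    refine c.dualBasis.ext fun j => ?_
    rw [c.coe_dualBasis]
    refine (h₂ j).trans ?_
    rw [coord_prod_inr]; rfl

variable (q R R' Q) in
/-- The algebra map `K(U) → K(V ⊕_Q U)`. -/
noncomputable def koszulInr (hq : q ≠ 0) : Koszul q R' →ₐ[k] Koszul q (heckeSum q R R' Q) :=
  (exists_koszul_inr q R R' Q hq).choose

@[simp]
theorem koszulInr_gen (hq : q ≠ 0) (u : U) :
    koszulInr q R R' Q hq (gen q R' u) = genSnd q R R' Q u :=
  (exists_koszul_inr q R R' Q hq).choose_spec.1 u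

@[simp]
theorem koszulInr_dualGen (hq : q ≠ 0) (ξ : Dual k U) :
    koszulInr q R R' Q hq (dualGen q R' ξ) = dualGenSnd q R R' Q ξ :=
  (exists_koszul_inr q R R' Q hq).choose_spec.2 ξ

/-- The mixed relation moves V to the right of U* by q⁻¹ Q♯. Invertibility of Q♯ gives the opposite
rule, and the inverse of a compatible exchange rule is compatible. -/
theorem exists_koszul_reorder (hq : q ≠ 0) (hQ : IsGluing R R' Q) :
    ∃ σ : QuadAlg (addId (coeff b b b b R) q⁻¹) ⊗[k]
        QuadAlg (addId (flipCoeff (coeff c c c c R')) (-q)) ≃ₗ[k]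
      QuadAlg (addId (flipCoeff (coeff c c c c R')) (-q)) ⊗[k]
        QuadAlg (addId (coeff b b b b R) q⁻¹),
      ∀ {E : Type v} [Ring E] [Algebra k E] {x : J → E} {y : I → E}
        (hx : SatisfiesQuad (addId (flipCoeff (coeff c c c c R')) (-q)) x)
        (hy : SatisfiesQuad (addId (coeff b b b b R) q⁻¹) y),
        SatisfiesExchange (fun i j p s => q⁻¹ * coeff c b b c Q.toLinearMap p i s j) x y → ∀ t,
        mulOf (QuadAlg.lift hx) (QuadAlg.lift hy) (σ t) =
          mulOf (QuadAlg.lift hy) (QuadAlg.lift hx) t := by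
  have h := ((isTwist_coeff_iff b c R R' Q.toLinearMap).2
    ⟨hQ.compat_left, hQ.compat_right⟩).sharp
  let T := LinearEquiv.ofBijective _ hQ.sharp_bijective
  have hT : coeff b c.dualBasis c.dualBasis b T.toLinearMap =
      fun i j p s => coeff c b b c Q.toLinearMap p i s j := by
    have : T.toLinearMap = sharp Q.toLinearMap := rfl
    rw [this, coeff_sharp]
  rw [← hT, ← coeff_sharp_sharp] at h
  have h' := isTwist_coeff_symm c.dualBasis b T h
  have i₁ := isInverseExchange_coeff c.dualBasis b T
  have i₂ := isInverseExchange_coeff b c.dualBasis T.symm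
  rw [coeff_sharp_sharp, hT] at h
  rw [coeff_sharp_sharp] at h'
  rw [hT] at i₁
  rw [LinearEquiv.symm_symm, hT] at i₂
  -- The rule carries the factor q⁻¹, so its inverse carries q; the relations are shifted by -q on
  -- U* and by q⁻¹ on V.
  exact exists_reorder (h.addId (-q) q⁻¹ q⁻¹) (h'.addId q⁻¹ (-q) q)
    (i₁.smul (mul_inv_cancel₀ hq)) (i₂.smul (inv_mul_cancel₀ hq))

/-- Combines the factorizations of K(X), S(X*) and Λ(X) with the interchange of S(U*) and Λ(V), and
then regroups the four factors by the normal ordering of K(V) and K(U). -/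
theorem exists_mulEquiv_aux (hR : IsHecke q R) (hR' : IsHecke q R') (hQ : IsGluing R R' Q) :
    ∃ (sV : QuadAlg (addId (flipCoeff (coeff b b b b R)) (-q)) →ₐ[k] Koszul q (heckeSum q R R' Q))
      (lV : QuadAlg (addId (coeff b b b b R) q⁻¹) →ₐ[k] Koszul q (heckeSum q R R' Q))
      (φ : Koszul q R ⊗[k] Koszul q R' ≃ₗ[k] Koszul q (heckeSum q R R' Q)),
      (∀ i, sV (QuadAlg.x _ i) = dualGenFst q R R' Q (b.coord i)) ∧
      (∀ i, lV (QuadAlg.x _ i) = genFst q R R' Q (b i)) ∧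
      ∀ s l y, φ ((symHom q R b hR.q_ne_zero s * extHom q R b hR.q_ne_zero l) ⊗ₜ y) =
        sV s * lV l * koszulInr q R R' Q hR.q_ne_zero y := by
  have hq := hR.q_ne_zero
  let c := finBasis k U
  have hz := isInverseExchange_coeff b c Q
  have hw := isInverseExchange_coeff c b Q.symm
  rw [LinearEquiv.symm_symm] at hw
  have ht := (isTwist_coeff_iff b c R R' Q.toLinearMap).2 ⟨hQ.compat_left, hQ.compat_right⟩
  obtain ⟨hy, hx, -⟩ := (koszulRep_iff hq).1 (koszulRep_heckeSum q R R' Q b c)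
  have hrel := sumRelations_heckeSum q R R' Q b c hq
  obtain ⟨eL, heL⟩ := bijective_mulOf_ext hq hz ht hx
  obtain ⟨eS, heS⟩ := bijective_mulOf_sym hq hw ht hy
  obtain ⟨hy₁, hy₂, -⟩ := (satisfiesQuad_sum_sym hq hw).1 hy
  obtain ⟨hx₁, hx₂, -⟩ := (satisfiesQuad_sum_ext hq hz).1 hx
  have hbij := bijective_mulOf_lift (b.prod c) hq (heckeSum_braid hR hR' hQ)
    (coeff_heckeSum b c) hy hx
  -- The order of factors here is V*, U*, V, U; the equivalence e' below has V*, V, U*, U.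
  let e := TensorProduct.congr eS eL ≪≫ₗ LinearEquiv.ofBijective _ hbij
  have he : ∀ s t, e (s ⊗ₜ t) = mulOf (QuadAlg.lift hy₁) (QuadAlg.lift hy₂) s *
      mulOf (QuadAlg.lift hx₁) (QuadAlg.lift hx₂) t := by
    intro s t
    simp only [e, LinearEquiv.trans_apply, TensorProduct.congr_tmul,
      LinearEquiv.ofBijective_apply, mulOf_tmul, heL, heS]
  obtain ⟨σ, hσ⟩ := exists_koszul_reorder b c hq hQ
  obtain ⟨e', he'⟩ := exists_equiv_mulOf_mulOf _ _ _ _ e he σ (hσ hy₂ hx₁ hrel.exchange)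
  let eV := LinearEquiv.ofBijective _ (bijective_mulOf_symHom_extHom b hq hR.braid)
  let eU := LinearEquiv.ofBijective _ (bijective_mulOf_symHom_extHom c hq hR'.braid)
  refine ⟨QuadAlg.lift hy₁, QuadAlg.lift hx₁, (TensorProduct.congr eV eU).symm ≪≫ₗ e',
    fun i => ?_, fun i => ?_, fun s l y => ?_⟩
  · simp [dualGenFst, coord_prod_inl]
  · simp [genFst]
  · obtain ⟨t, rfl⟩ := eU.surjective y
    have h₁ : symHom q R b hq s * extHom q R b hq l = eV (s ⊗ₜ l) := by simp [eV]
    have h₂ : (koszulInr q R R' Q hq).comp (symHom q R' c hq) = QuadAlg.lift hy₂ :=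
      QuadAlg.hom_ext fun j => by simp [dualGenSnd, coord_prod_inr]
    have h₃ : (koszulInr q R R' Q hq).comp (extHom q R' c hq) = QuadAlg.lift hx₂ :=
      QuadAlg.hom_ext fun j => by simp [genSnd]
    rw [h₁, ← TensorProduct.congr_tmul, LinearEquiv.trans_apply, LinearEquiv.symm_apply_apply, he',
      mulOf_tmul, LinearEquiv.ofBijective_apply, mulOf_comp, h₂, h₃]

/-- The multiplication map `K(V) ⊗ K(U) → K(V ⊕_Q U)` is a linear isomorphism. -/
theorem exists_mulEquiv (hR : IsHecke q R) (hR' : IsHecke q R') (hQ : IsGluing R R' Q) :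
    ∃ φ : Koszul q R ⊗[k] Koszul q R' ≃ₗ[k] Koszul q (heckeSum q R R' Q),
      ∀ s e y, φ ((TensorAlgebra.lift k (dualGen q R) s * TensorAlgebra.lift k (gen q R) e) ⊗ₜ y) =
        TensorAlgebra.lift k (dualGenFst q R R' Q) s * TensorAlgebra.lift k (genFst q R R' Q) e *
          koszulInr q R R' Q hR.q_ne_zero y := by
  let b := finBasis k V
  obtain ⟨sV, lV, φ, hs, hl, hφ⟩ := exists_mulEquiv_aux b hR hR' hQ
  refine ⟨φ, fun s e y => ?_⟩
  let F := TensorAlgebra.lift k (b.dualBasis.constr k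
    (QuadAlg.x (addId (flipCoeff (coeff b b b b R)) (-q))))
  let G := TensorAlgebra.lift k (b.constr k (QuadAlg.x (addId (coeff b b b b R) q⁻¹)))
  have hF : ∀ i, F (TensorAlgebra.ι k (b.coord i)) = QuadAlg.x _ i := fun i => by
    rw [← b.coe_dualBasis, TensorAlgebra.lift_ι_apply, Basis.constr_basis]
  have hG : ∀ i, G (TensorAlgebra.ι k (b i)) = QuadAlg.x _ i := fun i => by
    rw [TensorAlgebra.lift_ι_apply, Basis.constr_basis]
  have h₁ : TensorAlgebra.lift k (dualGen q R) = (symHom q R b hR.q_ne_zero).comp F := by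
    refine TensorAlgebra.hom_ext (b.dualBasis.ext fun i => ?_)
    simp [hF]
  have h₂ : TensorAlgebra.lift k (gen q R) = (extHom q R b hR.q_ne_zero).comp G := by
    refine TensorAlgebra.hom_ext (b.ext fun i => ?_)
    simp [hG]
  have h₃ : TensorAlgebra.lift k (dualGenFst q R R' Q) = sV.comp F := by
    refine TensorAlgebra.hom_ext (b.dualBasis.ext fun i => ?_)
    simp [hF, hs]
  have h₄ : TensorAlgebra.lift k (genFst q R R' Q) = lV.comp G := by
    refine TensorAlgebra.hom_ext (b.ext fun i => ?_)
    simp [hG, hl]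
  rw [h₁, h₂, h₃, h₄]
  exact hφ _ _ _

end MulEquiv

/-! ### Commutation rules of the canonical element. -/

section Differential

variable {k : Type u} [Field k] {I : Type} [Fintype I] [DecidableEq I] {q : k}
  {r : I → I → I → I → k} {E : Type*} [Ring E] [Algebra k E] {x y : I → E}

theorem KoszulRep.mixed' (h : KoszulRep q r x y) (hq : q ≠ 0) (i j : I) :
    x i * y j = q⁻¹ • ∑ a, ∑ b, r a i b j • (y a * x b) := by
  rw [h.mixed, inv_smul_smul₀ hq]

/-- The mixed relation contributes q⁻¹ and the relation among the dual letters contributes q, and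
these cancel. -/
theorem KoszulRep.canonical_mul (h : KoszulRep q r x y) (hq : q ≠ 0) (j : I) :
    (∑ i, y i * x i) * y j = y j * ∑ i, y i * x i := by
  calc (∑ i, y i * x i) * y j = q⁻¹ • ∑ i, ∑ a, ∑ b, r a i b j • (y i * y a * x b) := by
        simp only [Finset.sum_mul, mul_assoc, h.mixed' hq, Finset.mul_sum, mul_smul_comm,
          Finset.smul_sum]
    _ = q⁻¹ • ∑ b, (∑ i, ∑ a, r a i b j • (y i * y a)) * x b := by
        rw [Finset.sum_comm_cycle]
        simp only [Finset.sum_mul, smul_mul_assoc]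
    _ = y j * ∑ i, y i * x i := by
        simp only [h.sym, smul_mul_assoc, ← Finset.smul_sum, inv_smul_smul₀ hq, mul_assoc,
          Finset.mul_sum]

/-- Here the factor q⁻¹ of the mixed relation meets the eigenvalue -q⁻¹ of the relation among the
x's. -/
theorem KoszulRep.mul_canonical (h : KoszulRep q r x y) (hq : q ≠ 0) (j : I) :
    x j * ∑ i, y i * x i = -(q⁻¹ * q⁻¹) • ((∑ i, y i * x i) * x j) := by
  calc x j * ∑ i, y i * x i = q⁻¹ • ∑ i, ∑ a, ∑ b, r a j b i • (y a * (x b * x i)) := by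
        simp only [Finset.mul_sum, ← mul_assoc, h.mixed' hq, Finset.sum_mul, smul_mul_assoc,
          Finset.smul_sum]
    _ = q⁻¹ • ∑ a, y a * ∑ b, ∑ i, r a j b i • (x b * x i) := by
        rw [← Finset.sum_comm_cycle]
        simp only [Finset.mul_sum, mul_smul_comm]
    _ = -(q⁻¹ * q⁻¹) • ((∑ i, y i * x i) * x j) := by
        simp only [h.ext, mul_smul_comm, ← Finset.smul_sum, smul_smul, mul_assoc, Finset.sum_mul]
        congr 1; ring

theorem KoszulRep.canonical_mul_canonical (h : KoszulRep q r x y) (hq : q ≠ 0)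
    (hq' : q ^ 2 ≠ -1) : (∑ i, y i * x i) * ∑ i, y i * x i = 0 := by
  set c := ∑ i, y i * x i with hc
  have h₁ : c * c = -(q⁻¹ * q⁻¹) • (c * c) := by
    calc c * c = ∑ i, y i * (x i * c) := by
          conv_lhs => enter [1]; rw [hc]
          simp only [Finset.sum_mul, mul_assoc]
      _ = -(q⁻¹ * q⁻¹) • ∑ i, c * (y i * x i) := by
          simp only [hc, h.mul_canonical hq, mul_smul_comm, ← Finset.smul_sum, ← mul_assoc,
            h.canonical_mul hq]
      _ = -(q⁻¹ * q⁻¹) • (c * c) := by rw [← Finset.mul_sum]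
  -- The coefficient 1 + q⁻² vanishes only if q² = -1.
  have h₂ : (1 + q⁻¹ * q⁻¹) • (c * c) = 0 := by
    rw [add_smul, one_smul]; nth_rewrite 1 [h₁]; simp
  refine (smul_eq_zero.1 h₂).resolve_left fun h₃ => hq' ?_
  field_simp at h₃
  linear_combination h₃

variable {V : Type*} [AddCommGroup V] [Module k V] [FiniteDimensional k V]
  {R : V ⊗[k] V →ₗ[k] V ⊗[k] V}

theorem canonicalElt_eq_sum (b : Basis I k V) :
    canonicalElt q R = ∑ i, dualGen q R (b.coord i) * gen q R (b i) := by
  have : (dualTensorHomEquiv k V V).symm LinearMap.id = ∑ i, b.coord i ⊗ₜ[k] b i := by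
    rw [LinearEquiv.symm_apply_eq]
    refine b.ext fun i => ?_
    simp [Finsupp.single_apply]
  rw [canonicalElt, this]
  simp

theorem canonicalElt_mul_dualGen (hq : q ≠ 0) (ξ : Dual k V) :
    canonicalElt q R * dualGen q R ξ = dualGen q R ξ * canonicalElt q R := by
  let b := finBasis k V
  suffices LinearMap.mulLeft k (canonicalElt q R) ∘ₗ dualGen q R =
      LinearMap.mulRight k (canonicalElt q R) ∘ₗ dualGen q R from LinearMap.congr_fun this ξ
  refine b.dualBasis.ext fun j => ?_
  simpa [canonicalElt_eq_sum b] using (koszulRep_gen b).canonical_mul hq j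

variable (R) in
theorem diff_comp_diff (hq : q ≠ 0) (hq' : q ^ 2 ≠ -1) : diff q R ∘ₗ diff q R = 0 := by
  let b := finBasis k V
  have := (koszulRep_gen (q := q) (R := R) b).canonical_mul_canonical hq hq'
  rw [← canonicalElt_eq_sum b] at this
  ext z
  simp [diff, ← mul_assoc, this]

theorem commute_lift {M : Type*} [AddCommGroup M] [Module k M] {f : M →ₗ[k] E} {c : E}
    (h : ∀ m, c * f m = f m * c) (s : TensorAlgebra k M) :
    c * TensorAlgebra.lift k f s = TensorAlgebra.lift k f s * c := by
  induction s using TensorAlgebra.induction with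
  | algebraMap t => simp [Algebra.commutes]
  | ι m => simp [h]
  | mul a b ha hb => rw [map_mul, ← mul_assoc, ha, mul_assoc, hb, mul_assoc]
  | add a b ha hb => rw [map_add, mul_add, ha, hb, add_mul]

theorem skewCommute_lift {M : Type*} [AddCommGroup M] [Module k M] {f : M →ₗ[k] E} {c : E}
    (h : ∀ m, c * f m = -(f m * c)) {n : ℕ} {s : TensorAlgebra k M}
    (hs : s ∈ LinearMap.range (TensorAlgebra.ι k (M := M)) ^ n) :
    c * TensorAlgebra.lift k f s = (-1 : k) ^ n • (TensorAlgebra.lift k f s * c) := by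
  induction hs using Submodule.pow_induction_on_left' with
  | algebraMap t => simp [Algebra.commutes]
  | add a b i _ _ ha hb => rw [map_add, mul_add, ha, hb, add_mul, smul_add]
  | mem_mul m hm i a _ ha =>
    obtain ⟨m, rfl⟩ := hm
    rw [map_mul, ← mul_assoc, TensorAlgebra.lift_ι_apply, h, neg_mul, mul_assoc, ha, pow_succ,
      mul_neg_one, neg_smul, mul_smul_comm, mul_assoc]

variable {U : Type*} [AddCommGroup U] [Module k U] [FiniteDimensional k U]
  {R' : U ⊗[k] U →ₗ[k] U ⊗[k] U} {Q : U ⊗[k] V ≃ₗ[k] V ⊗[k] U}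

/-- The V part is written in letters, because the deformed mixed relation of V and V* does not in
general allow an algebra map from K(V). -/
theorem canonicalElt_heckeSum (hq : q ≠ 0) (b : Basis I k V) :
    canonicalElt q (heckeSum q R R' Q) =
      ∑ i, dualGenFst q R R' Q (b.coord i) * genFst q R R' Q (b i) +
        koszulInr q R R' Q hq (canonicalElt q R') := by
  let c := finBasis k U
  rw [canonicalElt_eq_sum (b.prod c), canonicalElt_eq_sum c, map_sum, Fintype.sum_sum_type]
  simp only [coord_prod_inl, coe_prod_inl, coord_prod_inr, coe_prod_inr, map_mul,
    koszulInr_gen, koszulInr_dualGen]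
  rfl

/-- Moving v left past u costs -q⁻¹ Q, and moving v right past U* costs q⁻¹ Q♯. Both turn the
product into the same sum of terms u* v u, with opposite signs. -/
theorem koszulInr_canonicalElt_mul_genFst (hq : q ≠ 0) (v : V) :
    koszulInr q R R' Q hq (canonicalElt q R') * genFst q R R' Q v =
      -(genFst q R R' Q v * koszulInr q R R' Q hq (canonicalElt q R')) := by
  let b := finBasis k V
  let c := finBasis k U
  set C := koszulInr q R R' Q hq (canonicalElt q R') with hC
  suffices LinearMap.mulLeft k C ∘ₗ genFst q R R' Q = -(LinearMap.mulRight k C ∘ₗ genFst q R R' Q)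
    from LinearMap.congr_fun this v
  have hc : C = ∑ j, dualGenSnd q R R' Q (c.coord j) * genSnd q R R' Q (c j) := by
    simp [hC, canonicalElt_eq_sum c]
  obtain ⟨-, hx, -⟩ := (koszulRep_iff hq).1 (koszulRep_heckeSum q R R' Q b c)
  have hz := isInverseExchange_coeff b c Q
  obtain ⟨-, -, h₁⟩ := (satisfiesQuad_sum_ext hq hz).1 hx
  have h₂ := (sumRelations_heckeSum q R R' Q b c hq).exchange
  have h₁' : ∀ j i, genSnd q R R' Q (c j) * genFst q R R' Q (b i) =
      -(q⁻¹ • ∑ p, ∑ s, coeff c b b c Q.toLinearMap j i p s •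
        (genFst q R R' Q (b p) * genSnd q R R' Q (c s))) := by
    intro j i
    have := h₁ j i
    simp only [coe_prod_inl, coe_prod_inr, neg_mul, neg_smul, Finset.sum_neg_distrib, mul_smul,
      ← Finset.smul_sum] at this
    exact this
  have h₂' : ∀ i j, genFst q R R' Q (b i) * dualGenSnd q R R' Q (c.coord j) =
      q⁻¹ • ∑ p, ∑ s, coeff c b b c Q.toLinearMap p i s j •
        (dualGenSnd q R R' Q (c.coord p) * genFst q R R' Q (b s)) := by
    intro i j
    have := h₂ i j
    simp only [coe_prod_inl, coord_prod_inr, mul_smul, ← Finset.smul_sum] at this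
    exact this
  refine b.ext fun i => ?_
  simp only [LinearMap.comp_apply, LinearMap.neg_apply, LinearMap.mulLeft_apply,
    LinearMap.mulRight_apply, hc, Finset.sum_mul, Finset.mul_sum, mul_assoc, h₁']
  simp only [← mul_assoc _ _ (genSnd q R R' Q _), h₂', mul_neg, Finset.sum_neg_distrib,
    mul_smul_comm, smul_mul_assoc, Finset.mul_sum, Finset.sum_mul, ← Finset.smul_sum]
  rw [Finset.sum_comm_cycle]

end Differential

/-! ### The bigrading of K(V). -/

section Grading

variable {k : Type u} [Field k]

theorem eq_of_le_of_iSup_eq_top {ι M : Type*} [AddCommGroup M] [Module k M]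
    {G G' : ι → Submodule k M} (p : ι → M →ₗ[k] M) (hp : ∀ i, ∀ x ∈ G' i, p i x = x)
    (hp' : ∀ i j, i ≠ j → ∀ x ∈ G' j, p i x = 0) (hle : ∀ i, G i ≤ G' i) (htop : ⨆ i, G i = ⊤)
    (i : ι) : G i = G' i := by
  refine le_antisymm (hle i) fun x hx => ?_
  -- As the G j span, each p i maps the whole space into G i, while it fixes the elements of G' i.
  have key : ∀ y, p i y ∈ G i := by
    intro y
    have hy : y ∈ ⨆ i, G i := by rw [htop]; trivial
    induction hy using Submodule.iSup_induction' with
    | mem j y hy =>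
      by_cases h : i = j
      · subst h; rwa [hp i y (hle i hy)]
      · rw [hp' i j h y (hle j hy)]; exact zero_mem _
    | zero => rw [map_zero]; exact zero_mem _
    | add y z _ _ hy hz => rw [map_add]; exact add_mem hy hz
  rw [← hp i x hx]
  exact key x

theorem iSup_tensorGrade {M N : Type*} [AddCommGroup M] [Module k M] [AddCommGroup N] [Module k N]
    {A : ℕ → ℕ → Submodule k M} {B : ℕ → ℕ → Submodule k N} (hA : ⨆ p : ℕ × ℕ, A p.1 p.2 = ⊤)
    (hB : ⨆ p : ℕ × ℕ, B p.1 p.2 = ⊤) : ⨆ p : ℕ × ℕ, tensorGrade A B p.1 p.2 = ⊤ := by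
  rw [eq_top_iff]
  rintro t -
  induction t with
  | zero => exact zero_mem _
  | add s t hs ht => exact add_mem hs ht
  | tmul a b =>
    have ha : a ∈ ⨆ p : ℕ × ℕ, A p.1 p.2 := by rw [hA]; trivial
    have hb : b ∈ ⨆ p : ℕ × ℕ, B p.1 p.2 := by rw [hB]; trivial
    induction ha using Submodule.iSup_induction' with
    | zero => rw [TensorProduct.zero_tmul]; exact zero_mem _
    | add a a' _ _ ha ha' => rw [TensorProduct.add_tmul]; exact add_mem ha ha'
    | mem p a ha =>
      induction hb using Submodule.iSup_induction' with
      | zero => rw [TensorProduct.tmul_zero]; exact zero_mem _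
      | add a a' _ _ ha ha' => rw [TensorProduct.tmul_add]; exact add_mem ha ha'
      | mem s b hb =>
        exact Submodule.mem_iSup_of_mem (p + s) (Submodule.subset_span
          ⟨p.1, p.2, s.1, s.2, rfl, rfl, a, ha, b, hb, rfl⟩)

variable {V : Type*} [AddCommGroup V] [Module k V] [FiniteDimensional k V]
  {q : k} {R : V ⊗[k] V →ₗ[k] V ⊗[k] V}

theorem gen_mul_mem_grade {n m : ℕ} {x : Koszul q R} (v : V) (hx : x ∈ grade q R n m) :
    gen q R v * x ∈ grade q R (n + 1) m := by
  induction hx using Submodule.span_induction with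
  | mem x hx => exact Submodule.subset_span (hx.gen_mul v)
  | zero => rw [mul_zero]; exact zero_mem _
  | add x y _ _ hx hy => rw [mul_add]; exact add_mem hx hy
  | smul t x _ hx => rw [mul_smul_comm]; exact Submodule.smul_mem _ _ hx

theorem dualGen_mul_mem_grade {n m : ℕ} {x : Koszul q R} (ξ : Dual k V)
    (hx : x ∈ grade q R n m) : dualGen q R ξ * x ∈ grade q R n (m + 1) := by
  induction hx using Submodule.span_induction with
  | mem x hx => exact Submodule.subset_span (hx.dualGen_mul ξ)
  | zero => rw [mul_zero]; exact zero_mem _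
  | add x y _ _ hx hy => rw [mul_add]; exact add_mem hx hy
  | smul t x _ hx => rw [mul_smul_comm]; exact Submodule.smul_mem _ _ hx

theorem IsWord.mul_mem_grade {n m n' m' : ℕ} {x y : Koszul q R} (hx : IsWord q R n m x)
    (hy : y ∈ grade q R n' m') : x * y ∈ grade q R (n + n') (m + m') := by
  induction hx with
  | one => simpa using hy
  | gen_mul v _ ih => rw [mul_assoc, add_right_comm]; exact gen_mul_mem_grade v ih
  | dualGen_mul ξ _ ih => rw [mul_assoc, add_right_comm]; exact dualGen_mul_mem_grade ξ ih

theorem mul_mem_grade {n m n' m' : ℕ} {x y : Koszul q R} (hx : x ∈ grade q R n m)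
    (hy : y ∈ grade q R n' m') : x * y ∈ grade q R (n + n') (m + m') := by
  induction hx using Submodule.span_induction with
  | mem x hx => exact hx.mul_mem_grade hy
  | zero => rw [zero_mul]; exact zero_mem _
  | add x y _ _ hx hy => rw [add_mul]; exact add_mem hx hy
  | smul t x _ hx => rw [smul_mul_assoc]; exact Submodule.smul_mem _ _ hx

theorem one_mem_grade : (1 : Koszul q R) ∈ grade q R 0 0 := Submodule.subset_span .one

theorem gen_mem_grade (v : V) : gen q R v ∈ grade q R 1 0 := by
  simpa using gen_mul_mem_grade v one_mem_grade

theorem dualGen_mem_grade (ξ : Dual k V) : dualGen q R ξ ∈ grade q R 0 1 := by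
  simpa using dualGen_mul_mem_grade ξ one_mem_grade

variable (q R) in
theorem iSup_grade : ⨆ p : ℕ × ℕ, grade q R p.1 p.2 = ⊤ := by
  let b := finBasis k V
  refine eq_top_of_one_mem_of_mul_mem (adjoin_gen b) _
    (Submodule.mem_iSup_of_mem (0, 0) one_mem_grade) ?_
  intro s hs z hz
  induction hz using Submodule.iSup_induction' with
  | zero => rw [mul_zero]; exact zero_mem _
  | add x y _ _ hx hy => rw [mul_add]; exact add_mem hx hy
  | mem p z hz =>
    obtain ⟨i, rfl⟩ | ⟨i, rfl⟩ := hs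
    · exact Submodule.mem_iSup_of_mem (p.1, p.2 + 1) (dualGen_mul_mem_grade _ hz)
    · exact Submodule.mem_iSup_of_mem (p.1 + 1, p.2) (gen_mul_mem_grade _ hz)

end Grading

/-! ### Projections onto bidegrees and normally ordered components. -/

section GradeProj

variable {k : Type u} [Field k] {V : Type*} [AddCommGroup V] [Module k V] [FiniteDimensional k V]
  {q : k} {R : V ⊗[k] V →ₗ[k] V ⊗[k] V}

/-- Homogeneity of the relations: they survive when each letter is multiplied by a formal monomial
that records its bidegree. -/
theorem KoszulRep.single {I : Type} [Fintype I] [DecidableEq I] {r : I → I → I → I → k}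
    {E : Type*} [Ring E] [Algebra k E] {x y : I → E} (h : KoszulRep q r x y) :
    KoszulRep q r (fun i => AddMonoidAlgebra.single ((1, 0) : ℕ × ℕ) (x i))
      (fun i => AddMonoidAlgebra.single ((0, 1) : ℕ × ℕ) (y i)) := by
  refine ⟨fun i j => ?_, fun i j => ?_, fun i j => ?_⟩
  · simp only [AddMonoidAlgebra.single_mul_single, Prod.mk_add_mk, add_zero]
    simp only [← AddMonoidAlgebra.lsingle_apply (R := k), ← map_smul, ← map_sum, h.ext]
  · simp only [AddMonoidAlgebra.single_mul_single, Prod.mk_add_mk, add_zero]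
    simp only [← AddMonoidAlgebra.lsingle_apply (R := k), ← map_smul, ← map_sum, h.mixed]
  · simp only [AddMonoidAlgebra.single_mul_single, Prod.mk_add_mk, add_zero]
    simp only [← AddMonoidAlgebra.lsingle_apply (R := k), ← map_smul, ← map_sum, h.sym]

variable (q R) in
-- The components are defined as spans of words; their independence is seen from an algebra map to
-- K(V)[ℕ × ℕ] that marks bidegrees, whose coefficients are the projections.
theorem exists_gradeProj : ∃ p : ℕ × ℕ → Koszul q R →ₗ[k] Koszul q R,
    ∀ i j : ℕ × ℕ, ∀ x ∈ grade q R j.1 j.2, p i x = if i = j then x else 0 := by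
  let b := finBasis k V
  obtain ⟨F, h₁, h₂⟩ := exists_koszul_lift b (koszulRep_gen (q := q) (R := R) b).single
  have h₁' : ∀ v, F (gen q R v) = AddMonoidAlgebra.single ((1, 0) : ℕ × ℕ) (gen q R v) := by
    intro v
    suffices F.toLinearMap ∘ₗ gen q R =
        AddMonoidAlgebra.lsingle (R := k) ((1, 0) : ℕ × ℕ) ∘ₗ gen q R from
      LinearMap.congr_fun this v
    exact b.ext fun i => by simpa using h₁ i
  have h₂' : ∀ ξ, F (dualGen q R ξ) = AddMonoidAlgebra.single ((0, 1) : ℕ × ℕ) (dualGen q R ξ) := by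
    intro ξ
    suffices F.toLinearMap ∘ₗ dualGen q R =
        AddMonoidAlgebra.lsingle (R := k) ((0, 1) : ℕ × ℕ) ∘ₗ dualGen q R from
      LinearMap.congr_fun this ξ
    exact b.dualBasis.ext fun i => by simpa using h₂ i
  have hw : ∀ n m x, IsWord q R n m x → F x = AddMonoidAlgebra.single ((n, m) : ℕ × ℕ) x := by
    intro n m x hx
    induction hx with
    | one => rw [map_one]; rfl
    | gen_mul v _ ih =>
      rw [map_mul, h₁', ih, AddMonoidAlgebra.single_mul_single, Prod.mk_add_mk, add_comm 1,
        zero_add]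
    | dualGen_mul ξ _ ih =>
      rw [map_mul, h₂', ih, AddMonoidAlgebra.single_mul_single, Prod.mk_add_mk, add_comm 1,
        zero_add]
  refine ⟨fun i => Finsupp.lapply i ∘ₗ (AddMonoidAlgebra.coeffLinearEquiv k).toLinearMap ∘ₗ
    F.toLinearMap, fun i j x hx => ?_⟩
  induction hx using Submodule.span_induction with
  | mem x hx =>
    have := hw _ _ _ hx
    simp [this, Finsupp.single_apply, eq_comm]
  | zero => simp
  | add x y _ _ hx hy => rw [map_add, hx, hy]; split_ifs <;> simp
  | smul t x _ hx => rw [map_smul, hx]; split_ifs <;> simp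

variable (q R) in
/-- The projection of `K(V)` onto a homogeneous component. -/
noncomputable def gradeProj (i : ℕ × ℕ) : Koszul q R →ₗ[k] Koszul q R :=
  (exists_gradeProj q R).choose i

theorem gradeProj_of_mem {i j : ℕ × ℕ} {x : Koszul q R} (hx : x ∈ grade q R j.1 j.2) :
    gradeProj q R i x = if i = j then x else 0 :=
  (exists_gradeProj q R).choose_spec i j x hx

theorem eq_grade_of_le {G : ℕ × ℕ → Submodule k (Koszul q R)}
    (hle : ∀ i, G i ≤ grade q R i.1 i.2) (htop : ⨆ i, G i = ⊤) (i : ℕ × ℕ) :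
    G i = grade q R i.1 i.2 := by
  have h₁ : ∀ i : ℕ × ℕ, ∀ x ∈ grade q R i.1 i.2, gradeProj q R i x = x :=
    fun i x hx => by rw [gradeProj_of_mem hx, if_pos rfl]
  have h₂ : ∀ i j : ℕ × ℕ, i ≠ j → ∀ x ∈ grade q R j.1 j.2, gradeProj q R i x = 0 :=
    fun i j hij x hx => by rw [gradeProj_of_mem hx, if_neg hij]
  exact eq_of_le_of_iSup_eq_top (G := G) (G' := fun i : ℕ × ℕ => grade q R i.1 i.2)
    (gradeProj q R) h₁ h₂ hle htop i

theorem gradeProj_mem (i : ℕ × ℕ) (x : Koszul q R) : gradeProj q R i x ∈ grade q R i.1 i.2 := by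
  have hx : x ∈ ⨆ p : ℕ × ℕ, grade q R p.1 p.2 := by rw [iSup_grade]; trivial
  induction hx using Submodule.iSup_induction' with
  | zero => rw [map_zero]; exact zero_mem _
  | add x y _ _ hx hy => rw [map_add]; exact add_mem hx hy
  | mem j x hx =>
    rw [gradeProj_of_mem hx]
    split_ifs with h
    · rw [h]; exact hx
    · exact zero_mem _

theorem exists_lift_of_mem_pow {M E : Type*} [AddCommGroup M] [Module k M] [Ring E] [Algebra k E]
    {f : M →ₗ[k] E} {n : ℕ} {x : E} (hx : x ∈ LinearMap.range f ^ n) :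
    ∃ s ∈ LinearMap.range (TensorAlgebra.ι k (M := M)) ^ n, TensorAlgebra.lift k f s = x := by
  have : LinearMap.range f ^ n = (LinearMap.range (TensorAlgebra.ι k (M := M)) ^ n).map
      (TensorAlgebra.lift k f).toLinearMap := by
    rw [Submodule.map_pow, ← LinearMap.range_comp]
    congr 2
    exact (TensorAlgebra.ι_comp_lift f).symm
  rw [this] at hx
  exact hx

theorem lift_mem_of_mem_pow {M : Type*} [AddCommGroup M] [Module k M] {f : M →ₗ[k] Koszul q R}
    {a b : ℕ} (hf : ∀ m, f m ∈ grade q R a b) {n : ℕ} {s : TensorAlgebra k M}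
    (hs : s ∈ LinearMap.range (TensorAlgebra.ι k (M := M)) ^ n) :
    TensorAlgebra.lift k f s ∈ grade q R (n * a) (n * b) := by
  induction hs using Submodule.pow_induction_on_left' with
  | algebraMap t =>
    rw [AlgHom.commutes, Algebra.algebraMap_eq_smul_one, zero_mul, zero_mul]
    exact Submodule.smul_mem _ _ one_mem_grade
  | add x y i _ _ hx hy => rw [map_add]; exact add_mem hx hy
  | mem_mul m hm i x _ hx =>
    obtain ⟨m, rfl⟩ := hm
    rw [map_mul, TensorAlgebra.lift_ι_apply, Nat.succ_mul, Nat.succ_mul, add_comm, add_comm (i * b)]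
    exact mul_mem_grade (hf m) hx

theorem mem_iSup_pow {A B : Type*} [Ring A] [Algebra k A] [Ring B] [Algebra k B] (f : A →ₐ[k] B)
    {S : Set A} (hS : Algebra.adjoin k S = ⊤) (N : Submodule k B) (hN : ∀ s ∈ S, f s ∈ N) (a : A) :
    f a ∈ ⨆ n : ℕ, N ^ n := by
  have : (⨆ n : ℕ, N ^ n).comap f.toLinearMap = ⊤ := by
    refine eq_top_of_one_mem_of_mul_mem hS _ ?_ ?_
    · exact Submodule.mem_iSup_of_mem 0 (by simp [Submodule.one_le.1 le_rfl])
    · intro s hs z hz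
      have h : N * ⨆ n : ℕ, N ^ n ≤ ⨆ n : ℕ, N ^ n := by
        rw [Submodule.mul_iSup]
        exact iSup_le fun n => by rw [← pow_succ']; exact le_iSup (fun n : ℕ => N ^ n) (n + 1)
      refine h ?_
      rw [AlgHom.toLinearMap_apply, map_mul]
      exact Submodule.mul_mem_mul (hN s hs) hz
  exact (this ▸ Submodule.mem_top : a ∈ (⨆ n : ℕ, N ^ n).comap f.toLinearMap)

/-- Normal ordering of the homogeneous components. -/
theorem grade_eq_mul (hq : q ≠ 0)
    (h : LinearMap.rTensor V R ∘ₗ oneTensor V R ∘ₗ LinearMap.rTensor V R =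
      oneTensor V R ∘ₗ LinearMap.rTensor V R ∘ₗ oneTensor V R) (n m : ℕ) :
    grade q R n m = LinearMap.range (dualGen q R) ^ m * LinearMap.range (gen q R) ^ n := by
  -- Normally ordered products lie in the right component, and they span K(V) by the normal ordering
  -- theorem.
  refine (eq_grade_of_le (G := fun i => LinearMap.range (dualGen q R) ^ i.2 *
    LinearMap.range (gen q R) ^ i.1) ?_ ?_ (n, m)).symm
  · intro i
    refine Submodule.mul_le.2 fun x hx y hy => ?_
    obtain ⟨s, hs, rfl⟩ := exists_lift_of_mem_pow hx
    obtain ⟨e, he, rfl⟩ := exists_lift_of_mem_pow hy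
    have := mul_mem_grade (lift_mem_of_mem_pow (q := q) (R := R) dualGen_mem_grade hs)
      (lift_mem_of_mem_pow gen_mem_grade he)
    simpa using this
  · let b := finBasis k V
    rw [eq_top_iff]
    rintro x -
    obtain ⟨t, rfl⟩ := (bijective_mulOf_symHom_extHom b hq h).2 x
    induction t with
    | zero => rw [map_zero]; exact zero_mem _
    | add s t hs ht => rw [map_add]; exact add_mem hs ht
    | tmul s l =>
      have h₁ : symHom q R b hq s ∈ ⨆ n : ℕ, LinearMap.range (dualGen q R) ^ n :=
        mem_iSup_pow _ (QuadAlg.adjoin_x _) _ (by rintro _ ⟨i, rfl⟩; simp) s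
      have h₂ : extHom q R b hq l ∈ ⨆ n : ℕ, LinearMap.range (gen q R) ^ n :=
        mem_iSup_pow _ (QuadAlg.adjoin_x _) _ (by rintro _ ⟨i, rfl⟩; simp) l
      have h₃ := Submodule.mul_mem_mul h₁ h₂
      rw [Submodule.iSup_mul] at h₃
      have hle : ∀ m : ℕ, LinearMap.range (dualGen q R) ^ m * ⨆ n : ℕ, LinearMap.range (gen q R) ^ n ≤
          ⨆ i : ℕ × ℕ, LinearMap.range (dualGen q R) ^ i.2 * LinearMap.range (gen q R) ^ i.1 := by
        intro m
        rw [Submodule.mul_iSup]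
        exact iSup_le fun n => le_iSup (fun i : ℕ × ℕ => LinearMap.range (dualGen q R) ^ i.2 *
          LinearMap.range (gen q R) ^ i.1) (n, m)
      exact iSup_le hle h₃

theorem diff_mem_grade {n m : ℕ} {x : Koszul q R} (hx : x ∈ grade q R n m) :
    diff q R x ∈ grade q R (n + 1) (m + 1) := by
  let b := finBasis k V
  have : canonicalElt q R ∈ grade q R 1 1 := by
    rw [canonicalElt_eq_sum b]
    refine Submodule.sum_mem _ fun i _ => ?_
    simpa using mul_mem_grade (dualGen_mem_grade (q := q) (R := R) (b.coord i)) (gen_mem_grade (b i))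
  rw [add_comm n, add_comm m]
  exact mul_mem_grade this hx

theorem gradeProj_diff (n m : ℕ) (x : Koszul q R) :
    gradeProj q R (n + 1, m + 1) (diff q R x) = diff q R (gradeProj q R (n, m) x) := by
  have hx : x ∈ ⨆ p : ℕ × ℕ, grade q R p.1 p.2 := by rw [iSup_grade]; trivial
  induction hx using Submodule.iSup_induction' with
  | zero => simp
  | add x y _ _ hx hy => simp only [map_add, hx, hy]
  | mem j x hx =>
    rw [gradeProj_of_mem hx, gradeProj_of_mem (j := (j.1 + 1, j.2 + 1)) (diff_mem_grade hx)]
    obtain ⟨a, b⟩ := j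
    simp only [Prod.mk.injEq, add_left_inj]
    split_ifs <;> simp

/-- Covers also the bidegrees with a zero coordinate, which `gradeProj_diff` does not reach. -/
theorem gradeProj_diff_mem_range (i : ℕ × ℕ) (x : Koszul q R) :
    gradeProj q R i (diff q R x) ∈ LinearMap.range (diff q R) := by
  have hx : x ∈ ⨆ p : ℕ × ℕ, grade q R p.1 p.2 := by rw [iSup_grade]; trivial
  induction hx using Submodule.iSup_induction' with
  | zero => simp
  | add x y _ _ hx hy => simp only [map_add]; exact add_mem hx hy
  | mem j x hx =>
    rw [gradeProj_of_mem (j := (j.1 + 1, j.2 + 1)) (diff_mem_grade hx)]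
    split_ifs
    · exact ⟨x, rfl⟩
    · exact zero_mem _

theorem gradeProj_mem_ker (i : ℕ × ℕ) {x : Koszul q R} (hx : x ∈ LinearMap.ker (diff q R)) :
    gradeProj q R i x ∈ LinearMap.ker (diff q R) := by
  rw [LinearMap.mem_ker] at hx ⊢
  rw [← gradeProj_diff i.1 i.2, hx, map_zero]

end GradeProj

/-! ### Uniqueness, bidegrees and differential of the multiplication map. -/

section MulMap

variable {k : Type u} [Field k]
  {V : Type*} [AddCommGroup V] [Module k V] [FiniteDimensional k V]
  {U : Type*} [AddCommGroup U] [Module k U] [FiniteDimensional k U]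
  {q : k} {R : V ⊗[k] V →ₗ[k] V ⊗[k] V} {R' : U ⊗[k] U →ₗ[k] U ⊗[k] U}
  {Q : U ⊗[k] V ≃ₗ[k] V ⊗[k] U}

/-- Induction on normally ordered monomials. -/
@[elab_as_elim]
theorem grade_induction (hq : q ≠ 0)
    (h : LinearMap.rTensor V R ∘ₗ oneTensor V R ∘ₗ LinearMap.rTensor V R =
      oneTensor V R ∘ₗ LinearMap.rTensor V R ∘ₗ oneTensor V R) {n m : ℕ}
    {C : Koszul q R → Prop}
    (hmul : ∀ s ∈ LinearMap.range (TensorAlgebra.ι k (M := Dual k V)) ^ m,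
      ∀ e ∈ LinearMap.range (TensorAlgebra.ι k (M := V)) ^ n,
        C (TensorAlgebra.lift k (dualGen q R) s * TensorAlgebra.lift k (gen q R) e))
    (hadd : ∀ x y, C x → C y → C (x + y)) {x : Koszul q R} (hx : x ∈ grade q R n m) : C x := by
  rw [grade_eq_mul hq h] at hx
  refine Submodule.mul_induction_on hx (fun x hx y hy => ?_) hadd
  obtain ⟨s, hs, rfl⟩ := exists_lift_of_mem_pow hx
  obtain ⟨e, he, rfl⟩ := exists_lift_of_mem_pow hy
  exact hmul s hs e he

theorem koszulInr_proj (hq : q ≠ 0) (w : TensorAlgebra k (U × Dual k U)) :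
    koszulInr q R R' Q hq (proj q R' w) = proj q (heckeSum q R R' Q)
      (TensorAlgebra.lift k (TensorAlgebra.ι k ∘ₗ inclSecond k V U) w) := by
  suffices (koszulInr q R R' Q hq).comp (proj q R') = (proj q (heckeSum q R R' Q)).comp
      (TensorAlgebra.lift k (TensorAlgebra.ι k ∘ₗ inclSecond k V U)) from
    DFunLike.congr_fun this w
  refine TensorAlgebra.hom_ext (LinearMap.prod_ext ?_ ?_)
  · ext u
    have h₁ : inclSecond k V U (u, 0) = (LinearMap.inr k V U u, 0) := by simp [inclSecond]
    have h₂ : proj q R' (TensorAlgebra.ι k (u, 0)) = gen q R' u := rfl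
    simp only [LinearMap.comp_apply, LinearMap.inl_apply, AlgHom.toLinearMap_apply,
      AlgHom.comp_apply, TensorAlgebra.lift_ι_apply, h₁, h₂, koszulInr_gen]
    rfl
  · ext ξ
    have h₁ : inclSecond k V U (0, ξ) = (0, (LinearMap.snd k V U).dualMap ξ) := by
      simp [inclSecond]
    have h₂ : proj q R' (TensorAlgebra.ι k (0, ξ)) = dualGen q R' ξ := rfl
    simp only [LinearMap.comp_apply, LinearMap.inr_apply, AlgHom.toLinearMap_apply,
      AlgHom.comp_apply, TensorAlgebra.lift_ι_apply, h₁, h₂, koszulInr_dualGen]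
    rfl

theorem koszulInr_mem_grade (hq : q ≠ 0) {n m : ℕ} {y : Koszul q R'} (hy : y ∈ grade q R' n m) :
    koszulInr q R R' Q hq y ∈ grade q (heckeSum q R R' Q) n m := by
  induction hy using Submodule.span_induction with
  | zero => rw [map_zero]; exact zero_mem _
  | add x y _ _ hx hy => rw [map_add]; exact add_mem hx hy
  | smul t x _ hx => rw [map_smul]; exact Submodule.smul_mem _ _ hx
  | mem x hx =>
    induction hx with
    | one => rw [map_one]; exact one_mem_grade
    | gen_mul u _ ih => rw [map_mul, koszulInr_gen]; exact gen_mul_mem_grade _ ih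
    | dualGen_mul ξ _ ih => rw [map_mul, koszulInr_dualGen]; exact dualGen_mul_mem_grade _ ih

variable (q R R' Q) in
/-- `f` multiplies normally ordered elements of `K(V)` with elements of `K(U)`. -/
def IsOrderedMul (hq : q ≠ 0)
    (f : Koszul q R ⊗[k] Koszul q R' →ₗ[k] Koszul q (heckeSum q R R' Q)) : Prop :=
  ∀ s e y, f ((TensorAlgebra.lift k (dualGen q R) s * TensorAlgebra.lift k (gen q R) e) ⊗ₜ y) =
    TensorAlgebra.lift k (dualGenFst q R R' Q) s * TensorAlgebra.lift k (genFst q R R' Q) e *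
      koszulInr q R R' Q hq y

theorem isMulMap_iff (hq : q ≠ 0)
    {f : Koszul q R ⊗[k] Koszul q R' →ₗ[k] Koszul q (heckeSum q R R' Q)} :
    IsMulMap q R R' Q f ↔ IsOrderedMul q R R' Q hq f := by
  constructor
  · intro h s e y
    obtain ⟨w, rfl⟩ := proj_surjective y
    rw [koszulInr_proj]
    exact h s e w
  · intro h s e w
    rw [h, koszulInr_proj]
    rfl

/-- Normally ordered products span K(V), so the prescribed values determine the map. -/
theorem IsOrderedMul.eq {hq : q ≠ 0}
    (h : LinearMap.rTensor V R ∘ₗ oneTensor V R ∘ₗ LinearMap.rTensor V R =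
      oneTensor V R ∘ₗ LinearMap.rTensor V R ∘ₗ oneTensor V R)
    {f g : Koszul q R ⊗[k] Koszul q R' →ₗ[k] Koszul q (heckeSum q R R' Q)}
    (hf : IsOrderedMul q R R' Q hq f) (hg : IsOrderedMul q R R' Q hq g) : f = g := by
  refine TensorProduct.ext' fun x y => ?_
  have hx : x ∈ ⨆ p : ℕ × ℕ, grade q R p.1 p.2 := by rw [iSup_grade]; trivial
  induction hx using Submodule.iSup_induction' with
  | zero => simp
  | add x y _ _ hx hy => simp only [TensorProduct.add_tmul, map_add, hx, hy]
  | mem p x hx =>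
    refine grade_induction hq h (fun s _ e _ => ?_) (fun x y hx hy => ?_) hx
    · rw [hf, hg]
    · simp only [TensorProduct.add_tmul, map_add, hx, hy]

theorem IsOrderedMul.map_tensorGrade {hq : q ≠ 0}
    (h : LinearMap.rTensor V R ∘ₗ oneTensor V R ∘ₗ LinearMap.rTensor V R =
      oneTensor V R ∘ₗ LinearMap.rTensor V R ∘ₗ oneTensor V R)
    {f : Koszul q R ⊗[k] Koszul q R' →ₗ[k] Koszul q (heckeSum q R R' Q)}
    (hf : IsOrderedMul q R R' Q hq f) (hsurj : Function.Surjective f) (p r : ℕ) :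
    (tensorGrade (grade q R) (grade q R') p r).map f = grade q (heckeSum q R R' Q) p r := by
  refine eq_grade_of_le (G := fun i => (tensorGrade (grade q R) (grade q R') i.1 i.2).map f)
    ?_ ?_ (p, r)
  · rintro ⟨p, r⟩
    refine Submodule.map_le_iff_le_comap.2 (Submodule.span_le.2 ?_)
    rintro _ ⟨n, m, i, j, rfl, rfl, x, hx, y, hy, rfl⟩
    rw [SetLike.mem_coe, Submodule.mem_comap]
    refine grade_induction hq h (fun s hs e he => ?_) (fun x y hx hy => ?_) hx
    · rw [hf]
      have h₁ : TensorAlgebra.lift k (dualGenFst q R R' Q) s ∈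
          grade q (heckeSum q R R' Q) (m * 0) (m * 1) :=
        lift_mem_of_mem_pow (f := dualGenFst q R R' Q)
          (fun ξ => dualGen_mem_grade ((LinearMap.fst k V U).dualMap ξ)) hs
      have h₂ : TensorAlgebra.lift k (genFst q R R' Q) e ∈
          grade q (heckeSum q R R' Q) (n * 1) (n * 0) :=
        lift_mem_of_mem_pow (f := genFst q R R' Q) (fun v => gen_mem_grade (v, 0)) he
      simpa using mul_mem_grade (mul_mem_grade h₁ h₂) (koszulInr_mem_grade hq hy)
    · rw [TensorProduct.add_tmul, map_add]; exact add_mem hx hy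
  · rw [← Submodule.map_iSup, iSup_tensorGrade (iSup_grade q R) (iSup_grade q R'),
      Submodule.map_top, LinearMap.range_eq_top.2 hsurj]

theorem diff_apply (x : Koszul q R) : diff q R x = canonicalElt q R * x := rfl

theorem canonicalElt_mul_dualGenFst (hq : q ≠ 0) (ξ : Dual k V) :
    canonicalElt q (heckeSum q R R' Q) * dualGenFst q R R' Q ξ =
      dualGenFst q R R' Q ξ * canonicalElt q (heckeSum q R R' Q) :=
  canonicalElt_mul_dualGen hq ((LinearMap.fst k V U).dualMap ξ)

/-- For x = se one has c_X s e w = s c_X e w. The V part of c_X yields s vⁱ vᵢ e, which is normally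
ordered and equals c_V s e in K(V); the part c_U passes e with the sign (-1)ⁿ and then acts on w. -/
theorem IsOrderedMul.diff_apply {hq : q ≠ 0}
    (h : LinearMap.rTensor V R ∘ₗ oneTensor V R ∘ₗ LinearMap.rTensor V R =
      oneTensor V R ∘ₗ LinearMap.rTensor V R ∘ₗ oneTensor V R)
    {f : Koszul q R ⊗[k] Koszul q R' →ₗ[k] Koszul q (heckeSum q R R' Q)}
    (hf : IsOrderedMul q R R' Q hq f) {n m : ℕ} {x : Koszul q R} (hx : x ∈ grade q R n m)
    (y : Koszul q R') :
    diff q (heckeSum q R R' Q) (f (x ⊗ₜ[k] y)) =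
      f (diff q R x ⊗ₜ[k] y + (-1 : k) ^ n • (x ⊗ₜ[k] diff q R' y)) := by
  refine grade_induction hq h (fun s hs e he => ?_) (fun x y hx hy => ?_) hx
  · let b := finBasis k V
    have h₁ := commute_lift (canonicalElt_mul_dualGenFst (R := R) (Q := Q) (R' := R') hq) s
    have h₂ : canonicalElt q R * TensorAlgebra.lift k (dualGen q R) s =
        TensorAlgebra.lift k (dualGen q R) s * canonicalElt q R :=
      commute_lift (fun ξ => canonicalElt_mul_dualGen hq _) s
    have h₃ := skewCommute_lift (koszulInr_canonicalElt_mul_genFst (R := R) (Q := Q) (R' := R') hq) he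
    have h₄ : ∀ i, TensorAlgebra.lift k (dualGen q R) s *
        (dualGen q R (b.coord i) * gen q R (b i) * TensorAlgebra.lift k (gen q R) e) =
        TensorAlgebra.lift k (dualGen q R) (s * TensorAlgebra.ι k (b.coord i)) *
          TensorAlgebra.lift k (gen q R) (TensorAlgebra.ι k (b i) * e) := fun i => by
      simp [mul_assoc]
    have h₅ : diff q R (TensorAlgebra.lift k (dualGen q R) s * TensorAlgebra.lift k (gen q R) e) =
        ∑ i, TensorAlgebra.lift k (dualGen q R) (s * TensorAlgebra.ι k (b.coord i)) *
          TensorAlgebra.lift k (gen q R) (TensorAlgebra.ι k (b i) * e) := by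
      rw [HeckeKoszul.diff_apply, ← mul_assoc, h₂, mul_assoc, canonicalElt_eq_sum b,
        Finset.sum_mul, Finset.mul_sum]
      simp only [h₄]
    have h₆ : diff q R' y = canonicalElt q R' * y := rfl
    rw [map_add, map_smul, hf, h₅, h₆, hf, TensorProduct.sum_tmul, map_sum,
      Finset.sum_congr rfl fun i _ => hf _ _ _]
    rw [HeckeKoszul.diff_apply, ← mul_assoc, ← mul_assoc, h₁,
      mul_assoc _ _ (TensorAlgebra.lift k (genFst q R R' Q) e), canonicalElt_heckeSum hq b,
      add_mul, h₃, mul_add, add_mul, map_mul (koszulInr q R R' Q hq)]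
    congr 1
    · simp only [Finset.sum_mul, Finset.mul_sum, map_mul, TensorAlgebra.lift_ι_apply, mul_assoc]
    · simp only [mul_assoc, mul_smul_comm, smul_mul_assoc]
  · simp only [TensorProduct.add_tmul, map_add, hx, hy, smul_add]
    abel

end MulMap

/-! ### The Künneth theorem over a field. -/

section Kunneth

variable {k : Type u} [Field k] {A B C : Type*} [AddCommGroup A] [Module k A] [AddCommGroup B]
  [Module k B] [AddCommGroup C] [Module k C]

/-- The cohomology of an endomorphism. -/
abbrev Cohomology (d : A →ₗ[k] A) :=
  LinearMap.ker d ⧸ (LinearMap.range d).submoduleOf (LinearMap.ker d)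

theorem exists_generalized_inverse (d : A →ₗ[k] A) : ∃ s : A →ₗ[k] A, ∀ x, d (s (d x)) = d x := by
  obtain ⟨g, hg⟩ := d.rangeRestrict.exists_rightInverse_of_surjective d.range_rangeRestrict
  obtain ⟨s, hs⟩ := g.exists_extend
  refine ⟨s, fun x => ?_⟩
  have h₁ : s (d x) = g ⟨d x, x, rfl⟩ := LinearMap.congr_fun hs ⟨d x, x, rfl⟩
  have h₂ := congrArg Subtype.val (LinearMap.congr_fun hg ⟨d x, x, rfl⟩)
  rw [h₁]
  exact h₂

/-- If s is a generalized inverse of d, so is -εsε, because d anticommutes with ε. Their average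
anticommutes with ε; this is where 2 must be invertible. -/
theorem exists_skew_generalized_inverse [CharZero k] {d ε : A →ₗ[k] A}
    (hε : ∀ x, ε (ε x) = x) (hd : ∀ x, d (ε x) = -ε (d x)) :
    ∃ s : A →ₗ[k] A, (∀ x, d (s (d x)) = d x) ∧ ∀ x, s (ε x) = -ε (s x) := by
  obtain ⟨s, hs⟩ := exists_generalized_inverse d
  have h2 : (2⁻¹ : k) + 2⁻¹ = 1 := by norm_num
  refine ⟨(2⁻¹ : k) • (s - ε ∘ₗ s ∘ₗ ε), fun x => ?_, fun x => ?_⟩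
  · have h : ε (d x) = -d (ε x) := by rw [hd, neg_neg]
    have h' : d (ε (s (ε (d x)))) = -d x := by
      rw [h, map_neg, map_neg, map_neg, hd (s _), hs, neg_neg, hd, map_neg, hε]
    simp only [LinearMap.smul_apply, LinearMap.sub_apply, LinearMap.comp_apply, map_smul, map_sub,
      hs, h', sub_neg_eq_add, smul_add, ← add_smul, h2, one_smul]
  · simp only [LinearMap.smul_apply, LinearMap.sub_apply, LinearMap.comp_apply, map_smul, map_sub,
      hε, ← smul_neg, neg_sub]

/-- The map to cohomology given by a homotopy `s` from a projection to the identity. -/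
theorem exists_cohomology_section {d s : A →ₗ[k] A} (hdd : ∀ x, d (d x) = 0)
    (hs : ∀ x, d (s (d x)) = d x) :
    ∃ (π : A →ₗ[k] Cohomology d) (σ : Cohomology d →ₗ[k] A),
      (∀ x : LinearMap.ker d, π x = Submodule.mkQ _ x) ∧ (∀ x, π (d x) = 0) ∧
      ∀ x, σ (π x) =
        (LinearMap.id - d ∘ₗ s - s ∘ₗ d : A →ₗ[k] A) ((LinearMap.id - d ∘ₗ s - s ∘ₗ d : A →ₗ[k] A) x) := by
  set p : A →ₗ[k] A := LinearMap.id - d ∘ₗ s - s ∘ₗ d with hp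
  have hdp : ∀ x, d (p x) = 0 := fun x => by simp [hp, hdd, hs]
  have hpd : ∀ x, p (d x) = 0 := fun x => by simp [hp, hdd, hs]
  refine ⟨Submodule.mkQ _ ∘ₗ p.codRestrict _ hdp, Submodule.liftQ _ (p ∘ₗ Submodule.subtype _) ?_,
    fun x => ?_, fun x => ?_, fun x => ?_⟩
  · rintro ⟨_, _⟩ ⟨x, rfl⟩
    exact hpd x
  · refine (Submodule.Quotient.eq _).2 ⟨-s x, ?_⟩
    have hx : d x = 0 := x.2
    simp [hp, hx]
  · have : p.codRestrict (LinearMap.ker d) hdp (d x) = 0 := Subtype.ext (hpd x)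
    rw [LinearMap.comp_apply, this, map_zero]
  · rfl

/-- With p = 1 - ds - sd and p' likewise, p ⊗ p' is homotopic to the identity and factors through
cohomology up to a second application. -/
theorem exists_kunneth_map [CharZero k] {d ε : A →ₗ[k] A} {d' : B →ₗ[k] B}
    (hdd : ∀ x, d (d x) = 0) (hdd' : ∀ y, d' (d' y) = 0) (hε : ∀ x, ε (ε x) = x)
    (hd : ∀ x, d (ε x) = -ε (d x)) {D : A ⊗[k] B →ₗ[k] A ⊗[k] B}
    (hD : ∀ x y, D (x ⊗ₜ y) = d x ⊗ₜ y + ε x ⊗ₜ d' y) :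
    ∃ Ψ : A ⊗[k] B →ₗ[k] Cohomology d ⊗[k] Cohomology d',
      (∀ (x : LinearMap.ker d) (y : LinearMap.ker d'), Ψ ((x : A) ⊗ₜ (y : B)) =
        Submodule.mkQ _ x ⊗ₜ Submodule.mkQ _ y) ∧
      (∀ z, Ψ (D z) = 0) ∧ ∀ z, D z = 0 → Ψ z = 0 → z ∈ LinearMap.range D := by
  obtain ⟨s, hs, hsε⟩ := exists_skew_generalized_inverse hε hd
  obtain ⟨s', hs'⟩ := exists_generalized_inverse d'
  obtain ⟨π, σ, h₁, h₂, h₃⟩ := exists_cohomology_section hdd hs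
  obtain ⟨π', σ', h₁', h₂', h₃'⟩ := exists_cohomology_section hdd' hs'
  set p : A →ₗ[k] A := LinearMap.id - d ∘ₗ s - s ∘ₗ d with hp
  set p' : B →ₗ[k] B := LinearMap.id - d' ∘ₗ s' - s' ∘ₗ d' with hp'
  -- Deform the first factor to p by s, then the second to p' by s'; the sign operator ε makes h fit
  -- the differential d ⊗ 1 + ε ⊗ d'.
  let h : A ⊗[k] B →ₗ[k] A ⊗[k] B :=
    TensorProduct.map s LinearMap.id + TensorProduct.map (p ∘ₗ ε) s'
  have hpε : ∀ x, p (ε x) = ε (p x) := fun x => by simp [hp, hd, hsε]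
  have hdp : ∀ x, d (p x) = 0 := fun x => by simp [hp, hdd, hs]
  have hpd : ∀ x, p (d x) = 0 := fun x => by simp [hp, hdd, hs]
  have hh : ∀ z, z = TensorProduct.map p p' z + (D (h z) + h (D z)) := by
    intro z
    induction z with
    | zero => simp
    | add z w hz hw =>
      simp only [map_add]
      nth_rewrite 1 [hz, hw]
      abel
    | tmul x y =>
      have e₁ : p x = x - d (s x) - s (d x) := rfl
      have e₂ : p' y = y - d' (s' y) - s' (d' y) := rfl
      have e₃ : D (h (x ⊗ₜ y)) = d (s x) ⊗ₜ y + ε (s x) ⊗ₜ d' y + p x ⊗ₜ d' (s' y) := by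
        simp only [h, LinearMap.add_apply, TensorProduct.map_tmul, LinearMap.id_apply,
          LinearMap.comp_apply, map_add, hD, hpε, hd, hdp, hε, map_zero, neg_zero,
          TensorProduct.zero_tmul, zero_add]
      have e₄ : h (D (x ⊗ₜ y)) = s (d x) ⊗ₜ y - ε (s x) ⊗ₜ d' y + p x ⊗ₜ s' (d' y) := by
        simp only [h, LinearMap.add_apply, TensorProduct.map_tmul, LinearMap.id_apply,
          LinearMap.comp_apply, map_add, hD, hpε, hpd, hsε, hε, map_zero,
          TensorProduct.zero_tmul, TensorProduct.neg_tmul]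
        abel
      rw [e₃, e₄, TensorProduct.map_tmul, e₂, TensorProduct.tmul_sub, TensorProduct.tmul_sub]
      have : x ⊗ₜ[k] y = p x ⊗ₜ[k] y + (d (s x) ⊗ₜ[k] y + s (d x) ⊗ₜ[k] y) := by
        rw [← TensorProduct.add_tmul, ← TensorProduct.add_tmul, e₁]
        congr 1
        abel
      rw [this]
      abel
  refine ⟨TensorProduct.map π π', fun x y => ?_, fun z => ?_, fun z hz hz' => ?_⟩
  · rw [TensorProduct.map_tmul, h₁, h₁']
  · suffices TensorProduct.map π π' ∘ₗ D = 0 from LinearMap.congr_fun this z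
    refine TensorProduct.ext' fun x y => ?_
    simp [hD, h₂, h₂']
  -- The map p need not be idempotent, so vanishing in cohomology only gives (p ⊗ p')² z = 0. The
  -- homotopy formula is therefore used twice, for z and for (p ⊗ p') z.
  · have hσ : TensorProduct.map p p' (TensorProduct.map p p' z) = 0 := by
      have : TensorProduct.map σ σ' (TensorProduct.map π π' z) =
          TensorProduct.map p p' (TensorProduct.map p p' z) := by
        simp only [← LinearMap.comp_apply, ← TensorProduct.map_comp]
        congr 2 <;> ext x
        · exact h₃ x
        · exact h₃' x
      rw [← this, hz', map_zero]
    have hDD : ∀ w, D (D w) = 0 := by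
      intro w
      induction w with
      | zero => simp
      | add z w hz hw => simp only [map_add, hz, hw, add_zero]
      | tmul x y => simp [hD, hdd, hdd', hd, TensorProduct.neg_tmul]
    have e₁ := hh z
    rw [hz, map_zero, add_zero] at e₁
    have hw : D (TensorProduct.map p p' z) = 0 := by
      rw [← sub_eq_of_eq_add e₁, map_sub, hz, hDD, sub_zero]
    have e₂ := hh (TensorProduct.map p p' z)
    rw [hw, hσ, map_zero, add_zero, zero_add] at e₂
    rw [e₁, e₂, ← map_add]
    exact ⟨_, rfl⟩

/-- The Künneth isomorphism for the super tensor product of two complexes. -/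
theorem exists_kunneth_equiv [CharZero k] {d ε : A →ₗ[k] A} {d' : B →ₗ[k] B}
    (hdd : ∀ x, d (d x) = 0) (hdd' : ∀ y, d' (d' y) = 0) (hε : ∀ x, ε (ε x) = x)
    (hd : ∀ x, d (ε x) = -ε (d x)) (φ : A ⊗[k] B ≃ₗ[k] C) {D : C →ₗ[k] C}
    (hD : ∀ x y, D (φ (x ⊗ₜ y)) = φ (d x ⊗ₜ y + ε x ⊗ₜ d' y)) :
    ∃ ψ : Cohomology D ≃ₗ[k] Cohomology d ⊗[k] Cohomology d',
      ∀ (x : LinearMap.ker d) (y : LinearMap.ker d'),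
        ∃ h : φ ((x : A) ⊗ₜ[k] (y : B)) ∈ LinearMap.ker D,
          ψ (Submodule.mkQ _ ⟨_, h⟩) = Submodule.mkQ _ x ⊗ₜ[k] Submodule.mkQ _ y := by
  let D' : A ⊗[k] B →ₗ[k] A ⊗[k] B := φ.symm.toLinearMap ∘ₗ D ∘ₗ φ.toLinearMap
  have hD' : ∀ x y, D' (x ⊗ₜ y) = d x ⊗ₜ y + ε x ⊗ₜ d' y := fun x y => by
    simp only [D', LinearMap.comp_apply, LinearEquiv.coe_coe, hD, LinearEquiv.symm_apply_apply]
  obtain ⟨Ψ, h₁, h₂, h₃⟩ := exists_kunneth_map hdd hdd' hε hd hD'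
  let Θ : LinearMap.ker D →ₗ[k] Cohomology d ⊗[k] Cohomology d' :=
    Ψ ∘ₗ φ.symm.toLinearMap ∘ₗ Submodule.subtype _
  have hmem : ∀ (x : LinearMap.ker d) (y : LinearMap.ker d'),
      φ ((x : A) ⊗ₜ[k] (y : B)) ∈ LinearMap.ker D := fun x y => by
    have hx : d x = 0 := x.2
    have hy : d' y = 0 := y.2
    simp [hD, hx, hy]
  have hΘ : ∀ x y, Θ ⟨_, hmem x y⟩ = Submodule.mkQ _ x ⊗ₜ[k] Submodule.mkQ _ y := fun x y => by
    simp only [Θ, LinearMap.comp_apply, Submodule.subtype_apply, LinearEquiv.coe_coe,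
      LinearEquiv.symm_apply_apply, h₁]
  have hsurj : Function.Surjective Θ := by
    intro t
    induction t with
    | zero => exact ⟨0, map_zero _⟩
    | add t t' ht ht' =>
      obtain ⟨z, rfl⟩ := ht
      obtain ⟨z', rfl⟩ := ht'
      exact ⟨z + z', map_add _ _ _⟩
    | tmul x y =>
      obtain ⟨x, rfl⟩ := Submodule.mkQ_surjective _ x
      obtain ⟨y, rfl⟩ := Submodule.mkQ_surjective _ y
      exact ⟨_, hΘ x y⟩
  have hker : (LinearMap.range D).submoduleOf (LinearMap.ker D) = LinearMap.ker Θ := by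
    ext z
    obtain ⟨z, hz⟩ := z
    rw [LinearMap.mem_ker] at hz
    constructor
    · rintro ⟨w, hw⟩
      have hw : D w = z := hw
      have : φ.symm z = D' (φ.symm w) := by simp [D', hw]
      change Ψ (φ.symm z) = 0
      rw [this, h₂]
    · intro h
      obtain ⟨w, hw⟩ := h₃ (φ.symm z) (by simp [D', hz]) h
      refine ⟨φ w, ?_⟩
      have := congrArg φ hw
      simpa [D'] using this
  refine ⟨Submodule.quotEquivOfEq _ _ hker ≪≫ₗ Θ.quotKerEquivOfSurjective hsurj,
    fun x y => ⟨hmem x y, ?_⟩⟩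
  rw [← hΘ]
  rfl

end Kunneth

/-! ### The sign operator on K(V) and the bigrading of the Berezinian. -/

section Parity

variable {k : Type u} [Field k] {V : Type*} [AddCommGroup V] [Module k V] [FiniteDimensional k V]
  {q : k} {R : V ⊗[k] V →ₗ[k] V ⊗[k] V}

theorem hom_ext_of_grade {N : Type*} [AddCommGroup N] [Module k N] {f g : Koszul q R →ₗ[k] N}
    (h : ∀ n m, ∀ x ∈ grade q R n m, f x = g x) : f = g := by
  have : ⨆ p : ℕ × ℕ, grade q R p.1 p.2 ≤ LinearMap.eqLocus f g :=
    iSup_le fun p x hx => h p.1 p.2 x hx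
  rw [iSup_grade] at this
  exact LinearMap.ext fun x => this Submodule.mem_top

theorem KoszulRep.neg {I : Type} [Fintype I] [DecidableEq I] {r : I → I → I → I → k}
    {E : Type*} [Ring E] [Algebra k E] {x y : I → E} (h : KoszulRep q r x y) :
    KoszulRep q r (fun i => -x i) y := by
  refine ⟨fun i j => ?_, fun i j => ?_, h.sym⟩
  · simp only [neg_mul_neg, h.ext]
  · simp only [neg_mul, mul_neg, smul_neg, Finset.sum_neg_distrib, h.mixed]

variable (q R) in
-- The substitution v ↦ -v preserves the Koszul relations and so defines an algebra endomorphism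
-- with the required signs.
theorem exists_parity : ∃ ε : Koszul q R →ₗ[k] Koszul q R,
    ∀ n m, ∀ x ∈ grade q R n m, ε x = (-1 : k) ^ n • x := by
  let b := finBasis k V
  obtain ⟨F, h₁, h₂⟩ := exists_koszul_lift b (koszulRep_gen (q := q) (R := R) b).neg
  have h₁' : ∀ v, F (gen q R v) = -gen q R v := by
    intro v
    suffices F.toLinearMap ∘ₗ gen q R = -gen q R from LinearMap.congr_fun this v
    exact b.ext fun i => by simpa using h₁ i
  have h₂' : ∀ ξ, F (dualGen q R ξ) = dualGen q R ξ := by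
    intro ξ
    suffices F.toLinearMap ∘ₗ dualGen q R = dualGen q R from LinearMap.congr_fun this ξ
    exact b.dualBasis.ext fun i => by simpa using h₂ i
  refine ⟨F.toLinearMap, fun n m x hx => ?_⟩
  rw [AlgHom.toLinearMap_apply]
  induction hx using Submodule.span_induction with
  | zero => simp
  | add x y _ _ hx hy => rw [map_add, hx, hy, smul_add]
  | smul t x _ hx => rw [map_smul, hx, smul_comm]
  | mem x hx =>
    induction hx with
    | one => simp
    | gen_mul v _ ih => rw [map_mul, h₁', ih, pow_succ]; simp
    | dualGen_mul ξ _ ih => rw [map_mul, h₂', ih, mul_smul_comm]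

/-- The quantification over all larger sets T lets two elements be added over the union of their
supports. -/
theorem exists_sum_gradeProj (x : Koszul q R) :
    ∃ S : Finset (ℕ × ℕ), ∀ T, S ⊆ T → ∑ i ∈ T, gradeProj q R i x = x := by
  have hx : x ∈ ⨆ p : ℕ × ℕ, grade q R p.1 p.2 := by rw [iSup_grade]; trivial
  induction hx using Submodule.iSup_induction' with
  | zero => exact ⟨∅, by simp⟩
  | add x y _ _ hx hy =>
    obtain ⟨S, hS⟩ := hx
    obtain ⟨T, hT⟩ := hy
    refine ⟨S ∪ T, fun W hW => ?_⟩
    simp only [map_add, Finset.sum_add_distrib]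
    rw [hS W (Finset.union_subset_left hW), hT W (Finset.union_subset_right hW)]
  | mem j x hx =>
    refine ⟨{j}, fun T hT => ?_⟩
    have hj : j ∈ T := hT (Finset.mem_singleton_self j)
    simp only [gradeProj_of_mem hx, Finset.sum_ite_eq', hj, if_true]

variable (q R) in
theorem iSup_berGrade : ⨆ p : ℕ × ℕ, berGrade q R p.1 p.2 = ⊤ := by
  rw [eq_top_iff]
  rintro z -
  obtain ⟨x, rfl⟩ := Submodule.mkQ_surjective _ z
  obtain ⟨S, hS⟩ := exists_sum_gradeProj (x : Koszul q R)
  have : x = ∑ i ∈ S, ⟨gradeProj q R i x, gradeProj_mem_ker i x.2⟩ :=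
    Subtype.ext (by simp [hS S subset_rfl])
  rw [this, map_sum]
  exact Submodule.sum_mem _ fun i _ => Submodule.mem_iSup_of_mem i ⟨_, gradeProj_mem i _, rfl⟩

/-- Since D is homogeneous, the projections preserve its kernel and image and descend to the
cohomology, where the same principle applies. -/
theorem eq_berGrade_of_le {G : ℕ × ℕ → Submodule k (Ber q R)}
    (hle : ∀ i, G i ≤ berGrade q R i.1 i.2) (htop : ⨆ i, G i = ⊤) (i : ℕ × ℕ) :
    G i = berGrade q R i.1 i.2 := by
  let f : ℕ × ℕ → LinearMap.ker (diff q R) →ₗ[k] LinearMap.ker (diff q R) := fun i =>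
    (gradeProj q R i).restrict fun _ => gradeProj_mem_ker i
  have hf : ∀ i, (LinearMap.range (diff q R)).submoduleOf (LinearMap.ker (diff q R)) ≤
      ((LinearMap.range (diff q R)).submoduleOf (LinearMap.ker (diff q R))).comap (f i) := by
    rintro i ⟨_, _⟩ ⟨x, rfl⟩
    exact gradeProj_diff_mem_range i x
  let P : ℕ × ℕ → Ber q R →ₗ[k] Ber q R := fun i => Submodule.mapQ _ _ (f i) (hf i)
  have hP : ∀ i j : ℕ × ℕ, ∀ x ∈ berGrade q R j.1 j.2, P i x = if i = j then x else 0 := by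
    rintro i j _ ⟨x, hx, rfl⟩
    have : f i x = if i = j then x else 0 := by
      refine Subtype.ext ((gradeProj_of_mem hx).trans ?_)
      split_ifs <;> rfl
    change berClass q R (f i x) = _
    rw [this]
    split_ifs
    · rfl
    · exact map_zero _
  have h₁ : ∀ i : ℕ × ℕ, ∀ x ∈ berGrade q R i.1 i.2, P i x = x :=
    fun i x hx => by rw [hP i i x hx, if_pos rfl]
  have h₂ : ∀ i j : ℕ × ℕ, i ≠ j → ∀ x ∈ berGrade q R j.1 j.2, P i x = 0 :=
    fun i j hij x hx => by rw [hP i j x hx, if_neg hij]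
  exact eq_of_le_of_iSup_eq_top (G := G) (G' := fun i : ℕ × ℕ => berGrade q R i.1 i.2)
    P h₁ h₂ hle htop i

end Parity

/-! ### The Berezinian of a Hecke sum. -/

section BerEquiv

variable {k : Type u} [Field k]
  {V : Type*} [AddCommGroup V] [Module k V] [FiniteDimensional k V]
  {U : Type*} [AddCommGroup U] [Module k U] [FiniteDimensional k U]
  {q : k} {R : V ⊗[k] V →ₗ[k] V ⊗[k] V} {R' : U ⊗[k] U →ₗ[k] U ⊗[k] U}
  {Q : U ⊗[k] V ≃ₗ[k] V ⊗[k] U}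

/-- The Künneth isomorphism for the Berezinian of a Hecke sum. -/
theorem exists_berEquiv [CharZero k] (hd : diff q R ∘ₗ diff q R = 0)
    (hd' : diff q R' ∘ₗ diff q R' = 0)
    {φ : Koszul q R ⊗[k] Koszul q R' ≃ₗ[k] Koszul q (heckeSum q R R' Q)}
    (hφ : ∀ n m, ∀ x ∈ grade q R n m, ∀ y : Koszul q R',
      diff q (heckeSum q R R' Q) (φ (x ⊗ₜ[k] y)) =
        φ (diff q R x ⊗ₜ[k] y + (-1 : k) ^ n • (x ⊗ₜ[k] diff q R' y))) :
    ∃ ψ : Ber q (heckeSum q R R' Q) ≃ₗ[k] Ber q R ⊗[k] Ber q R',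
      ∀ (x : LinearMap.ker (diff q R)) (y : LinearMap.ker (diff q R')),
        ∃ h : φ ((x : Koszul q R) ⊗ₜ[k] (y : Koszul q R')) ∈
            LinearMap.ker (diff q (heckeSum q R R' Q)),
          ψ (berClass q (heckeSum q R R' Q) ⟨_, h⟩) = berClass q R x ⊗ₜ[k] berClass q R' y := by
  obtain ⟨ε, hε⟩ := exists_parity q R
  have h₁ : ∀ x, ε (ε x) = x := by
    suffices ε ∘ₗ ε = LinearMap.id from LinearMap.congr_fun this
    refine hom_ext_of_grade fun n m x hx => ?_
    rw [LinearMap.comp_apply, hε n m x hx, map_smul, hε n m x hx, smul_smul, ← mul_pow]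
    simp
  have h₂ : ∀ x, diff q R (ε x) = -ε (diff q R x) := by
    suffices diff q R ∘ₗ ε = -(ε ∘ₗ diff q R) from LinearMap.congr_fun this
    refine hom_ext_of_grade fun n m x hx => ?_
    rw [LinearMap.comp_apply, hε n m x hx, map_smul, LinearMap.neg_apply, LinearMap.comp_apply,
      hε _ _ _ (diff_mem_grade hx), pow_succ, mul_neg_one, neg_smul, neg_neg]
  have h₃ : ∀ x y, diff q (heckeSum q R R' Q) (φ (x ⊗ₜ y)) =
      φ (diff q R x ⊗ₜ y + ε x ⊗ₜ diff q R' y) := by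
    intro x y
    have hx : x ∈ ⨆ p : ℕ × ℕ, grade q R p.1 p.2 := by rw [iSup_grade]; trivial
    induction hx using Submodule.iSup_induction' with
    | zero => simp
    | add x z _ _ hx hz =>
      simp only [TensorProduct.add_tmul, map_add, hx, hz]
      abel
    | mem p x hx => rw [hφ _ _ x hx, hε _ _ x hx, TensorProduct.smul_tmul']
  exact exists_kunneth_equiv (LinearMap.congr_fun hd) (LinearMap.congr_fun hd') h₁ h₂ φ h₃

/-- Only the inclusion for ψ⁻¹ is direct: it sends [x] ⊗ [y] to the class of φ(x ⊗ y), which is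
homogeneous. Equality follows because the images span the Berezinian. -/
theorem map_berGrade {φ : Koszul q R ⊗[k] Koszul q R' ≃ₗ[k] Koszul q (heckeSum q R R' Q)}
    (hφ : ∀ p r, (tensorGrade (grade q R) (grade q R') p r).map φ.toLinearMap =
      grade q (heckeSum q R R' Q) p r)
    {ψ : Ber q (heckeSum q R R' Q) ≃ₗ[k] Ber q R ⊗[k] Ber q R'}
    (hψ : ∀ (x : LinearMap.ker (diff q R)) (y : LinearMap.ker (diff q R')),
      ∃ h : φ ((x : Koszul q R) ⊗ₜ[k] (y : Koszul q R')) ∈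
          LinearMap.ker (diff q (heckeSum q R R' Q)),
        ψ (berClass q (heckeSum q R R' Q) ⟨_, h⟩) = berClass q R x ⊗ₜ[k] berClass q R' y)
    (p r : ℕ) : (berGrade q (heckeSum q R R' Q) p r).map ψ.toLinearMap =
      tensorGrade (berGrade q R) (berGrade q R') p r := by
  have hle : ∀ i : ℕ × ℕ, (tensorGrade (berGrade q R) (berGrade q R') i.1 i.2).map
      ψ.symm.toLinearMap ≤ berGrade q (heckeSum q R R' Q) i.1 i.2 := by
    rintro ⟨p, r⟩
    refine Submodule.map_le_iff_le_comap.2 (Submodule.span_le.2 ?_)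
    rintro _ ⟨n, m, i, j, rfl, rfl, _, ⟨x, hx, rfl⟩, _, ⟨y, hy, rfl⟩, rfl⟩
    obtain ⟨h, hxy⟩ := hψ x y
    rw [SetLike.mem_coe, Submodule.mem_comap, ← hxy, LinearEquiv.coe_coe,
      LinearEquiv.symm_apply_apply]
    refine ⟨_, ?_, rfl⟩
    change φ ((x : Koszul q R) ⊗ₜ[k] (y : Koszul q R')) ∈ grade q (heckeSum q R R' Q) _ _
    rw [← hφ]
    exact ⟨_, Submodule.subset_span ⟨n, m, i, j, rfl, rfl, x, hx, y, hy, rfl⟩, rfl⟩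
  have htop : ⨆ i : ℕ × ℕ, (tensorGrade (berGrade q R) (berGrade q R') i.1 i.2).map
      ψ.symm.toLinearMap = ⊤ := by
    rw [← Submodule.map_iSup, iSup_tensorGrade (iSup_berGrade q R) (iSup_berGrade q R'),
      Submodule.map_top, LinearMap.range_eq_top.2 ψ.symm.surjective]
  have := eq_berGrade_of_le (G := fun i : ℕ × ℕ =>
    (tensorGrade (berGrade q R) (berGrade q R') i.1 i.2).map ψ.symm.toLinearMap) hle htop (p, r)
  rw [← this, ← Submodule.map_comp]
  have e : ψ.toLinearMap ∘ₗ ψ.symm.toLinearMap = LinearMap.id := by ext; simp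
  rw [e, Submodule.map_id]

end BerEquiv

end HeckeKoszul

open HeckeKoszul in
theorem mainTheorem1 {k : Type*} [Field k] [CharZero k]
    {V : Type*} [AddCommGroup V] [Module k V] [FiniteDimensional k V]
    {U : Type*} [AddCommGroup U] [Module k U] [FiniteDimensional k U]
    (q : k) (R : V ⊗[k] V →ₗ[k] V ⊗[k] V) (R' : U ⊗[k] U →ₗ[k] U ⊗[k] U)
    (Q : U ⊗[k] V ≃ₗ[k] V ⊗[k] U)
    (hR : IsHecke q R) (hR' : IsHecke q R') (hQ : IsGluing R R' Q) :
    -- the three Koszul complexes are complexes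
    diff q R ∘ₗ diff q R = 0 ∧
    diff q R' ∘ₗ diff q R' = 0 ∧
    diff q (heckeSum q R R' Q) ∘ₗ diff q (heckeSum q R R' Q) = 0 ∧
    ∃ φ : Koszul q R ⊗[k] Koszul q R' ≃ₗ[k] Koszul q (heckeSum q R R' Q),
      -- `φ` is the multiplication map, which is unique
      IsMulMap q R R' Q φ.toLinearMap ∧
      (∀ f, IsMulMap q R R' Q f → f = φ.toLinearMap) ∧
      -- `φ` is an isomorphism of bigraded spaces
      (∀ p r, (tensorGrade (grade q R) (grade q R') p r).map φ.toLinearMap =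
        grade q (heckeSum q R R' Q) p r) ∧
      -- `φ` intertwines the differentials
      (∀ n m, ∀ x ∈ grade q R n m, ∀ y : Koszul q R',
        diff q (heckeSum q R R' Q) (φ (x ⊗ₜ[k] y)) =
          φ (diff q R x ⊗ₜ[k] y + (-1 : k) ^ n • (x ⊗ₜ[k] diff q R' y))) ∧
      -- the inverse of `φ` induces an isomorphism of bigraded spaces on cohomology
      ∃ ψ : Ber q (heckeSum q R R' Q) ≃ₗ[k] Ber q R ⊗[k] Ber q R',
        (∀ (x : LinearMap.ker (diff q R)) (y : LinearMap.ker (diff q R')),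
          ∃ h : φ ((x : Koszul q R) ⊗ₜ[k] (y : Koszul q R')) ∈
              LinearMap.ker (diff q (heckeSum q R R' Q)),
            ψ (berClass q (heckeSum q R R' Q) ⟨_, h⟩) =
              berClass q R x ⊗ₜ[k] berClass q R' y) ∧
        (∀ p r, (berGrade q (heckeSum q R R' Q) p r).map ψ.toLinearMap =
          tensorGrade (berGrade q R) (berGrade q R') p r) := by
  have hd := diff_comp_diff R hR.q_ne_zero hR.q_sq_ne
  have hd' := diff_comp_diff R' hR.q_ne_zero hR.q_sq_ne
  obtain ⟨φ, hφ⟩ := exists_mulEquiv hR hR' hQ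
  have hφ : IsOrderedMul q R R' Q hR.q_ne_zero φ.toLinearMap := hφ
  have hgrade := hφ.map_tensorGrade hR.braid φ.surjective
  have hdiff : ∀ n m, ∀ x ∈ grade q R n m, ∀ y : Koszul q R',
      diff q (heckeSum q R R' Q) (φ (x ⊗ₜ[k] y)) =
        φ (diff q R x ⊗ₜ[k] y + (-1 : k) ^ n • (x ⊗ₜ[k] diff q R' y)) :=
    fun n m x hx y => hφ.diff_apply hR.braid hx y
  obtain ⟨ψ, hψ⟩ := exists_berEquiv hd hd' hdiff
  exact ⟨hd, hd', diff_comp_diff _ hR.q_ne_zero hR.q_sq_ne, φ, (isMulMap_iff hR.q_ne_zero).2 hφ,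
    fun f hf => ((isMulMap_iff hR.q_ne_zero).1 hf).eq hR.braid hφ, hgrade, hdiff, ψ, hψ,
    map_berGrade hgrade hψ⟩
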